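/- **Setting.** Let $\mathcal G$ be a digraph on the states $x_1,\dots,x_n$ (a link $x_u\to x_v$ means that the entry $a_{vu}$ of the system matrix $A$ is nonzero; all other entries vanish). Let $\Gamma_A$ be the bipartite graph with parts $\mathcal V^+$ and $\mathcal V^-$, two copies of the state set, and a link $(u^+,v^-)$ for every $x_u\to x_v$. A matching is a set of pairwise disjoint links of $\Gamma_A$, and $\delta M\subseteq\mathcal V^+$ is the set of $\mathcal V^+$-nodes not incident to the matching $M$. The auxiliary graph $\Gamma_A^M$ directs the links outside $M$ from $\mathcal V^+$ to $\mathcal V^-$ and those of $M$ from $\mathcal V^-$ to $\mathcal V^+$; $M$-alternating paths are directed paths of $\Gamma_A^M$ starting in $\delta M$. For $i\in\delta M$, the *contraction* $\mathcal C_M(i)$ is the set of $\mathcal V^+$-nodes reachable from $i$ by $M$-alternating paths (so $i\in \mathcal C_M(i)$). An $M$-augmenting path is an $M$-alternating path without repeated nodes from $\delta M$ to a node of $\mathcal V^-$ not incident to $M$. A *parent SCC* is a strongly connected component of $\mathcal G$ without outgoing links. There are $m$ sensors; sensor $s$ measures the single state $x_{\sigma(s)}$, that is, $H_s$ is a row whose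 only nonzero entry is in position $\sigma(s)$. The sensors use neighborhoods $\mathcal N_\alpha(s)\ni s$ for sharing measurements and $\mathcal N_\beta(s)\ni s$ for sharing predictions; $W$ is a nonnegative row-stochastic $m\times m$ matrix with $w_{st}\ne0$ iff $t\in\mathcal N_\beta(s)$, and $D_H=\mathrm{blockdiag}_s\bigl(\sum_{t\in\mathcal N_\alpha(s)}H_t^\top H_t\bigr)$. The network is *structurally observable* if $(A,H)$ is observable for some choice of the (nonzero) values of the nonzero entries of $A,H$, and *structurally distributed observable* if $(W\otimes A,D_H)$ is observable for some choice of the values of the nonzero entries of $A,H,W$ (with $W$ row-stochastic). **(1) Recovery.** Let $M$ be a maximum matching of $\Gamma_A$, $i\in\delta M$ and $j\in\mathcal C_M(i)$. Then $j\in\delta M'$ for some maximum matching $M'$. Suppose further that * every state of $\delta M$ is measured, and at least one state of every parent SCC is measured; * each sensor measuring a state of $\delta M$ (an $\alpha$-sensor) belongs to $\mathcal N_\alpha(s)$ for every sensor $s$, and the network given by $\mathcal N_\beta$ is strongly connected; * sensor $f$, with $\sigma(f)=i$, fails, and if $x_i$ lies in a parent SCC that does not contain $x_j$, then some sensor other than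 $f$ measures a state of that SCC. Then, after $f$ is replaced by a sensor with the same network connections that measures $x_j$, the network is structurally observable and structurally distributed observable. **(2) Correctness of the contraction detection algorithm.** The algorithm starts with a matching $M_0$, replaces the current matching $M$ by $M\oplus P$ for an $M$-augmenting path $P$ as long as one exists, and then returns $\mathcal C_M(i)$ for the nodes $i\in\delta M$ of the final matching $M$. Starting from any matching, after $k$ augmentations the current set is a matching of size $|M_0|+k$, and $k\le n$; the loop can be run to its end, and whenever it ends, the final matching is maximum. **(3) Running time.** There are a program for a random access machine (registers, two-dimensional arrays, unit-cost copy, increment, decrement, load, store and comparison) and a constant $C$ such that for every $n$ and every digraph on $n$ states there is an outcome $M$ of the loop in (2) such that for every set $Q$ of queried states, the program, given the adjacency matrix and $Q$, outputs $M$ and all contractions $\mathcal C_M(i)$, $i\in Q\cap\delta M$, in at most $$C\Bigl(n^{5/2}+\sum_{i\in Q\cap\delta M}|\mathcal C_M(i)|^2+1\Bigr)$$ steps. Thus the contraction of one failed sensor is found in $O(n^{5/2})$ steps; so are all contractions together if they are pairwise disjoint or if $|\delta M|=O(\sqrt n)$; and all contractions are always found in polynomial time $O(n^3)$. -/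

import Mathlib

open scoped Matrix Kronecker

namespace SensorRecovery

/-! ### Observability and its structural versions -/

/-- Observability of the discrete-time pair `(F, G)`: the state is determined by the outputs,
that is, the only initial state with identically vanishing outputs `G Fᵏ x` is `0`. -/
def Observable {p q : Type*} [Fintype p] [DecidableEq p] (F : Matrix p p ℝ)
    (G : Matrix q p ℝ) : Prop :=
  ∀ x : p → ℝ, (∀ k : ℕ, G *ᵥ ((F ^ k) *ᵥ x) = 0) → x = 0

/-- `A` is a numerical realization of the state digraph `E`
(`E u v` is the link `x_u → x_v`, present exactly when the entry `a_{vu}` is nonzero). -/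
def Realizes {n : ℕ} (E : Fin n → Fin n → Prop) (A : Matrix (Fin n) (Fin n) ℝ) : Prop :=
  ∀ u v, A v u ≠ 0 ↔ E u v

/-- The measurement matrix: sensor `s` measures the single state `σ s`, with gain `h s`. -/
def measurement {n m : ℕ} (σ : Fin m → Fin n) (h : Fin m → ℝ) : Matrix (Fin m) (Fin n) ℝ :=
  Matrix.of fun s => Pi.single (σ s) (h s)

/-- Structural observability: some numerical values of the nonzero entries of `A` and `H`
give an observable pair. -/
def StructurallyObservable {n m : ℕ} (E : Fin n → Fin n → Prop) (σ : Fin m → Fin n) : Prop :=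
  ∃ (A : Matrix (Fin n) (Fin n) ℝ) (h : Fin m → ℝ),
    Realizes E A ∧ (∀ s, h s ≠ 0) ∧ Observable A (measurement σ h)

open Classical in
/-- The matrix `D_H = blockdiag (∑_{t ∈ N_α(s)} H_tᵀ H_t)_s`, where `H_t` is the row `t` of `H` and
`Nα s t` means that `t` belongs to the neighborhood `N_α(s)`. -/
noncomputable def fusedMeasurement {n m : ℕ} (Nα : Fin m → Fin m → Prop)
    (H : Matrix (Fin m) (Fin n) ℝ) : Matrix (Fin m × Fin n) (Fin m × Fin n) ℝ :=
  Matrix.reindex (Equiv.prodComm _ _) (Equiv.prodComm _ _)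
    (Matrix.blockDiagonal fun s : Fin m =>
      ∑ t ∈ Finset.univ.filter (fun t => Nα s t), Matrix.vecMulVec (H t) (H t))

/-- `W` is a fusion matrix of the network `Nβ`: nonnegative, row-stochastic, with nonzero entries
exactly at the pairs `(s, t)` with `t` in the neighborhood `N_β(s)`. -/
def IsFusionMatrix {m : ℕ} (Nβ : Fin m → Fin m → Prop) (W : Matrix (Fin m) (Fin m) ℝ) : Prop :=
  (∀ s t, 0 ≤ W s t) ∧ (∀ s t, W s t ≠ 0 ↔ Nβ s t) ∧ ∀ s, ∑ t, W s t = 1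

/-- Structural distributed observability: some numerical values of the nonzero entries of
`A`, `H`, `W` (with `W` row-stochastic) make `(W ⊗ A, D_H)` observable. -/
def StructurallyDistributedObservable {n m : ℕ} (E : Fin n → Fin n → Prop) (σ : Fin m → Fin n)
    (Nα Nβ : Fin m → Fin m → Prop) : Prop :=
  ∃ (A : Matrix (Fin n) (Fin n) ℝ) (h : Fin m → ℝ) (W : Matrix (Fin m) (Fin m) ℝ),
    Realizes E A ∧ (∀ s, h s ≠ 0) ∧ IsFusionMatrix Nβ W ∧
      Observable (W ⊗ₖ A) (fusedMeasurement Nα (measurement σ h))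

/-! ### Strongly connected components of the state digraph -/

/-- The strongly connected component of the node `v`. -/
def scc {n : ℕ} (E : Fin n → Fin n → Prop) (v : Fin n) : Set (Fin n) :=
  {w | Relation.ReflTransGen E v w ∧ Relation.ReflTransGen E w v}

/-- A parent SCC: a strongly connected component without outgoing links. -/
def IsParentSCC {n : ℕ} (E : Fin n → Fin n → Prop) (P : Set (Fin n)) : Prop :=
  (∃ v, P = scc E v) ∧ ∀ u ∈ P, ∀ w, E u w → w ∈ P

/-! ### Matchings of the bipartite graph `Γ_A`, contractions -/

/-- A matching of `Γ_A`: a set of links `(u⁺, v⁻)`, with `x_u → x_v`, no two of which share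
their start-node in `V⁺` or their end-node in `V⁻`. -/
def IsMatching {n : ℕ} (E : Fin n → Fin n → Prop) (M : Finset (Fin n × Fin n)) : Prop :=
  (∀ e ∈ M, E e.1 e.2) ∧ ∀ e ∈ M, ∀ e' ∈ M, (e.1 = e'.1 ∨ e.2 = e'.2) → e = e'

/-- A matching of maximum cardinality. -/
def IsMaximumMatching {n : ℕ} (E : Fin n → Fin n → Prop) (M : Finset (Fin n × Fin n)) : Prop :=
  IsMatching E M ∧ ∀ M', IsMatching E M' → M'.card ≤ M.card

/-- `δM`: the nodes of `V⁺` that are not incident to `M`. -/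
def unmatched {n : ℕ} (M : Finset (Fin n × Fin n)) : Finset (Fin n) :=
  Finset.univ \ M.image Prod.fst

/-- The links of the auxiliary graph `Γ_A^M` on `V⁺ ⊔ V⁻` (`inl u = u⁺`, `inr v = v⁻`):
links outside `M` run from `V⁺` to `V⁻`, links of `M` are reversed. -/
inductive AuxLink {n : ℕ} (E : Fin n → Fin n → Prop) (M : Finset (Fin n × Fin n)) :
    Fin n ⊕ Fin n → Fin n ⊕ Fin n → Prop
  | free (u v : Fin n) : E u v → (u, v) ∉ M → AuxLink E M (.inl u) (.inr v)
  | matched (u v : Fin n) : (u, v) ∈ M → AuxLink E M (.inr v) (.inl u)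

/-- The contraction of `i ∈ δM`: the nodes of `V⁺` reachable from `i` by `M`-alternating paths,
that is, by directed paths of the auxiliary graph (the path without links is allowed). -/
def contraction {n : ℕ} (E : Fin n → Fin n → Prop) (M : Finset (Fin n × Fin n)) (i : Fin n) :
    Set (Fin n) :=
  {j | Relation.ReflTransGen (AuxLink E M) (.inl i) (.inl j)}

/-! ### The contraction detection algorithm -/

/-- An `M`-augmenting path: an alternating path without repeated nodes from an unmatched node
of `V⁺` to an unmatched node of `V⁻`. -/
def IsAugmentingPath {n : ℕ} (E : Fin n → Fin n → Prop) (M : Finset (Fin n × Fin n))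
    (p : List (Fin n ⊕ Fin n)) : Prop :=
  p.Nodup ∧ p.IsChain (AuxLink E M) ∧ (∃ u ∈ unmatched M, p.head? = some (.inl u)) ∧
    ∃ v, v ∉ M.image Prod.snd ∧ p.getLast? = some (.inr v)

open Classical in
/-- The links of `Γ_A` traversed by a path. -/
noncomputable def pathLinks {n : ℕ} (p : List (Fin n ⊕ Fin n)) : Finset (Fin n × Fin n) :=
  Finset.univ.filter fun e =>
    [Sum.inl e.1, Sum.inr e.2] <:+: p ∨ [Sum.inr e.2, Sum.inl e.1] <:+: p

/-- `AugmentIter E k M M'`: `M'` arises from `M` by `k` passes `M := M ⊕ P`, each with some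
augmenting path `P` of the current matching. -/
inductive AugmentIter {n : ℕ} (E : Fin n → Fin n → Prop) :
    ℕ → Finset (Fin n × Fin n) → Finset (Fin n × Fin n) → Prop
  | zero (M : Finset (Fin n × Fin n)) : AugmentIter E 0 M M
  | succ (k : ℕ) (M M' : Finset (Fin n × Fin n)) (p : List (Fin n ⊕ Fin n)) :
      AugmentIter E k M M' → IsAugmentingPath E M' p →
        AugmentIter E (k + 1) M (symmDiff M' (pathLinks p))

/-- The while loop of the algorithm, started with the matching `M₀`, can end with `M`. -/
def AugmentLoopEnds {n : ℕ} (E : Fin n → Fin n → Prop) (M₀ M : Finset (Fin n × Fin n)) : Prop :=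
  (∃ k, AugmentIter E k M₀ M) ∧ ¬ ∃ p, IsAugmentingPath E M p

/-! ### The machine model

A random access machine with numbered registers and numbered two-dimensional arrays of natural
numbers. Registers can be set to a constant, copied, incremented and decremented, array entries
are addressed by two registers. One step is counted for every elementary instruction and for
every evaluation of a test. A number grows by at most one per step, so nothing is gained by
packing data into large numbers. -/

/-- A memory state: the contents of the registers and of the arrays. -/
structure Store where
  reg : ℕ → ℕ
  arr : ℕ → ℕ → ℕ → ℕ

/-- The tests: comparison of two registers. -/
inductive Test
  | eq (i j : ℕ)
  | lt (i j : ℕ)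

/-- Truth of a test in a memory state. -/
def Test.holds (s : Store) : Test → Prop
  | .eq i j => s.reg i = s.reg j
  | .lt i j => s.reg i < s.reg j

/-- Programs. -/
inductive Prog
  | setConst (d k : ℕ)
  | copy (d i : ℕ)
  | incr (d : ℕ)
  | decr (d : ℕ)
  | load (d a i j : ℕ)
  | store (a i j d : ℕ)
  | seq (c₁ c₂ : Prog)
  | ite (b : Test) (c₁ c₂ : Prog)
  | loop (b : Test) (c : Prog)

/-- Assignment to a register. -/
def Store.setReg (s : Store) (d x : ℕ) : Store :=
  ⟨Function.update s.reg d x, s.arr⟩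

/-- Assignment to an array entry. -/
def Store.setArr (s : Store) (a i j x : ℕ) : Store :=
  ⟨s.reg, Function.update s.arr a
    (Function.update (s.arr a) i (Function.update (s.arr a i) j x))⟩

/-- `Exec c s t s'`: the program `c`, started in `s`, halts in `s'` after exactly `t` steps. -/
inductive Exec : Prog → Store → ℕ → Store → Prop
  | setConst (d k : ℕ) (s : Store) : Exec (.setConst d k) s 1 (s.setReg d k)
  | copy (d i : ℕ) (s : Store) : Exec (.copy d i) s 1 (s.setReg d (s.reg i))
  | incr (d : ℕ) (s : Store) : Exec (.incr d) s 1 (s.setReg d (s.reg d + 1))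
  | decr (d : ℕ) (s : Store) : Exec (.decr d) s 1 (s.setReg d (s.reg d - 1))
  | load (d a i j : ℕ) (s : Store) :
      Exec (.load d a i j) s 1 (s.setReg d (s.arr a (s.reg i) (s.reg j)))
  | store (a i j d : ℕ) (s : Store) :
      Exec (.store a i j d) s 1 (s.setArr a (s.reg i) (s.reg j) (s.reg d))
  | seq (c₁ c₂ : Prog) (s s' s'' : Store) (t₁ t₂ : ℕ) :
      Exec c₁ s t₁ s' → Exec c₂ s' t₂ s'' → Exec (.seq c₁ c₂) s (t₁ + t₂) s''
  | ite_true (b : Test) (c₁ c₂ : Prog) (s s' : Store) (t : ℕ) :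
      b.holds s → Exec c₁ s t s' → Exec (.ite b c₁ c₂) s (t + 1) s'
  | ite_false (b : Test) (c₁ c₂ : Prog) (s s' : Store) (t : ℕ) :
      ¬ b.holds s → Exec c₂ s t s' → Exec (.ite b c₁ c₂) s (t + 1) s'
  | loop_true (b : Test) (c : Prog) (s s' s'' : Store) (t₁ t₂ : ℕ) :
      b.holds s → Exec c s t₁ s' → Exec (.loop b c) s' t₂ s'' →
        Exec (.loop b c) s (t₁ + t₂ + 1) s''
  | loop_false (b : Test) (c : Prog) (s : Store) :
      ¬ b.holds s → Exec (.loop b c) s 1 s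

open Classical in
/-- The input: register `0` holds `n`, array `0` the adjacency matrix of the state digraph, row `0`
of array `1` the indicator of the set `Q` of the states whose contractions are asked for. All other
registers and entries are `0`. -/
noncomputable def inputStore {n : ℕ} (E : Fin n → Fin n → Prop) (Q : Finset (Fin n)) : Store where
  reg := fun r => if r = 0 then n else 0
  arr := fun a i j =>
    if a = 0 ∧ ∃ u v : Fin n, (u : ℕ) = i ∧ (v : ℕ) = j ∧ E u v then 1
    else if a = 1 ∧ i = 0 ∧ ∃ u ∈ Q, (u : ℕ) = j then 1
    else 0

open Classical in
/-- The output: row `0` of array `2` holds the matching `M` (the entry `u` is `v + 1` if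
`(u, v) ∈ M`, and `0` if `u` is unmatched); for every `i ∈ Q ∩ δM`, row `i` of array `3` holds
the indicator of the contraction of `i`. -/
def IsOutput {n : ℕ} (E : Fin n → Fin n → Prop) (Q : Finset (Fin n)) (M : Finset (Fin n × Fin n))
    (s : Store) : Prop :=
  (∀ u v : Fin n, (u, v) ∈ M → s.arr 2 0 u = v + 1) ∧
  (∀ u ∈ unmatched M, s.arr 2 0 u = 0) ∧
  ∀ i ∈ Q ∩ unmatched M, ∀ j : Fin n,
    s.arr 3 i j = if j ∈ contraction E M i then 1 else 0

end SensorRecovery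

open SensorRecovery

namespace SensorRecovery

/-! ### Consecutive entries of lists -/

/-! Recovery. Exchanging `M` along an alternating path from i to j trades i for j among the
unmatched nodes. So some maximum matching M' has δM' = (δM \ {i}) ∪ {j}, and after the replacement
each node of δM' is measured by a sensor that belongs to every N_α(s). M' extends to a permutation π
of the states that follows links off δ = δM'. It remains to show that this, together with a walk
from every state to a measured one, gives both kinds of observability. All of it rests on one sparse
nonnegative matrix A (`exists_cactus`). The orbits of π that meet δ become nilpotent chains ending
in δ. Every other orbit is attached in turn as a cycle of weight w that is measured or has one link
into the part already built. An eigenvalue μ living on the new cycle satisfies μ^N = w^N for N the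
order of π, so all but finitely many w avoid the old spectrum and the frequencies at which the old
part hides its input (`finite_zeros`). This preserves observability and keeps the nonzero
eigenvalues semisimple. For the network, W is chosen invertible, with eigenvectors without zero
entries and with eigenvalues so close to 1 that products of eigenvalues of W and A determine the
factor from A. On an eigenspace of W ⊗ A for a nonzero eigenvalue, 1 ⊗ A is then a scalar, so v is
an eigenvector for both factors: what one sensor sees as zero is zero at all sensors
(`observable_kronecker`). For the eigenvalue 0 the kernel of A is detected on δ, by sensors heard
everywhere. Such a W comes from a generic combination of sparse matrices of the same kind for the
digraph Nβ, normalised by its Perron vector and moved towards the identity. Finally, observability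
is the nonvanishing of a Gramian determinant (`finite_not_observable`), so a small perturbation
fills in the missing links. Correctness is Berge's theorem: without augmenting paths the nodes
reachable from δM yield a König cover with as many nodes as `M` has links. Running time. An auction
with prices up to K finds a matching that misses a maximum one by at most n/K links, by approximate
linear programming duality (`Auction.card_le`). With K of order √n this takes O(nK) scans of cost
O(n), and O(K) breadth-first searches of cost O(n²) finish the matching. After successor lists have
been made in O(n²), each contraction C is explored in O(|C|²), since a node of C has at most |C|
successors. -/

theorem pair_infix_iff {α : Type*} {p : List α} {a b : α} :
    [a, b] <:+: p ↔ ∃ i, p[i]? = some a ∧ p[i + 1]? = some b := by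
  constructor
  · rintro ⟨s, t, rfl⟩
    refine ⟨s.length, ?_, ?_⟩ <;> simp
  · rintro ⟨i, ha, hb⟩
    obtain ⟨hi, rfl⟩ := List.getElem?_eq_some_iff.1 ha
    obtain ⟨hj, rfl⟩ := List.getElem?_eq_some_iff.1 hb
    refine ⟨p.take i, p.drop (i + 2), ?_⟩
    have h1 : p.drop i = p[i] :: p[i + 1] :: p.drop (i + 2) := by
      rw [List.drop_eq_getElem_cons hi, List.drop_eq_getElem_cons hj]
    have h2 : [p[i], p[i + 1]] ++ p.drop (i + 2) = p.drop i := by rw [h1]; rfl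
    rw [List.append_assoc, h2, List.take_append_drop]

theorem nodup_index_inj {α : Type*} {p : List α} (hp : p.Nodup) {a : α} {i j : ℕ}
    (hi : p[i]? = some a) (hj : p[j]? = some a) : i = j := by
  obtain ⟨hi', h1⟩ := List.getElem?_eq_some_iff.1 hi
  obtain ⟨hj', h2⟩ := List.getElem?_eq_some_iff.1 hj
  exact (List.Nodup.getElem_inj_iff hp).1 (h1.trans h2.symm)

theorem pair_infix_right_unique {α : Type*} {p : List α} (hp : p.Nodup) {a b b' : α}
    (h : [a, b] <:+: p) (h' : [a, b'] <:+: p) : b = b' := by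
  obtain ⟨i, hi, hi'⟩ := pair_infix_iff.1 h
  obtain ⟨j, hj, hj'⟩ := pair_infix_iff.1 h'
  obtain rfl := nodup_index_inj hp hi hj
  exact Option.some.inj (hi'.symm.trans hj')

theorem pair_infix_left_unique {α : Type*} {p : List α} (hp : p.Nodup) {a a' b : α}
    (h : [a, b] <:+: p) (h' : [a', b] <:+: p) : a = a' := by
  obtain ⟨i, hi, hi'⟩ := pair_infix_iff.1 h
  obtain ⟨j, hj, hj'⟩ := pair_infix_iff.1 h'
  have := nodup_index_inj hp hi' hj'
  obtain rfl : i = j := by omega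
  exact Option.some.inj (hi.symm.trans hj)

theorem exists_pair_infix_right {α : Type*} {p : List α} {a : α} (ha : a ∈ p)
    (hl : p.getLast? ≠ some a) : ∃ b, [a, b] <:+: p := by
  obtain ⟨i, hi, rfl⟩ := List.getElem_of_mem ha
  rcases Nat.lt_or_ge (i + 1) p.length with h | h
  · exact ⟨p[i + 1], pair_infix_iff.2 ⟨i, by simp [hi], by simp [h]⟩⟩
  · refine absurd ?_ hl
    rw [List.getLast?_eq_getElem?]
    obtain rfl : i = p.length - 1 := by omega
    simp [hi]

theorem exists_pair_infix_left {α : Type*} {p : List α} {b : α} (hb : b ∈ p)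
    (hh : p.head? ≠ some b) : ∃ a, [a, b] <:+: p := by
  obtain ⟨i, hi, rfl⟩ := List.getElem_of_mem hb
  rcases i with _ | i
  · refine absurd ?_ hh
    rw [List.head?_eq_getElem?]
    simp [hi]
  · exact ⟨p[i], pair_infix_iff.2 ⟨i, by simp, by simp [hi]⟩⟩

theorem pair_infix_ne_getLast {α : Type*} {p : List α} (hp : p.Nodup) {a b : α}
    (h : [a, b] <:+: p) : p.getLast? ≠ some a := by
  intro hl
  obtain ⟨i, hi, hi'⟩ := pair_infix_iff.1 h
  rw [List.getLast?_eq_getElem?] at hl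
  have := nodup_index_inj hp hi hl
  have h2 := (List.getElem?_eq_some_iff.1 hi').1
  omega

theorem pair_infix_rel {α : Type*} {R : α → α → Prop} {p : List α} (hp : p.IsChain R) {a b : α}
    (h : [a, b] <:+: p) : R a b := by
  have := hp.infix h
  simpa using this

/-- Every walk can be shortened to a path without repetitions. -/
theorem exists_nodup_chain {α : Type*} {R : α → α → Prop} {a b : α}
    (h : Relation.ReflTransGen R a b) :
    ∃ p : List α, p.Nodup ∧ p.IsChain R ∧ p.head? = some a ∧ p.getLast? = some b := by
  induction h using Relation.ReflTransGen.head_induction_on with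
  | refl => exact ⟨[b], by simp⟩
  | @head a c hac _ ih =>
    obtain ⟨p, hn, hc, hh, hl⟩ := ih
    by_cases ha : a ∈ p
    · obtain ⟨s, t, rfl⟩ := List.append_of_mem ha
      refine ⟨a :: t, ?_, ?_, rfl, ?_⟩
      · exact hn.sublist (List.sublist_append_right _ _)
      · exact hc.infix ⟨s, [], by simp⟩
      · simpa [List.getLast?_append] using hl
    · refine ⟨a :: p, List.nodup_cons.2 ⟨ha, hn⟩, ?_, rfl, ?_⟩
      · rcases p with _ | ⟨d, p⟩
        · simp
        · simp only [List.head?_cons, Option.some.injEq] at hh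
          subst hh
          exact List.isChain_cons_cons.2 ⟨hac, hc⟩
      · rcases p with _ | ⟨d, p⟩
        · simp at hl
        · simpa [List.getLast?_cons_cons] using hl

/-! ### Exchange along alternating paths -/

section Exchange

variable {n : ℕ} {E : Fin n → Fin n → Prop} {M : Finset (Fin n × Fin n)}

theorem mem_unmatched {u : Fin n} : u ∈ unmatched M ↔ ∀ v, (u, v) ∉ M := by
  simp [unmatched]

theorem auxLink_inl_inr {u v : Fin n} :
    AuxLink E M (.inl u) (.inr v) ↔ E u v ∧ (u, v) ∉ M :=
  ⟨fun h => by cases h; exact ⟨‹_›, ‹_›⟩, fun h => .free _ _ h.1 h.2⟩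

theorem auxLink_inr_inl {u v : Fin n} : AuxLink E M (.inr v) (.inl u) ↔ (u, v) ∈ M :=
  ⟨fun h => by cases h; assumption, fun h => .matched _ _ h⟩

theorem not_auxLink_inl_inl {u v : Fin n} : ¬ AuxLink E M (.inl u) (.inl v) := by rintro ⟨⟩

theorem not_auxLink_inr_inr {u v : Fin n} : ¬ AuxLink E M (.inr u) (.inr v) := by rintro ⟨⟩

theorem mem_pathLinks {p : List (Fin n ⊕ Fin n)} {u v : Fin n} :
    (u, v) ∈ pathLinks p ↔ [Sum.inl u, Sum.inr v] <:+: p ∨ [Sum.inr v, Sum.inl u] <:+: p := by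
  simp [pathLinks]

/-- Membership in `M ⊕ P` for an alternating path `P`. -/
theorem mem_symmDiff_pathLinks {p : List (Fin n ⊕ Fin n)} (hc : p.IsChain (AuxLink E M))
    {u v : Fin n} : (u, v) ∈ symmDiff M (pathLinks p) ↔
      ((u, v) ∈ M ∧ ¬ [Sum.inr v, Sum.inl u] <:+: p) ∨ [Sum.inl u, Sum.inr v] <:+: p := by
  rw [Finset.mem_symmDiff, mem_pathLinks]
  have h1 : [Sum.inl u, Sum.inr v] <:+: p → (u, v) ∉ M := fun h =>
    (auxLink_inl_inr.1 (pair_infix_rel hc h)).2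
  have h2 : [Sum.inr v, Sum.inl u] <:+: p → (u, v) ∈ M := fun h =>
    auxLink_inr_inl.1 (pair_infix_rel hc h)
  tauto

/-- The only danger is a surviving link of `M` meeting a link added by the path. At a shared node of
V⁺, either the node is the unmatched start, or the path entered it through its link of `M`, which is
then removed. At a shared node of V⁻ the path leaves through the link of `M`, unless it ends there,
and `hl` handles that case. Paths ending in V⁺ are allowed too. -/
theorem isMatching_symmDiff_pathLinks (hM : IsMatching E M) {p : List (Fin n ⊕ Fin n)}
    (hn : p.Nodup) (hc : p.IsChain (AuxLink E M)) {i : Fin n} (hi : i ∈ unmatched M)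
    (hh : p.head? = some (.inl i))
    (hl : ∀ v, p.getLast? = some (.inr v) → v ∉ M.image Prod.snd) :
    IsMatching E (symmDiff M (pathLinks p)) := by
  have key : ∀ u v u' v', (u, v) ∈ M → ¬ [Sum.inr v, Sum.inl u] <:+: p →
      [Sum.inl u', Sum.inr v'] <:+: p → ¬ (u = u' ∨ v = v') := by
    rintro u v u' v' h h' h'' (rfl | rfl)
    · have hu : Sum.inl u ∈ p := h''.subset (by simp)
      by_cases hiu : u = i
      · subst hiu; exact mem_unmatched.1 hi _ h
      · obtain ⟨a, ha⟩ := exists_pair_infix_left hu (by rw [hh]; simpa using fun h => hiu h.symm)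
        rcases a with a | a
        · exact not_auxLink_inl_inl (pair_infix_rel hc ha)
        · have := auxLink_inr_inl.1 (pair_infix_rel hc ha)
          have := hM.2 _ h _ this (Or.inl rfl)
          simp only [Prod.mk.injEq, true_and] at this
          subst this
          exact h' ha
    · have hv : Sum.inr v ∈ p := h''.subset (by simp)
      by_cases hlv : p.getLast? = some (.inr v)
      · exact hl v hlv (Finset.mem_image_of_mem Prod.snd h)
      · obtain ⟨b, hb⟩ := exists_pair_infix_right hv hlv
        rcases b with b | b
        · have := auxLink_inr_inl.1 (pair_infix_rel hc hb)
          have := hM.2 _ h _ this (Or.inr rfl)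
          simp only [Prod.mk.injEq, and_true] at this
          subst this
          exact h' hb
        · exact not_auxLink_inr_inr (pair_infix_rel hc hb)
  refine ⟨?_, ?_⟩
  · rintro ⟨u, v⟩ h
    rcases (mem_symmDiff_pathLinks hc).1 h with h | h
    · exact hM.1 _ h.1
    · exact (auxLink_inl_inr.1 (pair_infix_rel hc h)).1
  · rintro ⟨u, v⟩ h ⟨u', v'⟩ h' he
    rcases (mem_symmDiff_pathLinks hc).1 h with h | h <;>
      rcases (mem_symmDiff_pathLinks hc).1 h' with h' | h'
    · exact hM.2 _ h.1 _ h'.1 he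
    · exact absurd he (key _ _ _ _ h.1 h.2 h')
    · exact absurd (he.imp Eq.symm Eq.symm) (key _ _ _ _ h'.1 h'.2 h)
    · simp only at he
      rcases he with rfl | rfl
      · simpa using pair_infix_right_unique hn h h'
      · simpa using pair_infix_left_unique hn h h'

/-- The unmatched nodes of `M ⊕ P`: the start-node leaves, an end-node in `V⁺` enters. -/
theorem mem_unmatched_symmDiff (hM : IsMatching E M) {p : List (Fin n ⊕ Fin n)}
    (hn : p.Nodup) (hc : p.IsChain (AuxLink E M)) {i : Fin n} (hi : i ∈ unmatched M)
    (hh : p.head? = some (.inl i)) (u : Fin n) :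
    u ∈ unmatched (symmDiff M (pathLinks p)) ↔
      (u ∈ unmatched M ∧ u ≠ i) ∨ p.getLast? = some (.inl u) := by
  have hip : Sum.inl i ∈ p := List.mem_of_head? hh
  simp only [mem_unmatched (M := symmDiff M (pathLinks p)), mem_symmDiff_pathLinks hc]
  have next : ∀ w, Sum.inl w ∈ p → p.getLast? ≠ some (.inl w) →
      ∃ v, [Sum.inl w, Sum.inr v] <:+: p := by
    intro w hw hl
    obtain ⟨b, hb⟩ := exists_pair_infix_right hw hl
    rcases b with b | b
    · exact absurd (pair_infix_rel hc hb) not_auxLink_inl_inl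
    · exact ⟨b, hb⟩
  constructor
  · intro h
    by_contra hcon
    push Not at hcon
    obtain ⟨h1, h2⟩ := hcon
    by_cases hup : Sum.inl u ∈ p
    · obtain ⟨v, hv⟩ := next u hup h2
      exact h v (Or.inr hv)
    · have hui : u ≠ i := by rintro rfl; exact hup hip
      have : u ∉ unmatched M := fun h => hui (h1 h)
      rw [mem_unmatched] at this
      push Not at this
      obtain ⟨v, hv⟩ := this
      exact h v (Or.inl ⟨hv, fun h => hup (h.subset (by simp))⟩)
  · rintro (⟨h1, h2⟩ | h) v (h' | h')
    · exact mem_unmatched.1 h1 _ h'.1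
    · obtain ⟨a, ha⟩ := exists_pair_infix_left (h'.subset (by simp : Sum.inl u ∈ _))
        (by rw [hh]; simpa using fun h => h2 h.symm)
      rcases a with a | a
      · exact not_auxLink_inl_inl (pair_infix_rel hc ha)
      · exact mem_unmatched.1 h1 _ (auxLink_inr_inl.1 (pair_infix_rel hc ha))
    · have hup : Sum.inl u ∈ p := List.mem_of_getLast? h
      by_cases hiu : u = i
      · subst hiu; exact mem_unmatched.1 hi _ h'.1
      obtain ⟨a, ha⟩ := exists_pair_infix_left hup (by rw [hh]; simpa using fun h => hiu h.symm)
      rcases a with a | a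
      · exact not_auxLink_inl_inl (pair_infix_rel hc ha)
      · have := hM.2 _ (auxLink_inr_inl.1 (pair_infix_rel hc ha)) _ h'.1 (Or.inl rfl)
        simp only [Prod.mk.injEq, true_and] at this
        subst this
        exact h'.2 ha
    · exact pair_infix_ne_getLast hn h' h

theorem card_unmatched (hM : IsMatching E M) : (unmatched M).card + M.card = n := by
  have h1 : (M.image Prod.fst).card = M.card :=
    Finset.card_image_of_injOn fun e he e' he' h => hM.2 _ he _ he' (Or.inl h)
  have h2 : (M.image Prod.fst).card ≤ n := by simpa using Finset.card_le_univ (M.image Prod.fst)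
  rw [unmatched, Finset.card_sdiff_of_subset (Finset.subset_univ _), h1]
  simp only [Finset.card_univ, Fintype.card_fin]
  omega

theorem card_le_of_isMatching (hM : IsMatching E M) : M.card ≤ n := by
  have := card_unmatched hM; omega

/-- Since the path ends in V⁻, its start leaves δM and no node enters; the size of the new matching
follows by counting unmatched nodes. -/
theorem IsAugmentingPath.exchange (hM : IsMatching E M) {p : List (Fin n ⊕ Fin n)}
    (hp : IsAugmentingPath E M p) :
    IsMatching E (symmDiff M (pathLinks p)) ∧ (symmDiff M (pathLinks p)).card = M.card + 1 := by
  obtain ⟨hn, hc, ⟨i, hi, hh⟩, v, hv, hl⟩ := hp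
  have h1 : IsMatching E (symmDiff M (pathLinks p)) := by
    refine isMatching_symmDiff_pathLinks hM hn hc hi hh fun w hw => ?_
    obtain rfl : v = w := by simpa using hl.symm.trans hw
    exact hv
  have h2 : unmatched (symmDiff M (pathLinks p)) = (unmatched M).erase i := by
    ext u
    rw [mem_unmatched_symmDiff hM hn hc hi hh, hl, Finset.mem_erase]
    simp [and_comm]
  refine ⟨h1, ?_⟩
  have h3 := card_unmatched h1
  have h4 := card_unmatched hM
  have h5 := Finset.card_pos.2 ⟨i, hi⟩
  rw [h2, Finset.card_erase_of_mem hi] at h3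
  omega

/-- Moving the unmatched node `i` to a node of its contraction. -/
theorem exists_maximum_matching_of_contraction (hM : IsMaximumMatching E M) {i j : Fin n}
    (hi : i ∈ unmatched M) (hj : j ∈ contraction E M i) :
    ∃ M', IsMaximumMatching E M' ∧ ∀ u, u ∈ unmatched M' ↔ (u ∈ unmatched M ∧ u ≠ i) ∨ u = j := by
  obtain ⟨p, hn, hc, hh, hl⟩ := exists_nodup_chain hj
  have h1 : IsMatching E (symmDiff M (pathLinks p)) :=
    isMatching_symmDiff_pathLinks hM.1 hn hc hi hh fun w hw => by
      rw [hl] at hw; simp at hw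
  have h2 : ∀ u, u ∈ unmatched (symmDiff M (pathLinks p)) ↔
      (u ∈ unmatched M ∧ u ≠ i) ∨ u = j := fun u => by
    rw [mem_unmatched_symmDiff hM.1 hn hc hi hh, hl]
    simp [eq_comm]
  refine ⟨_, ⟨h1, fun M' hM' => (hM.2 M' hM').trans ?_⟩, h2⟩
  have h3 := card_unmatched h1
  have h4 := card_unmatched hM.1
  -- Maximality only needs that δ does not grow. An inclusion suffices, and it also covers j = i.
  have h5 : unmatched (symmDiff M (pathLinks p)) ⊆ insert j ((unmatched M).erase i) := by
    intro u hu
    rcases (h2 u).1 hu with h | h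
    · exact Finset.mem_insert_of_mem (Finset.mem_erase.2 h.symm)
    · exact Finset.mem_insert.2 (Or.inl h)
  have h6 := (Finset.card_le_card h5).trans (Finset.card_insert_le _ _)
  have h7 := Finset.card_pos.2 ⟨i, hi⟩
  rw [Finset.card_erase_of_mem hi] at h6
  omega

/-- Without augmenting paths, every node of `V⁻` reachable from `δM` is matched. -/
theorem mem_image_snd_of_reachable (hE : ¬ ∃ p, IsAugmentingPath E M p) {i v : Fin n}
    (hi : i ∈ unmatched M) (h : Relation.ReflTransGen (AuxLink E M) (.inl i) (.inr v)) :
    v ∈ M.image Prod.snd := by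
  by_contra hv
  obtain ⟨p, hn, hc, hh, hl⟩ := exists_nodup_chain h
  exact hE ⟨p, hn, hc, ⟨i, hi, hh⟩, v, hv, hl⟩

open Classical in
/-- A matching without augmenting paths is maximum. -/
theorem isMaximumMatching_of_not_augmenting (hM : IsMatching E M)
    (hE : ¬ ∃ p, IsAugmentingPath E M p) : IsMaximumMatching E M := by
  refine ⟨hM, fun M' hM' => ?_⟩
  -- Reachability from δM gives the König cover: the nodes of V⁺ outside `R` and those of V⁻ inside
  -- `R`. Every link is covered, every covering node is matched, and no link of `M` has two covering
  -- ends.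
  let R : Fin n ⊕ Fin n → Prop := fun x =>
    ∃ i ∈ unmatched M, Relation.ReflTransGen (AuxLink E M) (.inl i) x
  have hRM : ∀ u v, (u, v) ∈ M → (R (.inl u) ↔ R (.inr v)) := by
    intro u v huv
    constructor
    · rintro ⟨i, hi, h⟩
      rcases Relation.ReflTransGen.cases_tail h with h | ⟨w, hw, hw'⟩
      · obtain rfl : u = i := by simpa using h
        exact absurd huv (mem_unmatched.1 hi v)
      · rcases w with w | w
        · exact absurd hw' not_auxLink_inl_inl
        · have := hM.2 _ (auxLink_inr_inl.1 hw') _ huv (Or.inl rfl)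
          simp only [Prod.mk.injEq, true_and] at this
          subst this
          exact ⟨i, hi, hw⟩
    · rintro ⟨i, hi, h⟩
      exact ⟨i, hi, h.tail (auxLink_inr_inl.2 huv)⟩
  have hRE : ∀ u v, E u v → R (.inl u) → R (.inr v) := by
    intro u v huv hu
    by_cases h : (u, v) ∈ M
    · exact (hRM u v h).1 hu
    · obtain ⟨i, hi, h'⟩ := hu
      exact ⟨i, hi, h'.tail (auxLink_inl_inr.2 ⟨huv, h⟩)⟩
  have hfst : ∀ u, ¬ R (.inl u) → ∃ v, (u, v) ∈ M := by
    intro u hu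
    by_contra hcon
    push Not at hcon
    exact hu ⟨u, mem_unmatched.2 hcon, .refl⟩
  have hsnd : ∀ v, R (.inr v) → ∃ u, (u, v) ∈ M := by
    rintro v ⟨i, hi, h⟩
    simpa using mem_image_snd_of_reachable hE hi h
  -- every link of `M'` is mapped to the link of `M` that shares the covering node
  have cover : ∀ e ∈ M', ∃ e' ∈ M, if R (.inl e.1) then R (.inl e'.1) ∧ e'.2 = e.2 else
      e'.1 = e.1 := by
    rintro ⟨u, v⟩ he
    split_ifs with h
    · obtain ⟨w, hw⟩ := hsnd v (hRE u v (hM'.1 _ he) h)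
      exact ⟨(w, v), hw, (hRM w v hw).2 (hRE u v (hM'.1 _ he) h), rfl⟩
    · obtain ⟨w, hw⟩ := hfst u h
      exact ⟨(u, w), hw, rfl⟩
  choose! g hg hg' using cover
  refine Finset.card_le_card_of_injOn g hg fun e he e' he' h => ?_
  have h1 := hg' e he
  have h2 := hg' e' he'
  rw [h] at h1
  split_ifs at h1 h2 with h3 h4 h4
  · exact hM'.2 _ he _ he' (Or.inr (h1.2.symm.trans h2.2))
  · exact absurd (h2 ▸ h1.1) h4
  · exact absurd (h1 ▸ h2.1) h3
  · exact hM'.2 _ he _ he' (Or.inl (h1.symm.trans h2))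

theorem AugmentIter.isMatching {M₀ : Finset (Fin n × Fin n)} (hM₀ : IsMatching E M₀) {k : ℕ}
    (h : AugmentIter E k M₀ M) : IsMatching E M ∧ M.card = M₀.card + k := by
  induction h with
  | zero => exact ⟨hM₀, rfl⟩
  | succ k M M' p _ hp ih =>
    obtain ⟨h1, h2⟩ := ih hM₀
    obtain ⟨h3, h4⟩ := IsAugmentingPath.exchange h1 hp
    exact ⟨h3, by omega⟩

/-- A loop that could never stop would reach, after n + 1 passes, a matching with more than n links.
-/
theorem exists_augmentLoopEnds {M₀ : Finset (Fin n × Fin n)} (hM₀ : IsMatching E M₀) :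
    ∃ M, AugmentLoopEnds E M₀ M := by
  by_contra hcon
  have step : ∀ k, ∃ M, AugmentIter E k M₀ M := by
    intro k
    induction k with
    | zero => exact ⟨M₀, .zero _⟩
    | succ k ih =>
      obtain ⟨M, hM⟩ := ih
      by_cases hp : ∃ p, IsAugmentingPath E M p
      · obtain ⟨p, hp⟩ := hp
        exact ⟨_, .succ k M₀ M p hM hp⟩
      · exact absurd ⟨M, ⟨k, hM⟩, hp⟩ hcon
  obtain ⟨M, hM⟩ := step (n + 1)
  obtain ⟨h1, h2⟩ := hM.isMatching hM₀
  have := card_le_of_isMatching h1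
  omega

theorem augmentation_correct {M₀ : Finset (Fin n × Fin n)} (hM₀ : IsMatching E M₀) :
    (∀ k M, AugmentIter E k M₀ M → IsMatching E M ∧ M.card = M₀.card + k ∧ k ≤ n) ∧
      (∃ M, AugmentLoopEnds E M₀ M) ∧
      ∀ M, AugmentLoopEnds E M₀ M → IsMaximumMatching E M := by
  refine ⟨fun k M h => ?_, exists_augmentLoopEnds hM₀, ?_⟩
  · obtain ⟨h1, h2⟩ := h.isMatching hM₀
    have := card_le_of_isMatching h1
    exact ⟨h1, h2, by omega⟩
  · rintro M ⟨⟨k, hk⟩, h⟩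
    exact isMaximumMatching_of_not_augmenting (hk.isMatching hM₀).1 h

end Exchange

/-! ### A sparse observable realization -/

section Cactus

variable {ι : Type*} [Fintype ι] [DecidableEq ι]

/-- The action of a real matrix on complex vectors. -/
noncomputable def cAct (A : Matrix ι ι ℝ) : (ι → ℂ) →ₗ[ℂ] (ι → ℂ) :=
  Matrix.toLin' (A.map Complex.ofReal)

theorem cAct_apply (A : Matrix ι ι ℝ) (a : ι → ℂ) (v : ι) :
    cAct A a v = ∑ u, (A v u : ℂ) * a u := by
  simp [cAct, Matrix.mulVec, dotProduct]

/-- A nonnegative matrix supported on the links of `E` inside a `π`-invariant set `S`, observable on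
`S` from the set `meas`, with kernel detected by `δ`, and with semisimple nonzero eigenvalues. -/
structure Cactus (E : ι → ι → Prop) (π : Equiv.Perm ι) (δ meas : Set ι) (S : Set ι)
    (A : Matrix ι ι ℝ) : Prop where
  nonneg : ∀ v u, 0 ≤ A v u
  supp : ∀ v u, A v u ≠ 0 → E u v ∧ u ∈ S ∧ v ∈ S
  invariant : ∀ u, π u ∈ S ↔ u ∈ S
  sub : δ ⊆ S
  inj : ∀ (μ : ℂ) (a : ι → ℂ), (∀ u ∉ S, a u = 0) → cAct A a = μ • a → (∀ u ∈ δ, a u = 0) →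
    (μ = 0 ∨ ∀ u ∈ meas, a u = 0) → a = 0
  semisimple : ∀ (μ : ℂ) (a b : ι → ℂ), μ ≠ 0 → (∀ u ∉ S, a u = 0) → cAct A a = μ • a + b →
    cAct A b = μ • b → b = 0

variable {E : ι → ι → Prop} {π : Equiv.Perm ι} {δ meas S : Set ι} {A : Matrix ι ι ℝ}

theorem Cactus.cAct_eq_zero (h : Cactus E π δ meas S A) (a : ι → ℂ) {v : ι} (hv : v ∉ S) :
    cAct A a v = 0 := by
  rw [cAct_apply]
  refine Finset.sum_eq_zero fun u _ => ?_
  by_cases hA : A v u = 0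
  · simp [hA]
  · exact absurd (h.supp v u hA).2.2 hv

/-- The source of the eigenvector arguments below: the restriction of `f` to `Y` has an eigenvalue
because ℂ is algebraically closed. -/
theorem exists_eigenvector_mem {V : Type*} [AddCommGroup V] [Module ℂ V] [FiniteDimensional ℂ V]
    (f : V →ₗ[ℂ] V) (Y : Submodule ℂ V) (hY : ∀ y ∈ Y, f y ∈ Y) (hne : Y ≠ ⊥) :
    ∃ (μ : ℂ) (y : V), y ∈ Y ∧ y ≠ 0 ∧ f y = μ • y := by
  have : Nontrivial Y := Submodule.nontrivial_iff_ne_bot.2 hne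
  obtain ⟨μ, hμ⟩ := Module.End.exists_eigenvalue (f.restrict hY)
  obtain ⟨y, hy⟩ := hμ.exists_hasEigenvector
  refine ⟨μ, y, y.2, fun h => hy.2 (by ext; exact h), ?_⟩
  simpa using congrArg Subtype.val hy.apply_eq_smul

/-- The input `e` excites the outputs at all but finitely many frequencies, if no eigenvector of `f`
lies in the output-nulling subspace `K`. -/
theorem finite_zeros {V : Type*} [AddCommGroup V] [Module ℂ V] [FiniteDimensional ℂ V]
    (f : V →ₗ[ℂ] V) (K : Submodule ℂ V) {e : V} (he : e ≠ 0)
    (hK : ∀ (μ : ℂ) (y : V), y ∈ K → f y = μ • y → y = 0) :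
    {μ : ℂ | ∃ y ∈ K, f y = μ • y + e}.Finite := by
  set Y : Submodule ℂ V := Submodule.span ℂ {y | y ∈ K ∧ ∃ μ : ℂ, f y = μ • y + e} with hYdef
  have hYK : Y ≤ K := Submodule.span_le.2 fun y hy => hy.1
  -- Were e in Y, the relations f y = μ y + e would make Y invariant, and Y ≤ K would contain an
  -- eigenvector of f.
  have heY : e ∉ Y := by
    intro heY
    have hinv : ∀ y ∈ Y, f y ∈ Y := by
      intro y hy
      induction hy using Submodule.span_induction with
      | mem y hy =>
        obtain ⟨μ, hμ⟩ := hy.2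
        rw [hμ]
        exact Y.add_mem (Y.smul_mem _ (Submodule.subset_span hy)) heY
      | zero => simp
      | add x y _ _ hx hy => rw [map_add]; exact Y.add_mem hx hy
      | smul c x _ hx => rw [map_smul]; exact Y.smul_mem _ hx
    obtain ⟨μ, y, hy, hy0, hfy⟩ := exists_eigenvector_mem f Y hinv
      (fun h => he (by rw [h] at heY; simpa using heY))
    exact hy0 (hK μ y (hYK hy) hfy)
  obtain ⟨φ, hφe, hφY⟩ := Submodule.exists_le_ker_of_notMem heY
  -- The projection along e onto the kernel of φ fixes Y and turns f y = μ y + e into P (f y) = μ y.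
  -- So all these μ are eigenvalues of the single map P ∘ f.
  let P : V →ₗ[ℂ] V := LinearMap.id - (φ.smulRight ((φ e)⁻¹ • e))
  have hP : ∀ x, P x = x - φ x • (φ e)⁻¹ • e := fun x => by simp [P]
  refine (Module.End.finite_hasEigenvalue (P ∘ₗ f)).subset ?_
  rintro μ ⟨y, hyK, hy⟩
  have hy0 : y ≠ 0 := by
    rintro rfl
    simp at hy
    exact he hy.symm
  have hyY : φ y = 0 := hφY (Submodule.subset_span ⟨hyK, μ, hy⟩)
  refine Module.End.hasEigenvalue_of_hasEigenvector (x := y) ⟨?_, hy0⟩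
  rw [Module.End.mem_eigenspace_iff, LinearMap.comp_apply, hP, hy, map_add, map_smul, hyY]
  simp [smul_smul, mul_inv_cancel₀ hφe]

/-- The part of the realization formed by the orbits of `π` that meet `δ`. -/
theorem exists_cactus_base (hπ : ∀ u ∉ δ, E u (π u)) :
    ∃ S A, Cactus E π δ meas S A := by
  classical
  -- The π-links leaving δ are dropped. This cuts each orbit meeting δ into chains that end in δ,
  -- along which `A` is a nilpotent shift.
  let S : Set ι := {v | ∃ u ∈ δ, π.SameCycle u v}
  let A : Matrix ι ι ℝ := Matrix.of fun v u => if π u = v ∧ u ∈ S ∧ u ∉ δ then 1 else 0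
  have hinv : ∀ u, π u ∈ S ↔ u ∈ S := fun u => by
    simp [S, Equiv.Perm.sameCycle_apply_right]
  have hA : ∀ a u, u ∈ S → cAct A a (π u) = if u ∈ δ then 0 else a u := by
    intro a u hu
    rw [cAct_apply, Finset.sum_eq_single u]
    · by_cases h : u ∈ δ <;> simp [A, hu, h]
    · intro w _ hw
      simp [A, hw]
    · simp
  refine ⟨S, A, ⟨?_, ?_, hinv, fun u hu => ⟨u, hu, .rfl⟩, ?_, ?_⟩⟩
  · intro v u
    simp only [A, Matrix.of_apply]
    split_ifs <;> norm_num
  · intro v u h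
    simp only [A, Matrix.of_apply, ne_eq, ite_eq_right_iff, one_ne_zero, imp_false, not_not] at h
    obtain ⟨rfl, h1, h2⟩ := h
    exact ⟨hπ u h2, h1, (hinv u).2 h1⟩
  · intro μ a ha hAa hδa _
    -- At u ∈ δ both sides vanish, so the recursion holds on whole orbits and can be followed until
    -- it meets δ.
    have hstep : ∀ u, u ∈ S → a u = μ * a (π u) := by
      intro u hu
      have h := hA a u hu
      rw [hAa] at h
      simp only [Pi.smul_apply, smul_eq_mul] at h
      rw [h]
      split_ifs with h'
      · exact hδa u h'
      · rfl
    have hpow : ∀ k : ℕ, ∀ u, u ∈ S → a u = μ ^ k * a ((π ^ k) u) := by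
      intro k
      induction k with
      | zero => intro u _; simp
      | succ k ih =>
        intro u hu
        rw [hstep u hu, ih _ ((hinv u).2 hu), pow_succ π k, Equiv.Perm.mul_apply]
        ring
    ext v
    by_cases hv : v ∈ S
    · obtain ⟨u, hu, hs⟩ := hv
      obtain ⟨k, -, -, hk⟩ := hs.symm.exists_pow_eq''
      rw [hpow k v ⟨u, hu, hs⟩, hk, hδa u hu]
      simp
    · exact ha v hv
  · intro μ a b hμ ha hab hb
    have hbS : ∀ v ∉ S, b v = 0 := by
      intro v hv
      have h1 := congrFun hb v
      have h2 : cAct A b v = 0 := by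
        rw [cAct_apply]
        refine Finset.sum_eq_zero fun u _ => ?_
        have : ¬ (π u = v ∧ u ∈ S ∧ u ∉ δ) := by
          rintro ⟨rfl, h, -⟩
          exact hv ((hinv u).2 h)
        simp [A, this]
      rw [h2] at h1
      simpa [hμ] using h1.symm
    have hstep : ∀ u, u ∈ S → μ * b (π u) = if u ∈ δ then 0 else b u := by
      intro u hu
      have h := hA b u hu
      rw [hb] at h
      simpa using h
    -- The first node of a chain receives nothing, so b vanishes there because μ ≠ 0, and the zero
    -- travels down the chain.
    have hpow : ∀ u ∈ δ, ∀ k : ℕ, b ((π ^ (k + 1)) u) = 0 := by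
      intro u hu k
      induction k with
      | zero =>
        have := hstep u ⟨u, hu, .rfl⟩
        simpa [hu, hμ] using this
      | succ k ih =>
        have := hstep ((π ^ (k + 1)) u) ⟨u, hu, ((k + 1 : ℕ) : ℤ), by rw [zpow_natCast]⟩
        rw [ih, ite_self] at this
        rw [pow_succ' π (k + 1), Equiv.Perm.mul_apply]
        simpa [hμ] using this
    ext v
    by_cases hv : v ∈ S
    · obtain ⟨u, hu, hs⟩ := hv
      obtain ⟨k, hk0, -, hk⟩ := hs.exists_pow_eq''
      obtain ⟨k, rfl⟩ := Nat.exists_eq_succ_of_ne_zero hk0.ne'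
      rw [← hk]
      exact hpow u hu k
    · exact hbS v hv

/-- Adding a `π`-orbit that contains a measured node or has a link to `S`. -/
theorem Cactus.exists_extend (h : Cactus E π δ meas S A) (hπ : ∀ u ∉ δ, E u (π u)) (hδ : δ ⊆ meas)
    {c : ι} (hc : c ∉ S)
    (hout : (∃ u ∈ meas, π.SameCycle c u) ∨ ∃ p ∈ S, E c p) :
    ∃ S' A', Cactus E π δ meas S' A' ∧ S ⊂ S' := by
  classical
  have hSc : ∀ {u v}, π.SameCycle u v → (u ∈ S ↔ v ∈ S) := by
    intro u v huv
    obtain ⟨k, rfl⟩ := huv.exists_nat_pow_eq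
    induction k with
    | zero => simp
    | succ k ih => rw [pow_succ', Equiv.Perm.mul_apply, h.invariant, ← ih ⟨k, by simp⟩]
  let C : Set ι := {v | π.SameCycle c v}
  have hCS : ∀ v ∈ C, v ∉ S := fun v hv hvS => hc ((hSc hv).2 hvS)
  have hcC : c ∈ C := Equiv.Perm.SameCycle.refl π c
  have hCinv : ∀ u, π u ∈ C ↔ u ∈ C := fun u => by
    simp [C, Equiv.Perm.sameCycle_apply_right]
  have hCpow : ∀ u ∈ C, ∀ v ∈ C, ∃ k : ℕ, (π ^ k) u = v := fun u hu v hv =>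
    (hu.symm.trans hv).exists_nat_pow_eq
  -- `d` is the column of the link from the new orbit into S: zero if the orbit is measured,
  -- otherwise the unit vector of one target p.
  obtain ⟨d, hd0, hdS, hdE, hd⟩ : ∃ d : ι → ℝ, (∀ v, 0 ≤ d v) ∧ (∀ v, d v ≠ 0 → v ∈ S) ∧
      (∀ v, d v ≠ 0 → E c v) ∧ ((∃ u ∈ meas, u ∈ C) ∨ d ≠ 0) := by
    rcases hout with hm | ⟨p, hp, hcp⟩
    · exact ⟨0, by simp, by simp, by simp, Or.inl hm⟩
    · have key : ∀ v, (Pi.single p 1 : ι → ℝ) v ≠ 0 → v = p := fun v hv => by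
        by_contra hne
        exact hv (Pi.single_eq_of_ne hne _)
      refine ⟨Pi.single p 1, fun v => ?_, fun v hv => key v hv ▸ hp, fun v hv => key v hv ▸ hcp,
        Or.inr (by simp)⟩
      by_cases hv : v = p
      · subst hv; simp
      · rw [Pi.single_eq_of_ne hv]
  let dC : ι → ℂ := fun v => d v
  have hdC : d ≠ 0 → dC ≠ 0 := fun hd h => hd (by
    ext v; simpa [dC] using congrFun h v)
  have hdCS : ∀ v ∉ S, dC v = 0 := fun v hv => by
    by_contra h'
    exact hv (hdS v (by simpa [dC] using h'))
  let K : Submodule ℂ (ι → ℂ) :=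
    { carrier := {y | (∀ u ∉ S, y u = 0) ∧ ∀ u ∈ meas, y u = 0}
      add_mem' := fun {x y} hx hy => ⟨fun u hu => by simp [hx.1 u hu, hy.1 u hu],
        fun u hu => by simp [hx.2 u hu, hy.2 u hu]⟩
      zero_mem' := by simp
      smul_mem' := fun r x hx => ⟨fun u hu => by simp [hx.1 u hu],
        fun u hu => by simp [hx.2 u hu]⟩ }
  -- The frequencies the new cycle must avoid: the eigenvalues of A, and those at which an input
  -- along `d` can leave all measured nodes of S silent.
  obtain ⟨F, hF, hF1, hF2⟩ : ∃ F : Set ℂ, F.Finite ∧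
      (∀ μ y, y ≠ 0 → cAct A y = μ • y → μ ∈ F) ∧
      (d ≠ 0 → ∀ μ, ∀ y ∈ K, cAct A y = μ • y + dC → μ ∈ F) := by
    refine ⟨{μ | Module.End.HasEigenvalue (cAct A) μ} ∪
      if d = 0 then ∅ else {μ : ℂ | ∃ y ∈ K, cAct A y = μ • y + dC}, ?_, ?_, ?_⟩
    · refine (Module.End.finite_hasEigenvalue _).union ?_
      split_ifs with hd
      · exact Set.finite_empty
      · exact finite_zeros _ K (hdC hd) fun μ y hy hAy =>
          h.inj μ y hy.1 hAy (fun u hu => hy.2 u (hδ hu)) (Or.inr hy.2)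
    · intro μ y hy hAy
      exact Or.inl (Module.End.hasEigenvalue_of_hasEigenvector
        ⟨Module.End.mem_eigenspace_iff.2 hAy, hy⟩)
    · intro hd μ y hy hAy
      rw [if_neg hd]
      exact Or.inr ⟨y, hy, hAy⟩
  set N := orderOf π with hN
  have hN0 : N ≠ 0 := (orderOf_pos π).ne'
  have hπN : ∀ u, (π ^ N) u = u := fun u => by rw [hN, pow_orderOf_eq_one]; rfl
  -- As π^N = 1, eigenvalues carried by the cycle satisfy μ^N = w^N. Comparing N-th powers avoids
  -- any mention of the length of this particular cycle.
  obtain ⟨w, hw0, hwF⟩ : ∃ w : ℝ, 0 < w ∧ ∀ μ ∈ F, μ ^ N ≠ (w : ℂ) ^ N := by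
    have hinj : Set.InjOn (fun w : ℝ => (w : ℂ) ^ N) (Set.Ioi 0) := by
      intro x hx y hy hxy
      simp only at hxy
      have hxy' : x ^ N = y ^ N := by exact_mod_cast hxy
      exact (pow_left_inj₀ (le_of_lt hx) (le_of_lt hy) hN0).1 hxy'
    obtain ⟨z, ⟨w, hw, rfl⟩, hz⟩ := ((Set.Ioi_infinite (0 : ℝ)).image hinj).exists_notMem_finite
      (hF.image (· ^ N))
    exact ⟨w, hw, fun μ hμ h' => hz ⟨μ, hμ, h'⟩⟩
  have hwC : (w : ℂ) ≠ 0 := by exact_mod_cast hw0.ne'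
  let B : Matrix ι ι ℝ := Matrix.of fun v u =>
    A v u + (if π u = v ∧ u ∈ C then w else 0) + if u = c then d v else 0
  have hB : ∀ a v, cAct B a v = cAct A a v +
      (if π.symm v ∈ C then w * a (π.symm v) else 0) + dC v * a c := by
    intro a v
    have e1 : ∑ u, ((if π u = v ∧ u ∈ C then w else 0 : ℝ) : ℂ) * a u =
        if π.symm v ∈ C then w * a (π.symm v) else 0 := by
      rw [Finset.sum_eq_single (π.symm v)]
      · by_cases hC : π.symm v ∈ C <;> simp [hC]
      · intro u _ hu
        have : π u ≠ v := fun h' => hu (by rw [← h', Equiv.symm_apply_apply])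
        simp [this]
      · simp
    have e2 : ∑ u, ((if u = c then d v else 0 : ℝ) : ℂ) * a u = dC v * a c := by
      rw [Finset.sum_eq_single c]
      · simp [dC]
      · intro u _ hu; simp [hu]
      · simp
    rw [cAct_apply, cAct_apply, ← e1, ← e2, ← Finset.sum_add_distrib, ← Finset.sum_add_distrib]
    refine Finset.sum_congr rfl fun u _ => ?_
    simp only [B, Matrix.of_apply]
    push_cast
    ring
  have hBC : ∀ a, ∀ u ∈ C, cAct B a (π u) = w * a u := by
    intro a u hu
    have hπu := (hCinv u).2 hu
    rw [hB, h.cAct_eq_zero a (hCS _ hπu), hdCS _ (hCS _ hπu)]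
    simp [hu]
  have hBS : ∀ a, ∀ v ∈ S, cAct B a v = cAct A a v + dC v * a c := by
    intro a v hv
    have : π.symm v ∉ C := fun h' => hCS v (by simpa using (hCinv _).2 h') hv
    rw [hB, if_neg this, add_zero]
  have hB0 : ∀ a, ∀ v, v ∉ S → v ∉ C → cAct B a v = 0 := by
    intro a v hv hv'
    have : π.symm v ∉ C := fun h' => hv' (by simpa using (hCinv _).2 h')
    rw [hB, if_neg this, h.cAct_eq_zero a hv, hdCS v hv]
    simp
  have hcyc : ∀ (μ : ℂ) (a : ι → ℂ), (∀ u ∈ C, w * a u = μ * a (π u)) → ∀ k : ℕ, ∀ u ∈ C,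
      (w : ℂ) ^ k * a u = μ ^ k * a ((π ^ k) u) := by
    intro μ a ha k
    induction k with
    | zero => intro u _; simp
    | succ k ih =>
      intro u hu
      rw [pow_succ π k, Equiv.Perm.mul_apply, pow_succ μ, mul_right_comm,
        ← ih _ ((hCinv u).2 hu), pow_succ (w : ℂ), mul_assoc, ha u hu]
      ring
  have hcycN : ∀ (μ : ℂ) (a : ι → ℂ), (∀ u ∈ C, w * a u = μ * a (π u)) → ∀ u ∈ C, a u ≠ 0 →
      (w : ℂ) ^ N = μ ^ N := by
    intro μ a ha u hu hau
    have := hcyc μ a ha N u hu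
    rw [hπN] at this
    exact mul_right_cancel₀ hau this
  refine ⟨S ∪ C, B, ⟨?_, ?_, ?_, h.sub.trans Set.subset_union_left, ?_, ?_⟩,
    Set.subset_union_left, fun hsub => hc (hsub (Or.inr hcC))⟩
  · intro v u
    simp only [B, Matrix.of_apply]
    have h1 := h.nonneg v u
    have h2 := hd0 v
    split_ifs <;> linarith
  · intro v u hvu
    by_cases h1 : A v u = 0
    · by_cases h2 : π u = v ∧ u ∈ C
      · obtain ⟨rfl, hu⟩ := h2
        exact ⟨hπ u fun h' => hCS u hu (h.sub h'), Or.inr hu, Or.inr ((hCinv u).2 hu)⟩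
      · simp only [B, Matrix.of_apply, h1, if_neg h2, zero_add, ne_eq, ite_eq_right_iff,
          Classical.not_imp] at hvu
        obtain ⟨rfl, h3⟩ := hvu
        exact ⟨hdE v h3, Or.inr hcC, Or.inl (hdS v h3)⟩
    · obtain ⟨h3, h4, h5⟩ := h.supp v u h1
      exact ⟨h3, Or.inl h4, Or.inl h5⟩
  · intro u
    simp only [Set.mem_union, h.invariant, hCinv]
  · intro μ a ha hBa hδa hμa
    have hrow : ∀ u ∈ C, w * a u = μ * a (π u) := fun u hu => by
      rw [← hBC a u hu, hBa]; rfl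
    -- An eigenvector that is nonzero somewhere on the cycle is nonzero on all of it. Then it is
    -- seen at a measured node of the cycle, or it drives S through c at a frequency that w was
    -- chosen to avoid.
    by_cases hz : ∃ u ∈ C, a u ≠ 0
    · exfalso
      obtain ⟨u, hu, hau⟩ := hz
      have hwμ := hcycN μ a hrow u hu hau
      have hμ0 : μ ≠ 0 := by
        rintro rfl
        rw [zero_pow hN0] at hwμ
        exact pow_ne_zero _ hwC hwμ
      have hma := hμa.resolve_left hμ0
      have hall : ∀ v ∈ C, a v ≠ 0 := by
        intro v hv hav
        obtain ⟨k, hk⟩ := hCpow u hu v hv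
        have := hcyc μ a hrow k u hu
        rw [hk, hav, mul_zero] at this
        exact mul_ne_zero (pow_ne_zero _ hwC) hau this
      rcases hd with ⟨m, hm, hmC⟩ | hd
      · exact hall m hmC (hma m hm)
      · have hac := hall c hcC
        let y : ι → ℂ := fun v => if v ∈ S then a v else 0
        have hAy : cAct A y = cAct A a := by
          ext v
          rw [cAct_apply, cAct_apply]
          refine Finset.sum_congr rfl fun u _ => ?_
          by_cases hA : A v u = 0
          · simp [hA]
          · simp [y, (h.supp v u hA).2.1]
        have hyK : y ∈ K := by
          refine ⟨fun u hu => by simp [y, hu], fun u hu => ?_⟩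
          simp only [y]
          split_ifs
          · exact hma u hu
          · rfl
        -- On S the eigenvector satisfies A y = μ y − a(c) d; dividing by −a(c) gives the normal
        -- form of `finite_zeros`.
        refine hwF μ (hF2 hd μ (-(a c)⁻¹ • y) (K.smul_mem _ hyK) ?_) hwμ.symm
        rw [map_smul, hAy]
        ext v
        by_cases hv : v ∈ S
        · have h1 := hBS a v hv
          rw [hBa] at h1
          simp only [Pi.smul_apply, smul_eq_mul, Pi.add_apply, y, if_pos hv] at h1 ⊢
          have h2 : cAct A a v = μ * a v - dC v * a c := by rw [h1]; ring
          rw [h2]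
          field_simp
          ring
        · simp [y, hv, h.cAct_eq_zero a hv, hdCS v hv]
    · push Not at hz
      have haS : ∀ u ∉ S, a u = 0 := fun u hu => by
        by_cases huC : u ∈ C
        · exact hz u huC
        · exact ha u (by simp [hu, huC])
      refine h.inj μ a haS ?_ hδa hμa
      ext v
      by_cases hv : v ∈ S
      · have h1 := hBS a v hv
        rw [hz c hcC, mul_zero, add_zero, hBa] at h1
        exact h1.symm
      · simp [h.cAct_eq_zero a hv, haS v hv]
  · intro μ a b hμ ha hab hb
    have hb0 : ∀ v, v ∉ S → v ∉ C → b v = 0 := by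
      intro v h1 h2
      have := hB0 b v h1 h2
      rw [hb] at this
      simpa [hμ] using this
    have hrow : ∀ u ∈ C, w * b u = μ * b (π u) := fun u hu => by
      rw [← hBC b u hu, hb]; rfl
    have hrow' : ∀ u ∈ C, w * a u = μ * a (π u) + b (π u) := fun u hu => by
      rw [← hBC a u hu, hab]; rfl
    -- This follows a Jordan chain k steps around the cycle. At k = N the terms in a cancel because
    -- w^N = μ^N, which leaves N μ^N b(u) = 0.
    have hjordan : ∀ k : ℕ, ∀ u ∈ C,
        μ * ((w : ℂ) ^ k * a u) = μ ^ (k + 1) * a ((π ^ k) u) + k * μ ^ k * b ((π ^ k) u) := by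
      intro k
      induction k with
      | zero => intro u _; simp
      | succ k ih =>
        intro u hu
        have h1 := ih _ ((hCinv u).2 hu)
        have h2 := hcyc μ b hrow k _ ((hCinv u).2 hu)
        have h3 := hrow' u hu
        rw [pow_succ π k, Equiv.Perm.mul_apply, Nat.cast_succ]
        calc μ * ((w : ℂ) ^ (k + 1) * a u) = μ * (w : ℂ) ^ k * (w * a u) := by ring
          _ = μ * (μ * ((w : ℂ) ^ k * a (π u))) + μ * ((w : ℂ) ^ k * b (π u)) := by
            rw [h3]; ring
          _ = _ := by rw [h1, h2]; ring
    have hbC : ∀ u ∈ C, b u = 0 := by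
      intro u hu
      by_contra hbu
      have h1 := hcycN μ b hrow u hu hbu
      have h2 := hjordan N u hu
      rw [hπN, h1] at h2
      have h3 : (N : ℂ) * μ ^ N * b u = 0 := by linear_combination -h2
      exact mul_ne_zero (mul_ne_zero (by exact_mod_cast hN0) (pow_ne_zero _ hμ)) hbu h3
    have hbS : ∀ u ∉ S, b u = 0 := fun u hu => by
      by_cases huC : u ∈ C
      · exact hbC u huC
      · exact hb0 u hu huC
    have hAb : cAct A b = μ • b := by
      ext v
      by_cases hv : v ∈ S
      · have h1 := hBS b v hv
        rw [hbC c hcC, mul_zero, add_zero, hb] at h1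
        exact h1.symm
      · simp [h.cAct_eq_zero b hv, hbS v hv]
    -- Now b is a nonzero eigenvector of A, so μ is forbidden on the cycle. Hence a vanishes on C as
    -- well, and the Jordan chain lives in S, where A is already known to be semisimple.
    by_contra hbne
    have hμF := hwF μ (hF1 μ b hbne hAb)
    have hrow'' : ∀ u ∈ C, w * a u = μ * a (π u) := fun u hu => by
      rw [hrow' u hu, hbC _ ((hCinv u).2 hu), add_zero]
    have haC : ∀ u ∈ C, a u = 0 := by
      intro u hu
      by_contra hau
      exact hμF (hcycN μ a hrow'' u hu hau).symm
    have haS : ∀ u ∉ S, a u = 0 := fun u hu => by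
      by_cases huC : u ∈ C
      · exact haC u huC
      · exact ha u (by simp [hu, huC])
    refine hbne (h.semisimple μ a b hμ haS ?_ hAb)
    ext v
    by_cases hv : v ∈ S
    · have h1 := hBS a v hv
      rw [haC c hcC, mul_zero, add_zero, hab] at h1
      exact h1.symm
    · simp [h.cAct_eq_zero a hv, haS v hv, hbS v hv]

/-- A sparse observable realization of a digraph in which every node reaches a measured one and the
nodes outside `δ` can be matched. -/
theorem exists_cactus (hπ : ∀ u ∉ δ, E u (π u)) (hδ : δ ⊆ meas)
    (hreach : ∀ u, ∃ v ∈ meas, Relation.ReflTransGen E u v) :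
    ∃ A, Cactus E π δ meas Set.univ A := by
  obtain ⟨S₀, A₀, h₀⟩ := exists_cactus_base hπ
  obtain ⟨S, hS⟩ := (Set.toFinite {S | ∃ A, Cactus E π δ meas S A}).exists_maximal ⟨S₀, A₀, h₀⟩
  obtain ⟨A, hA⟩ := hS.prop
  by_cases hSu : S = Set.univ
  · exact ⟨A, hSu ▸ hA⟩
  exfalso
  obtain ⟨x, hx⟩ := (Set.ne_univ_iff_exists_notMem S).1 hSu
  -- A walk from x to a measured node either ends outside S, at a node whose orbit is measured, or
  -- crosses into S by some link c → p.
  have : ∃ c, c ∉ S ∧ ((∃ u ∈ meas, π.SameCycle c u) ∨ ∃ p ∈ S, E c p) := by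
    obtain ⟨v, hv, hxv⟩ := hreach x
    by_cases hvS : v ∈ S
    · by_contra hcon
      push Not at hcon
      have : ∀ y, Relation.ReflTransGen E x y → y ∉ S := by
        intro y hy
        induction hy with
        | refl => exact hx
        | tail _ hyz ih => exact fun hz => (hcon _ ih).2 _ hz hyz
      exact this v hxv hvS
    · exact ⟨v, hvS, Or.inl ⟨v, hv, .rfl⟩⟩
  obtain ⟨c, hc, hout⟩ := this
  obtain ⟨S', A', h', hlt⟩ := hA.exists_extend hπ hδ hc hout
  exact hlt.not_subset (hS.le_of_ge ⟨A', h'⟩ hlt.subset)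

end Cactus

/-! ### Observability tests -/

section Tests

variable {p q : Type*} [Fintype p]

theorem map_ofReal_mulVec_ofReal {r : Type*} (G : Matrix r p ℝ) (x : p → ℝ) :
    (G.map Complex.ofReal) *ᵥ (fun i => (x i : ℂ)) = fun i => (((G *ᵥ x) i : ℝ) : ℂ) := by
  ext i
  simp [Matrix.mulVec, dotProduct]

theorem re_map_ofReal_mulVec {r : Type*} (G : Matrix r p ℝ) (v : p → ℂ) (i : r) :
    (((G.map Complex.ofReal) *ᵥ v) i).re = (G *ᵥ fun j => (v j).re) i := by
  simp [Matrix.mulVec, dotProduct]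

theorem im_map_ofReal_mulVec {r : Type*} (G : Matrix r p ℝ) (v : p → ℂ) (i : r) :
    (((G.map Complex.ofReal) *ᵥ v) i).im = (G *ᵥ fun j => (v j).im) i := by
  simp [Matrix.mulVec, dotProduct]

variable [DecidableEq p]

/-- The eigenvector test for observability. -/
theorem observable_iff_eigenvector (F : Matrix p p ℝ) (G : Matrix q p ℝ) :
    Observable F G ↔ ∀ (μ : ℂ) (v : p → ℂ), cAct F v = μ • v →
      (G.map Complex.ofReal) *ᵥ v = 0 → v = 0 := by
  have hcoe : ∀ k v, (F.map Complex.ofReal ^ k) *ᵥ v = (cAct F ^ k) v := by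
    intro k v
    rw [cAct, ← Matrix.toLin'_pow, Matrix.toLin'_apply]
  have hmap : ∀ k, (F ^ k).map Complex.ofReal = F.map Complex.ofReal ^ k := fun k =>
    Matrix.map_pow F Complex.ofRealHom k
  constructor
  · intro h μ v hv hGv
    have hpow : ∀ k, ((F ^ k).map Complex.ofReal) *ᵥ v = μ ^ k • v := by
      intro k
      rw [hmap, hcoe]
      induction k with
      | zero => simp
      | succ k ih => rw [pow_succ', Module.End.mul_apply, ih, map_smul, hv, smul_smul, pow_succ]
    have hout : ∀ k, ((G * F ^ k).map Complex.ofReal) *ᵥ v = 0 := by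
      intro k
      have : (G * F ^ k).map Complex.ofReal = G.map Complex.ofReal * (F ^ k).map Complex.ofReal :=
        Matrix.map_mul (f := Complex.ofRealHom)
      rw [this, ← Matrix.mulVec_mulVec, hpow, Matrix.mulVec_smul, hGv, smul_zero]
    have hre : (fun j => (v j).re) = 0 := h _ fun k => by
      ext i
      rw [Matrix.mulVec_mulVec, ← re_map_ofReal_mulVec, hout]
      rfl
    have him : (fun j => (v j).im) = 0 := h _ fun k => by
      ext i
      rw [Matrix.mulVec_mulVec, ← im_map_ofReal_mulVec, hout]
      rfl
    ext j
    exact Complex.ext (congrFun hre j) (congrFun him j)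
  · intro h x hx
    -- The complex unobservable subspace: it contains x, is invariant, and so would contain an
    -- eigenvector violating the test.
    let Y : Submodule ℂ (p → ℂ) :=
      ⨅ k : ℕ, LinearMap.ker ((Matrix.toLin' (G.map Complex.ofReal)) ∘ₗ (cAct F ^ k)) |>.restrictScalars ℂ
    have hY : ∀ v, v ∈ Y ↔ ∀ k : ℕ, (G.map Complex.ofReal) *ᵥ ((cAct F ^ k) v) = 0 := by
      intro v
      simp [Y, Submodule.mem_iInf]
    by_contra hx0
    have hxY : (fun i => (x i : ℂ)) ∈ Y := by
      rw [hY]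
      intro k
      rw [← hcoe, ← hmap, map_ofReal_mulVec_ofReal, map_ofReal_mulVec_ofReal, hx k]
      ext; simp
    obtain ⟨μ, y, hy, hy0, hfy⟩ := exists_eigenvector_mem (cAct F) Y (fun y hy => by
      rw [hY] at hy ⊢
      intro k
      have := hy (k + 1)
      rwa [pow_succ, Module.End.mul_apply] at this) (fun hbot => hx0 (by
        rw [hbot, Submodule.mem_bot] at hxY
        ext i
        simpa using congrFun hxY i))
    exact hy0 (h μ y hfy (by simpa using (hY y).1 hy 0))

/-- Cayley–Hamilton: F^k is a combination of the powers of exponent less than `card p + 1`. The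
extra exponent makes a non-strict degree bound for the remainder sufficient. -/
theorem output_eq_zero_of_lt {F : Matrix p p ℝ} {G : Matrix q p ℝ} {x : p → ℝ}
    (h : ∀ k < Fintype.card p + 1, G *ᵥ ((F ^ k) *ᵥ x) = 0) (k : ℕ) :
    G *ᵥ ((F ^ k) *ᵥ x) = 0 := by
  have hdeg : (Polynomial.X ^ k %ₘ F.charpoly).natDegree < Fintype.card p + 1 := by
    refine Nat.lt_succ_of_le ((Polynomial.natDegree_modByMonic_le _ F.charpoly_monic).trans ?_)
    rcases isEmpty_or_nonempty p with hp | hp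
    · simp [Matrix.charpoly, Matrix.charmatrix]
    · exact (Matrix.charpoly_natDegree_eq_dim F).le
  rw [Matrix.pow_eq_aeval_mod_charpoly, Polynomial.aeval_eq_sum_range' hdeg, Matrix.sum_mulVec,
    Matrix.mulVec_sum]
  refine Finset.sum_eq_zero fun i hi => ?_
  rw [Matrix.smul_mulVec, Matrix.mulVec_smul, h i (Finset.mem_range.1 hi), smul_zero]

open Polynomial in
/-- Observability is a generic property in polynomial families. -/
theorem finite_not_observable [Fintype q] (F : ℝ → Matrix p p ℝ) (G : Matrix q p ℝ)
    (hF : ∀ i j, ∃ P : ℝ[X], ∀ x, F x i j = P.eval x) {x₀ : ℝ} (h : Observable (F x₀) G) :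
    {x | ¬ Observable (F x) G}.Finite := by
  choose P hP using hF
  let Q : Matrix p p ℝ[X] := Matrix.of P
  let G' : Matrix q p ℝ[X] := G.map C
  -- The observability Gramian over the polynomial ring. It is singular at x exactly when
  -- observability fails there, so its determinant is nonzero at x₀ and has finitely many roots.
  let Γ : Matrix p p ℝ[X] :=
    ∑ k ∈ Finset.range (Fintype.card p + 1), (G' * Q ^ k)ᵀ * (G' * Q ^ k)
  have hQ : ∀ x, Q.map (evalRingHom x) = F x := fun x => by ext i j; simp [Q, hP]
  have hG' : ∀ x, G'.map (evalRingHom x) = G := fun x => by ext i j; simp [G']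
  have hΓ : ∀ x, Γ.map (evalRingHom x) =
      ∑ k ∈ Finset.range (Fintype.card p + 1), (G * F x ^ k)ᵀ * (G * F x ^ k) := by
    intro x
    change (evalRingHom x).mapMatrix Γ = _
    rw [map_sum]
    refine Finset.sum_congr rfl fun k _ => ?_
    rw [RingHom.mapMatrix_apply, Matrix.map_mul, Matrix.transpose_map, Matrix.map_mul,
      Matrix.map_pow, hQ, hG']
  have hdet : ∀ x, Γ.det.eval x = (Γ.map (evalRingHom x)).det := fun x =>
    RingHom.map_det (evalRingHom x) Γ
  have hne : Γ.det ≠ 0 := by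
    intro h0
    have h1 := hdet x₀
    rw [h0, eval_zero] at h1
    obtain ⟨x, hx0, hx⟩ := Matrix.exists_mulVec_eq_zero_iff.2 h1.symm
    refine hx0 (h x (output_eq_zero_of_lt fun k hk => ?_))
    have h2 : x ⬝ᵥ (Γ.map (evalRingHom x₀)) *ᵥ x = 0 := by rw [hx, dotProduct_zero]
    rw [hΓ, Matrix.sum_mulVec, dotProduct_sum] at h2
    have h3 : ∀ k, x ⬝ᵥ ((G * F x₀ ^ k)ᵀ * (G * F x₀ ^ k)) *ᵥ x =
        ((G * F x₀ ^ k) *ᵥ x) ⬝ᵥ ((G * F x₀ ^ k) *ᵥ x) := fun k => by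
      rw [← Matrix.mulVec_mulVec, Matrix.dotProduct_mulVec, Matrix.vecMul_transpose]
    have hnn : ∀ y : q → ℝ, 0 ≤ y ⬝ᵥ y := fun y =>
      Finset.sum_nonneg fun i _ => mul_self_nonneg _
    rw [Finset.sum_eq_zero_iff_of_nonneg fun k _ => by rw [h3]; exact hnn _] at h2
    have h4 := h2 k (Finset.mem_range.2 hk)
    rw [h3, dotProduct_self_eq_zero] at h4
    rw [Matrix.mulVec_mulVec, h4]
  refine (Polynomial.finite_setOfPred_isRoot hne).subset fun x hx => ?_
  by_contra hroot
  refine hx fun y hy => ?_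
  have h1 : (Γ.map (evalRingHom x)).det ≠ 0 := fun h0 => hroot (by
    change Γ.det.eval x = 0
    rw [hdet, h0])
  by_contra hy0
  refine h1 (Matrix.exists_mulVec_eq_zero_iff.1 ⟨y, hy0, ?_⟩)
  rw [hΓ, Matrix.sum_mulVec]
  refine Finset.sum_eq_zero fun k _ => ?_
  rw [← Matrix.mulVec_mulVec, ← Matrix.mulVec_mulVec, hy k, Matrix.mulVec_zero]

end Tests

theorem exists_mem_Ioo_of_finite {s : Set ℝ} (hs : s.Finite) : ∃ x, 0 < x ∧ x < 1 ∧ x ∉ s := by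
  obtain ⟨x, hx, hx'⟩ := (Set.Ioo_infinite (zero_lt_one' ℝ)).exists_notMem_finite hs
  exact ⟨x, hx.1, hx.2, hx'⟩

/-! ### Positive eigenvectors -/

section Perron

variable {ι : Type*} [Fintype ι] {B : Matrix ι ι ℝ}

theorem mulVec_pos_of_pos {P : Matrix ι ι ℝ} (hP : ∀ s t, 0 < P s t) {x : ι → ℝ}
    (hx : ∀ s, 0 ≤ x s) (hx0 : x ≠ 0) (s : ι) : 0 < (P *ᵥ x) s := by
  obtain ⟨t, ht⟩ := Function.ne_iff.1 hx0
  exact Finset.sum_pos' (fun i _ => mul_nonneg (hP _ _).le (hx i))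
    ⟨t, Finset.mem_univ _, mul_pos (hP s t) (lt_of_le_of_ne (hx t) (Ne.symm ht))⟩

variable [DecidableEq ι]

theorem pow_entry_nonneg (h0 : ∀ s t, 0 ≤ B s t) (k : ℕ) : ∀ s t, 0 ≤ (B ^ k) s t := by
  induction k with
  | zero =>
    intro s t
    rw [pow_zero, Matrix.one_apply]
    split_ifs <;> norm_num
  | succ k ih =>
    intro s t
    rw [pow_succ, Matrix.mul_apply]
    exact Finset.sum_nonneg fun i _ => mul_nonneg (ih _ _) (h0 _ _)

theorem pow_succ_entry_pos (h0 : ∀ s t, 0 ≤ B s t) {k : ℕ} {s t u : ι} (h1 : 0 < (B ^ k) s t)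
    (h2 : 0 < B t u) : 0 < (B ^ (k + 1)) s u := by
  rw [pow_succ, Matrix.mul_apply]
  exact Finset.sum_pos' (fun i _ => mul_nonneg (pow_entry_nonneg h0 k _ _) (h0 _ _))
    ⟨t, Finset.mem_univ _, mul_pos h1 h2⟩

/-- The positive diagonal lets a walk wait at its end, so a pair joined by a walk of length k is
joined at every greater length. The sum of all these lengths serves all pairs at once. -/
theorem exists_pow_pos (h0 : ∀ s t, 0 ≤ B s t) (h1 : ∀ s, 0 < B s s)
    (h2 : ∀ s t, Relation.ReflTransGen (fun s t => B s t ≠ 0) s t) :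
    ∃ k, ∀ s t, 0 < (B ^ k) s t := by
  have hex : ∀ s t, ∃ k, ∀ l, 0 < (B ^ (k + l)) s t := by
    intro s t
    have : ∃ k, 0 < (B ^ k) s t := by
      induction h2 s t with
      | refl => exact ⟨0, by simp⟩
      | tail _ hbc ih =>
        obtain ⟨k, hk⟩ := ih
        exact ⟨k + 1, pow_succ_entry_pos h0 hk (lt_of_le_of_ne (h0 _ _) hbc.symm)⟩
    obtain ⟨k, hk⟩ := this
    refine ⟨k, fun l => ?_⟩
    induction l with
    | zero => exact hk
    | succ l ih => exact pow_succ_entry_pos h0 ih (h1 t)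
  choose k hk using hex
  refine ⟨∑ s, ∑ t, k s t, fun s t => ?_⟩
  have h3 : k s t ≤ ∑ s, ∑ t, k s t :=
    (Finset.single_le_sum (f := fun t => k s t) (fun _ _ => Nat.zero_le _) (Finset.mem_univ t)).trans
      (Finset.single_le_sum (f := fun s => ∑ t, k s t) (fun _ _ => Nat.zero_le _)
        (Finset.mem_univ s))
  obtain ⟨l, hl⟩ := Nat.exists_eq_add_of_le h3
  rw [hl]
  exact hk s t l

/-- A nonnegative irreducible matrix with positive diagonal has a positive eigenvector. -/
theorem exists_pos_eigenvector [Nonempty ι] (h0 : ∀ s t, 0 ≤ B s t) (h1 : ∀ s, 0 < B s s)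
    (h2 : ∀ s t, Relation.ReflTransGen (fun s t => B s t ≠ 0) s t) :
    ∃ (p : ι → ℝ) (ρ : ℝ), 0 < ρ ∧ (∀ s, 0 < p s) ∧ B *ᵥ p = ρ • p := by
  obtain ⟨k, hk⟩ := exists_pow_pos h0 h1 h2
  let R : ℝ := ∑ s, ∑ t, B s t
  have hR : ∀ (r : ℝ) (x : ι → ℝ), x ∈ stdSimplex ℝ ι → (∀ s, r * x s ≤ (B *ᵥ x) s) → r ≤ R := by
    intro r x hx hr
    calc r = ∑ s, r * x s := by rw [← Finset.mul_sum, hx.2, mul_one]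
      _ ≤ ∑ s, (B *ᵥ x) s := Finset.sum_le_sum fun s _ => hr s
      _ ≤ R := Finset.sum_le_sum fun s _ => Finset.sum_le_sum fun t _ =>
        mul_le_of_le_one_right (h0 s t) ((Finset.single_le_sum (fun i _ => hx.1 i)
          (Finset.mem_univ t)).trans hx.2.le)
  -- The Collatz–Wielandt principle: the largest r with r x ≤ B x for some x in the simplex is
  -- attained by compactness, and there equality holds.
  let T : Set (ℝ × (ι → ℝ)) :=
    (Set.Icc 0 R ×ˢ stdSimplex ℝ ι) ∩ {z | ∀ s, z.1 * z.2 s ≤ (B *ᵥ z.2) s}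
  have hTc : IsCompact T := by
    refine (isCompact_Icc.prod (isCompact_stdSimplex ℝ ι)).inter_right ?_
    simp only [Set.ofPred_forall]
    refine isClosed_iInter fun s => isClosed_le (by fun_prop) ?_
    simp only [Matrix.mulVec, dotProduct]
    fun_prop
  have hTne : T.Nonempty := by
    obtain ⟨s⟩ := ‹Nonempty ι›
    refine ⟨(0, Pi.single s 1), ⟨⟨le_rfl, Finset.sum_nonneg fun s _ => Finset.sum_nonneg fun t _ =>
      h0 s t⟩, single_mem_stdSimplex ℝ s⟩, fun t => ?_⟩
    simp [h0]
  obtain ⟨⟨r, x⟩, ⟨⟨hr, hx⟩, hrx⟩, hmax⟩ := hTc.exists_isMaxOn hTne continuous_fst.continuousOn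
  simp only [Set.mem_ofPred_eq] at hr hx hrx
  have hx0 : x ≠ 0 := by
    rintro rfl
    simpa using hx.2
  have hBx : B *ᵥ x = r • x := by
    by_contra hne
    have hz0 : B *ᵥ x - r • x ≠ 0 := sub_ne_zero.2 hne
    have hzpos := mulVec_pos_of_pos hk (x := B *ᵥ x - r • x)
      (fun s => by simpa using hrx s) hz0
    have hypos := mulVec_pos_of_pos hk hx.1 hx0
    -- The positive matrix B^k turns the nonzero defect B x − r x into a strictly positive defect of
    -- y, so r could be raised by the smallest ratio ε.
    set y := (B ^ k) *ᵥ x with hy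
    have hzy : (B ^ k) *ᵥ (B *ᵥ x - r • x) = B *ᵥ y - r • y := by
      rw [Matrix.mulVec_sub, Matrix.mulVec_smul, hy, Matrix.mulVec_mulVec, Matrix.mulVec_mulVec,
        ← pow_succ, pow_succ']
    rw [hzy] at hzpos
    obtain ⟨s₀, -, hs₀⟩ := Finset.exists_min_image Finset.univ
      (fun s => (B *ᵥ y - r • y) s / y s) Finset.univ_nonempty
    set ε := (B *ᵥ y - r • y) s₀ / y s₀ with hε
    have hεpos : 0 < ε := div_pos (hzpos s₀) (hypos s₀)
    have hYpos : 0 < ∑ s, y s := Finset.sum_pos (fun s _ => hypos s) Finset.univ_nonempty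
    have hle : ∀ s, (r + ε) * ((∑ s, y s)⁻¹ • y) s ≤ (B *ᵥ ((∑ s, y s)⁻¹ • y)) s := by
      intro s
      have := (le_div_iff₀ (hypos s)).1 (hs₀ s (Finset.mem_univ s))
      simp only [Pi.sub_apply, Pi.smul_apply, smul_eq_mul] at this
      rw [Matrix.mulVec_smul]
      simp only [Pi.smul_apply, smul_eq_mul]
      rw [mul_left_comm]
      exact mul_le_mul_of_nonneg_left (by linarith) (inv_nonneg.2 hYpos.le)
    have hsimp : (∑ s, y s)⁻¹ • y ∈ stdSimplex ℝ ι :=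
      ⟨fun s => mul_nonneg (inv_nonneg.2 hYpos.le) (hypos s).le, by
        simp only [Pi.smul_apply, smul_eq_mul]
        rw [← Finset.mul_sum, inv_mul_cancel₀ hYpos.ne']⟩
    have := hmax (a := (r + ε, (∑ s, y s)⁻¹ • y))
      ⟨⟨⟨by linarith [hr.1], hR _ _ hsimp hle⟩, hsimp⟩, hle⟩
    simp only [Set.mem_ofPred_eq] at this
    linarith
  have hpow : ∀ l : ℕ, (B ^ l) *ᵥ x = r ^ l • x := by
    intro l
    induction l with
    | zero => simp
    | succ l ih => rw [pow_succ', ← Matrix.mulVec_mulVec, ih, Matrix.mulVec_smul, hBx, smul_smul,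
        pow_succ]
  have hxpos : ∀ s, 0 < x s := by
    intro s
    have := mulVec_pos_of_pos hk hx.1 hx0 s
    rw [hpow] at this
    exact pos_of_mul_pos_right this (pow_nonneg hr.1 _)
  refine ⟨x, r, ?_, hxpos, hBx⟩
  obtain ⟨s⟩ := ‹Nonempty ι›
  have h3 : 0 < (B *ᵥ x) s := Finset.sum_pos' (fun i _ => mul_nonneg (h0 _ _) (hx.1 i))
    ⟨s, Finset.mem_univ _, mul_pos (h1 s) (hxpos s)⟩
  rw [hBx] at h3
  exact pos_of_mul_pos_left h3 (hx.1 s)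

end Perron

/-! ### Fusion matrices observable from every node -/

section Fusion

variable {ι : Type*} [Fintype ι] [DecidableEq ι]

theorem observable_single_iff (B : Matrix ι ι ℝ) (s : ι) :
    Observable B (Matrix.of fun (_ : Unit) => (Pi.single s 1 : ι → ℝ)) ↔
      ∀ (ω : ℂ) (u : ι → ℂ), cAct B u = ω • u → u s = 0 → u = 0 := by
  rw [observable_iff_eigenvector]
  have : ∀ u : ι → ℂ, ((Matrix.of fun (_ : Unit) => (Pi.single s 1 : ι → ℝ)).map
      Complex.ofReal) *ᵥ u = 0 ↔ u s = 0 := by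
    intro u
    have h : ∀ i, ((Matrix.of fun (_ : Unit) => (Pi.single s 1 : ι → ℝ)).map
      Complex.ofReal *ᵥ u) i = u s := by
      intro i
      rw [Matrix.mulVec, dotProduct, Finset.sum_eq_single s]
      · simp
      · intro t _ ht
        simp [ht]
      · simp
    exact ⟨fun h' => by simpa [h] using congrFun h' (), fun h' => by ext i; simp [h, h']⟩
  simp only [this]

/-- A nonnegative matrix of a strongly connected pattern whose eigenvectors have no zero entries. -/
theorem exists_full_support_eigenvectors {Nβ : ι → ι → Prop} (hrefl : ∀ s, Nβ s s)
    (hconn : ∀ s t, Relation.ReflTransGen Nβ s t) :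
    ∃ B : Matrix ι ι ℝ, (∀ s t, 0 ≤ B s t) ∧ (∀ s t, B s t ≠ 0 ↔ Nβ s t) ∧
      ∀ (s : ι) (ω : ℂ) (u : ι → ℂ), cAct B u = ω • u → u s = 0 → u = 0 := by
  classical
  suffices h : ∀ T : Finset ι, ∃ B : Matrix ι ι ℝ, (∀ s t, 0 ≤ B s t) ∧
      (∀ s t, B s t ≠ 0 ↔ Nβ s t) ∧
      ∀ s ∈ T, Observable B (Matrix.of fun (_ : Unit) => (Pi.single s 1 : ι → ℝ)) by
    obtain ⟨B, h1, h2, h3⟩ := h Finset.univ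
    exact ⟨B, h1, h2, fun s => (observable_single_iff B s).1 (h3 s (Finset.mem_univ s))⟩
  intro T
  induction T using Finset.induction_on with
  | empty =>
    refine ⟨Matrix.of fun s t => if Nβ s t then 1 else 0, fun s t => ?_, fun s t => ?_, by simp⟩
    · simp only [Matrix.of_apply]
      split_ifs <;> norm_num
    · simp
  | @insert s T hs ih =>
    obtain ⟨B, h1, h2, h3⟩ := ih
    -- The loops of Nβ realise the permutation 1, so δ is empty and only s is measured. Links are
    -- reversed because the entry in row v and column u belongs to the link u → v.
    obtain ⟨B', hB'⟩ := exists_cactus (E := fun u v => Nβ v u) (π := 1) (δ := ∅) (meas := {s})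
      (fun u _ => hrefl u) (Set.empty_subset _)
      (fun u => ⟨s, rfl, Relation.reflTransGen_swap.2 (hconn s u)⟩)
    have hobs : Observable B' (Matrix.of fun (_ : Unit) => (Pi.single s 1 : ι → ℝ)) :=
      (observable_single_iff B' s).2 fun ω u hu hus =>
        hB'.inj ω u (by simp) hu (by simp) (Or.inr (by simpa using hus))
    -- For 0 < x < 1 the summand B ensures the full pattern of Nβ. The endpoints x = 1 and x = 0
    -- witness observability from s and from the earlier nodes, hence each holds for all but
    -- finitely many x.
    let F : ℝ → Matrix ι ι ℝ := fun x => (1 - x) • B + x • B'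
    have hF : ∀ i j, ∃ P : Polynomial ℝ, ∀ x, F x i j = P.eval x := fun i j =>
      ⟨(1 - Polynomial.X) * Polynomial.C (B i j) + Polynomial.X * Polynomial.C (B' i j),
        fun x => by simp [F]; ring⟩
    have hfin : {x | ∃ t ∈ insert s T,
        ¬ Observable (F x) (Matrix.of fun (_ : Unit) => (Pi.single t 1 : ι → ℝ))}.Finite := by
      have : {x | ∃ t ∈ insert s T,
          ¬ Observable (F x) (Matrix.of fun (_ : Unit) => (Pi.single t 1 : ι → ℝ))} =
          ⋃ t ∈ insert s T,
            {x | ¬ Observable (F x) (Matrix.of fun (_ : Unit) => (Pi.single t 1 : ι → ℝ))} := by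
        ext x; simp
      rw [this]
      refine (insert s T).finite_toSet.biUnion fun t ht => ?_
      rcases Finset.mem_insert.1 ht with rfl | ht
      · exact finite_not_observable F _ hF (x₀ := 1) (by simpa [F] using hobs)
      · exact finite_not_observable F _ hF (x₀ := 0) (by simpa [F] using h3 t ht)
    obtain ⟨x, hx0, hx1, hx⟩ := exists_mem_Ioo_of_finite hfin
    refine ⟨F x, fun i j => ?_, fun i j => ?_, fun t ht => ?_⟩
    · have := mul_nonneg (sub_nonneg.2 hx1.le) (h1 i j)
      have := mul_nonneg hx0.le (hB'.nonneg i j)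
      simp only [F, Matrix.add_apply, Matrix.smul_apply, smul_eq_mul]
      linarith
    · simp only [F, Matrix.add_apply, Matrix.smul_apply, smul_eq_mul]
      constructor
      · intro h
        by_contra hN
        have e1 : B i j = 0 := by by_contra h'; exact hN ((h2 i j).1 h')
        have e2 : B' i j = 0 := by by_contra h'; exact hN (hB'.supp i j h').1
        exact h (by rw [e1, e2]; ring)
      · intro hN
        have e1 : 0 < B i j := lt_of_le_of_ne (h1 i j) ((h2 i j).2 hN).symm
        have := mul_pos (sub_pos.2 hx1) e1
        have := mul_nonneg hx0.le (hB'.nonneg i j)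
        linarith
    · by_contra hcon
      exact hx ⟨t, ht, hcon⟩

/-- The scaled matrix is (ρ D)⁻¹ B D with D = diag(p), so D carries its eigenvectors to eigenvectors
of B without moving their zeros. -/
theorem cAct_diagonal_scaling {B : Matrix ι ι ℝ} {p : ι → ℝ} (hp : ∀ s, 0 < p s) {ρ : ℝ}
    (hρ : 0 < ρ) {ω : ℂ} {u : ι → ℂ}
    (h : cAct (Matrix.of fun s t => B s t * p t / (ρ * p s)) u = ω • u) :
    cAct B (fun s => p s * u s) = (ρ * ω) • fun s => p s * u s := by
  ext s
  have h1 := congrFun h s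
  have hps : (p s : ℂ) ≠ 0 := by exact_mod_cast (hp s).ne'
  have hρ' : (ρ : ℂ) ≠ 0 := by exact_mod_cast hρ.ne'
  rw [cAct_apply] at h1 ⊢
  simp only [Pi.smul_apply, smul_eq_mul] at h1 ⊢
  have h2 : ∑ t, ((Matrix.of (fun s t => B s t * p t / (ρ * p s)) s t : ℝ) : ℂ) * u t =
      (∑ t, (B s t : ℂ) * (p t * u t)) / (ρ * p s) := by
    rw [Finset.sum_div]
    refine Finset.sum_congr rfl fun t _ => ?_
    simp only [Matrix.of_apply]
    push_cast
    ring
  rw [h2, div_eq_iff (mul_ne_zero hρ' hps)] at h1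
  rw [h1]
  ring

end Fusion

/-- Conjugation by the Perron vector, followed by division by its eigenvalue, makes the row sums 1.
It keeps the pattern and the supports of the eigenvectors. -/
theorem exists_fusionMatrix {m : ℕ} {Nβ : Fin m → Fin m → Prop} (hm : 0 < m)
    (hrefl : ∀ s, Nβ s s) (hconn : ∀ s t, Relation.ReflTransGen Nβ s t) :
    ∃ W, IsFusionMatrix Nβ W ∧
      ∀ (s : Fin m) (ω : ℂ) (u : Fin m → ℂ), cAct W u = ω • u → u s = 0 → u = 0 := by
  obtain ⟨B, h1, h2, h3⟩ := exists_full_support_eigenvectors hrefl hconn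
  have : Nonempty (Fin m) := ⟨⟨0, hm⟩⟩
  obtain ⟨p, ρ, hρ, hp, hBp⟩ := exists_pos_eigenvector h1
    (fun s => lt_of_le_of_ne (h1 s s) ((h2 s s).2 (hrefl s)).symm)
    (fun s t => Relation.ReflTransGen.mono (fun a b => (h2 a b).2) _ _ (hconn s t))
  refine ⟨Matrix.of fun s t => B s t * p t / (ρ * p s), ⟨fun s t => ?_, fun s t => ?_,
    fun s => ?_⟩, fun s ω u hu hus => ?_⟩
  · exact div_nonneg (mul_nonneg (h1 s t) (hp t).le) (mul_pos hρ (hp s)).le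
  · rw [← h2 s t]
    simp [hρ.ne', (hp _).ne']
  · simp only [Matrix.of_apply]
    rw [← Finset.sum_div, div_eq_one_iff_eq (mul_pos hρ (hp s)).ne']
    exact congrFun hBp s
  · have := h3 s _ _ (cAct_diagonal_scaling hp hρ hu) (by simp [hus])
    ext t
    have h4 := congrFun this t
    simpa [(hp t).ne'] using h4

/-- A fusion matrix close to the identity: its eigenvectors have full support, it is invertible, and
the ratios of its eigenvalues avoid those of the nonzero numbers in a given finite set. -/
theorem exists_fusionMatrix_separated {m : ℕ} {Nβ : Fin m → Fin m → Prop} (hm : 0 < m)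
    (hrefl : ∀ s, Nβ s s) (hconn : ∀ s t, Relation.ReflTransGen Nβ s t) {Λ : Set ℂ}
    (hΛ : Λ.Finite) :
    ∃ W, IsFusionMatrix Nβ W ∧
      (∀ (s : Fin m) (ω : ℂ) (u : Fin m → ℂ), cAct W u = ω • u → u s = 0 → u = 0) ∧
      (∀ u, cAct W u = 0 → u = 0) ∧
      ∀ (ω ω' : ℂ) (u u' : Fin m → ℂ), u ≠ 0 → u' ≠ 0 → cAct W u = ω • u → cAct W u' = ω' • u' →
        ∀ μ ∈ Λ, ∀ μ' ∈ Λ, ω * μ = ω' * μ' → μ = μ' := by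
  obtain ⟨W, ⟨h1, h2, h3⟩, h4⟩ := exists_fusionMatrix hm hrefl hconn
  let Ω : Set ℂ := {ω | Module.End.HasEigenvalue (cAct W) ω}
  have hΩ : Ω.Finite := Module.End.finite_hasEigenvalue _
  have hmemΩ : ∀ (ω : ℂ) (u : Fin m → ℂ), u ≠ 0 → cAct W u = ω • u → ω ∈ Ω := fun ω u hu h =>
    Module.End.hasEigenvalue_of_hasEigenvector ⟨Module.End.mem_eigenspace_iff.2 h, hu⟩
  -- These are the eigenvalues of (1 − x) I + x W, whose eigenvectors for x ≠ 0 are those of W. At x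
  -- = 0 all equal 1, where both conditions on the spectrum hold; being open, they persist for small
  -- x > 0.
  let g : ℂ → ℝ → ℂ := fun ω x => 1 - x + x * ω
  have hg : ∀ ω, Continuous (g ω) := fun ω => by fun_prop
  have hg0 : ∀ ω, g ω 0 = 1 := fun ω => by simp [g]
  have ev1 : ∀ᶠ x in nhds (0 : ℝ), ∀ ω ∈ Ω, g ω x ≠ 0 :=
    (Filter.eventually_all_finite hΩ).2 fun ω _ =>
      (hg ω).continuousAt.eventually_ne (by rw [hg0]; exact one_ne_zero)
  have ev2 : ∀ᶠ x in nhds (0 : ℝ), ∀ ω ∈ Ω, ∀ ω' ∈ Ω, ∀ μ ∈ Λ, ∀ μ' ∈ Λ,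
      g ω x * μ = g ω' x * μ' → μ = μ' := by
    refine (Filter.eventually_all_finite hΩ).2 fun ω _ =>
      (Filter.eventually_all_finite hΩ).2 fun ω' _ => (Filter.eventually_all_finite hΛ).2
      fun μ _ => (Filter.eventually_all_finite hΛ).2 fun μ' _ => ?_
    by_cases hμ : μ = μ'
    · exact Filter.Eventually.of_forall fun _ _ => hμ
    · have hc : Continuous fun x => g ω x * μ - g ω' x * μ' :=
        ((hg ω).mul continuous_const).sub ((hg ω').mul continuous_const)
      filter_upwards [hc.continuousAt.eventually_ne (x := (0 : ℝ)) (y := 0)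
        (by simpa [hg0] using sub_ne_zero.2 hμ)] with x hx h'
      exact absurd (sub_eq_zero.2 h') hx
  obtain ⟨x, hx, hx0, hx1⟩ := (((ev1.and ev2).filter_mono nhdsWithin_le_nhds).and
    (Ioo_mem_nhdsGT (zero_lt_one' ℝ))).exists
  have hV : ∀ u, cAct ((1 - x) • (1 : Matrix (Fin m) (Fin m) ℝ) + x • W) u =
      (1 - x : ℂ) • u + (x : ℂ) • cAct W u := by
    intro u
    ext s
    simp only [Pi.add_apply, Pi.smul_apply, smul_eq_mul, cAct_apply, Finset.mul_sum]
    rw [← show (∑ t, if s = t then (1 - x : ℂ) * u t else 0) = (1 - x : ℂ) * u s by simp,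
      ← Finset.sum_add_distrib]
    refine Finset.sum_congr rfl fun t _ => ?_
    simp only [Matrix.add_apply, Matrix.smul_apply, Matrix.one_apply, smul_eq_mul]
    split_ifs <;> push_cast <;> ring
  have hback : ∀ (ω : ℂ) (u : Fin m → ℂ),
      cAct ((1 - x) • (1 : Matrix (Fin m) (Fin m) ℝ) + x • W) u = ω • u →
      ∃ ω₁, cAct W u = ω₁ • u ∧ ω = g ω₁ x := by
    intro ω u hu
    have hxC : (x : ℂ) ≠ 0 := by exact_mod_cast hx0.ne'
    refine ⟨(ω - (1 - x)) / x, ?_, ?_⟩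
    · rw [hV] at hu
      have h5 : (x : ℂ) • cAct W u = (ω - (1 - x)) • u := by
        rw [sub_smul, ← hu]; abel
      rw [div_eq_inv_mul, mul_smul, ← h5, smul_smul, inv_mul_cancel₀ hxC, one_smul]
    · simp only [g]
      field_simp
      ring
  refine ⟨(1 - x) • (1 : Matrix (Fin m) (Fin m) ℝ) + x • W, ⟨fun s t => ?_, fun s t => ?_,
    fun s => ?_⟩, ?_, ?_, ?_⟩
  · simp only [Matrix.add_apply, Matrix.smul_apply, Matrix.one_apply, smul_eq_mul]
    have := mul_nonneg hx0.le (h1 s t)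
    split_ifs <;> linarith
  · rw [← h2 s t]
    simp only [Matrix.add_apply, Matrix.smul_apply, Matrix.one_apply, smul_eq_mul]
    by_cases hst : s = t
    · subst hst
      have h5 := (h2 s s).2 (hrefl s)
      have h6 : 0 < W s s := lt_of_le_of_ne (h1 s s) h5.symm
      have := mul_pos hx0 h6
      simp only [if_true, h5, ne_eq, not_false_eq_true, iff_true]
      linarith
    · simp [hst, hx0.ne']
  · simp only [Matrix.add_apply, Matrix.smul_apply, Matrix.one_apply, smul_eq_mul]
    rw [Finset.sum_add_distrib, ← Finset.mul_sum, ← Finset.mul_sum, h3]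
    simp
  · intro s ω u hu hus
    obtain ⟨ω₁, h5, -⟩ := hback ω u hu
    exact h4 s ω₁ u h5 hus
  · intro u hu
    obtain ⟨ω₁, h5, h6⟩ := hback 0 u (by simpa using hu)
    by_contra hu0
    exact hx.1 ω₁ (hmemΩ _ _ hu0 h5) h6.symm
  · intro ω ω' u u' hu hu' h5 h6 μ hμ μ' hμ' h7
    obtain ⟨ω₁, h8, rfl⟩ := hback ω u h5
    obtain ⟨ω₂, h9, rfl⟩ := hback ω' u' h6
    exact hx.2 ω₁ (hmemΩ _ _ hu h8) ω₂ (hmemΩ _ _ hu' h9) μ hμ μ' hμ' h7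

/-! ### Observability of the networked system -/

section Network

variable {n m : ℕ}

/-- For unit gains D_H is diagonal, and its entry at (s, x) counts the sensors of N_α(s) that
measure x. -/
theorem fusedMeasurement_apply_eq_zero {Nα : Fin m → Fin m → Prop} {σ : Fin m → Fin n}
    {v : Fin m × Fin n → ℂ}
    (h : ((fusedMeasurement Nα (measurement σ fun _ => 1)).map Complex.ofReal) *ᵥ v = 0)
    {s t : Fin m} (hst : Nα s t) : v (s, σ t) = 0 := by
  classical
  have key : fusedMeasurement Nα (measurement σ fun _ => 1) = Matrix.diagonal fun z =>
      ((Finset.univ.filter fun t => Nα z.1 t ∧ σ t = z.2).card : ℝ) := by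
    ext ⟨s, x⟩ ⟨s', x'⟩
    simp only [fusedMeasurement, measurement, Matrix.reindex_apply, Matrix.submatrix_apply,
      Equiv.prodComm_symm, Equiv.prodComm_apply, Prod.swap_prod_mk, Matrix.blockDiagonal_apply,
      Matrix.diagonal_apply, Prod.mk.injEq]
    by_cases hs : s = s'
    · subst hs
      simp only [if_true, true_and, Matrix.sum_apply, Matrix.vecMulVec_apply, Matrix.of_apply]
      by_cases hx : x = x'
      · subst hx
        rw [if_pos rfl, ← Finset.filter_filter, Finset.card_filter]
        push_cast
        refine Finset.sum_congr (by congr) fun t _ => ?_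
        simp only [Pi.single_apply, eq_comm (a := x)]
        split_ifs <;> simp
      · rw [if_neg hx]
        refine Finset.sum_eq_zero fun t _ => ?_
        simp only [Pi.single_apply]
        split_ifs with h1 h2
        · exact absurd (h1.trans h2.symm) hx
        all_goals simp
    · simp [hs]
  have h1 := congrFun h (s, σ t)
  rw [key, Matrix.diagonal_map Complex.ofReal_zero, Matrix.mulVec_diagonal] at h1
  simp only [Pi.zero_apply, mul_eq_zero] at h1
  refine h1.resolve_left ?_
  have : (Finset.univ.filter fun t' => Nα s t' ∧ σ t' = σ t).card ≠ 0 :=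
    Finset.card_ne_zero.2 ⟨t, by simp [hst]⟩
  simpa using this

/-- Observability of `(W ⊗ A, D_H)` from properties of `A` and `W` alone. -/
theorem observable_kronecker {E : Fin n → Fin n → Prop} {π : Equiv.Perm (Fin n)}
    {δ : Set (Fin n)} {σ : Fin m → Fin n} {Nα : Fin m → Fin m → Prop}
    {A : Matrix (Fin n) (Fin n) ℝ} {W : Matrix (Fin m) (Fin m) ℝ}
    (hA : Cactus E π δ (Set.range σ) Set.univ A) (hαs : ∀ s, Nα s s)
    (hhub : ∀ x ∈ δ, ∃ t, σ t = x ∧ ∀ s, Nα s t)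
    (hW1 : ∀ (s : Fin m) (ω : ℂ) (u : Fin m → ℂ), cAct W u = ω • u → u s = 0 → u = 0)
    (hW0 : ∀ u, cAct W u = 0 → u = 0)
    (hW2 : ∀ (ω ω' : ℂ) (u u' : Fin m → ℂ), u ≠ 0 → u' ≠ 0 → cAct W u = ω • u →
      cAct W u' = ω' • u' → ∀ μ μ' : ℂ, Module.End.HasEigenvalue (cAct A) μ →
        Module.End.HasEigenvalue (cAct A) μ' → ω * μ = ω' * μ' → μ = μ') :
    Observable (W ⊗ₖ A) (fusedMeasurement Nα (measurement σ fun _ => 1)) := by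
  rw [observable_iff_eigenvector]
  intro lam v hv hout
  replace hout : ∀ s t, Nα s t → v (s, σ t) = 0 := fun s t h =>
    fusedMeasurement_apply_eq_zero hout h
  let TA : (Fin m × Fin n → ℂ) →ₗ[ℂ] (Fin m × Fin n → ℂ) := cAct ((1 : Matrix _ _ ℝ) ⊗ₖ A)
  let TW : (Fin m × Fin n → ℂ) →ₗ[ℂ] (Fin m × Fin n → ℂ) := cAct (W ⊗ₖ (1 : Matrix _ _ ℝ))
  have hTA : ∀ V s x, TA V (s, x) = cAct A (fun y => V (s, y)) x := by
    intro V s x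
    simp only [TA, cAct_apply, Fintype.sum_prod_type, Matrix.kroneckerMap_apply, Matrix.one_apply]
    rw [Finset.sum_eq_single s]
    · simp
    · intro t _ ht
      simp [Ne.symm ht]
    · simp
  have hTW : ∀ V s x, TW V (s, x) = cAct W (fun t => V (t, x)) s := by
    intro V s x
    simp only [TW, cAct_apply, Fintype.sum_prod_type, Matrix.kroneckerMap_apply, Matrix.one_apply]
    refine Finset.sum_congr rfl fun t _ => ?_
    rw [Finset.sum_eq_single x]
    · simp
    · intro y _ hy
      simp [Ne.symm hy]
    · simp
  have hrows : ∀ {V U : Fin m × Fin n → ℂ} (s), TA V = U →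
      cAct A (fun y => V (s, y)) = fun y => U (s, y) := by
    intro V U s h
    ext x
    rw [← hTA, h]
  have hcols : ∀ {V U : Fin m × Fin n → ℂ} (x), TW V = U →
      cAct W (fun t => V (t, x)) = fun t => U (t, x) := by
    intro V U x h
    ext s
    rw [← hTW, h]
  have hcompl : ∀ P Q : Matrix (Fin m × Fin n) (Fin m × Fin n) ℝ,
      cAct (P * Q) = cAct P ∘ₗ cAct Q := by
    intro P Q
    rw [cAct, cAct, cAct, ← Matrix.toLin'_mul]
    congr 1
    exact Matrix.map_mul (f := Complex.ofRealHom)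
  have hWA : cAct (W ⊗ₖ A) = TW ∘ₗ TA := by
    rw [← hcompl, ← Matrix.mul_kronecker_mul, mul_one, one_mul]
  have hAW : cAct (W ⊗ₖ A) = TA ∘ₗ TW := by
    rw [← hcompl, ← Matrix.mul_kronecker_mul, mul_one, one_mul]
  -- Fusion does not help for the eigenvalue 0: W is injective, so every block of v lies in the
  -- kernel of A. That kernel is detected on δ, which each sensor sees directly.
  by_cases hlam : lam = 0
  · subst hlam
    rw [zero_smul, hWA, LinearMap.comp_apply] at hv
    have h1 : TA v = 0 := by
      ext ⟨s, x⟩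
      have := hW0 _ (hcols x hv)
      exact congrFun this s
    ext ⟨s, x⟩
    have h2 := hA.inj 0 _ (by simp) (by rw [zero_smul]; exact hrows s h1)
      (fun x hx => by
        obtain ⟨t, rfl, ht⟩ := hhub x hx
        exact hout s t (ht s)) (Or.inl rfl)
    exact congrFun h2 x
  -- 1 ⊗ A commutes with W ⊗ A and so acts on this eigenspace. An eigenvalue μ of it there pairs
  -- with the eigenvalue lam / μ of W, which by `hW2` leaves a single μ.
  let X : Submodule ℂ (Fin m × Fin n → ℂ) := LinearMap.ker (cAct (W ⊗ₖ A) - lam • LinearMap.id)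
  have hX : ∀ V, V ∈ X ↔ cAct (W ⊗ₖ A) V = lam • V := fun V => by
    simp [X, sub_eq_zero]
  have hXA : ∀ V ∈ X, TA V ∈ X := by
    intro V hV
    rw [hX] at hV ⊢
    rw [hAW, LinearMap.comp_apply, ← LinearMap.comp_apply TW, ← hWA, hV, map_smul]
  have heig : ∀ (μ : ℂ) (U : Fin m × Fin n → ℂ), U ∈ X → U ≠ 0 → TA U = μ • U →
      μ ≠ 0 ∧ TW U = (lam / μ) • U ∧ Module.End.HasEigenvalue (cAct A) μ ∧
        ∃ u, u ≠ 0 ∧ cAct W u = (lam / μ) • u := by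
    intro μ U hU hU0 hAU
    rw [hX, hWA, LinearMap.comp_apply, hAU, map_smul] at hU
    have hμ : μ ≠ 0 := by
      rintro rfl
      rw [zero_smul] at hU
      exact hU0 ((smul_eq_zero.1 hU.symm).resolve_left hlam)
    have hWU : TW U = (lam / μ) • U := by
      rw [div_eq_inv_mul, mul_smul, ← hU, smul_smul, inv_mul_cancel₀ hμ, one_smul]
    obtain ⟨⟨s, x⟩, hsx⟩ := Function.ne_iff.1 hU0
    refine ⟨hμ, hWU, ?_, fun t => U (t, x), fun h => hsx (congrFun h s), hcols x hWU⟩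
    exact Module.End.hasEigenvalue_of_hasEigenvector (x := fun y => U (s, y))
      ⟨Module.End.mem_eigenspace_iff.2 (hrows s hAU), fun h => hsx (congrFun h x)⟩
  by_contra hv0
  have hvX : v ∈ X := (hX v).2 hv
  obtain ⟨μ, U, hUX, hU0, hAU⟩ := exists_eigenvector_mem TA X hXA
    (fun h => hv0 (by rw [h] at hvX; simpa using hvX))
  obtain ⟨hμ, -, hμA, u, hu, hWu⟩ := heig μ U hUX hU0 hAU
  -- the matrix `A` acts on the eigenspace as a scalar
  have hscalar : ∀ V ∈ X, TA V = μ • V := by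
    let Y : Submodule ℂ (Fin m × Fin n → ℂ) := X.map (TA - μ • LinearMap.id)
    have hYX : ∀ V ∈ Y, V ∈ X := by
      rintro _ ⟨V, hV, rfl⟩
      simpa using X.sub_mem (hXA V hV) (X.smul_mem μ hV)
    have hY : Y = ⊥ := by
      -- An eigenvector of `TA` inside the range of `TA` − μ again has eigenvalue μ. It would be the
      -- end of a Jordan chain of A, which `semisimple` forbids.
      by_contra hne
      obtain ⟨μ', Z, hZ, hZ0, hAZ⟩ := exists_eigenvector_mem TA Y (by
        rintro _ ⟨V, hV, rfl⟩
        exact ⟨TA V, hXA V hV, by simp⟩) hne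
      obtain ⟨hμ', -, hμA', u', hu', hWu'⟩ := heig μ' Z (hYX Z hZ) hZ0 hAZ
      obtain rfl : μ = μ' := hW2 _ _ u u' hu hu' hWu hWu' μ μ' hμA hμA'
        (by rw [div_mul_cancel₀ _ hμ, div_mul_cancel₀ _ hμ'])
      obtain ⟨V, hV, rfl⟩ := hZ
      refine hZ0 ?_
      ext ⟨s, x⟩
      have h1 : TA V = μ • V + (TA - μ • LinearMap.id : Module.End ℂ _) V := by simp
      exact congrFun (hA.semisimple μ _ _ hμ (by simp) (hrows s h1) (hrows s hAZ)) x
    intro V hV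
    have h1 : (TA - μ • LinearMap.id : Module.End ℂ _) V ∈ Y := ⟨V, hV, rfl⟩
    rw [hY, Submodule.mem_bot] at h1
    simpa [sub_eq_zero] using h1
  have hAv := hscalar v hvX
  obtain ⟨-, hWv, -, -⟩ := heig μ v hvX hv0 hAv
  -- Sensor s sees its own state, so the column of that state is an eigenvector of W with a zero at
  -- s, and therefore vanishes at every sensor r.
  have hcol : ∀ s r, v (r, σ s) = 0 := fun s r =>
    congrFun (hW1 s _ _ (hcols (σ s) hWv) (hout s s (hαs s))) r
  refine hv0 ?_
  ext ⟨s, x⟩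
  have hmeas : ∀ x ∈ Set.range σ, v (s, x) = 0 := by
    rintro _ ⟨t, rfl⟩
    exact hcol t s
  exact congrFun (hA.inj μ _ (by simp) (hrows s hAv) (fun x hx => by
    obtain ⟨t, rfl, -⟩ := hhub x hx
    exact hcol t s) (Or.inr hmeas)) x

open Classical in
/-- The perturbation of a realization that makes all entries of the links nonzero. -/
noncomputable def perturbation (E : Fin n → Fin n → Prop) (A : Matrix (Fin n) (Fin n) ℝ) (x : ℝ) :
    Matrix (Fin n) (Fin n) ℝ :=
  Matrix.of fun v u => A v u + x * if E u v then 1 else 0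

/-- This is where nonnegativity of the sparse matrix is used: adding x > 0 on the links cannot
cancel an entry. -/
theorem realizes_perturbation {E : Fin n → Fin n → Prop} {A : Matrix (Fin n) (Fin n) ℝ}
    (h0 : ∀ v u, 0 ≤ A v u) (hE : ∀ v u, A v u ≠ 0 → E u v) {x : ℝ} (hx : 0 < x) :
    Realizes E (perturbation E A x) := by
  intro u v
  simp only [perturbation, Matrix.of_apply]
  by_cases h : E u v
  · have := h0 v u
    simp only [h, if_true, mul_one, iff_true]
    exact (by linarith : (0 : ℝ) < A v u + x).ne'
  · have : A v u = 0 := by by_contra h'; exact h (hE v u h')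
    simp [h, this]

theorem perturbation_zero (E : Fin n → Fin n → Prop) (A : Matrix (Fin n) (Fin n) ℝ) :
    perturbation E A 0 = A := by
  ext; simp [perturbation]

open Polynomial in
theorem perturbation_polynomial (E : Fin n → Fin n → Prop) (A : Matrix (Fin n) (Fin n) ℝ)
    (i j : Fin n) : ∃ P : ℝ[X], ∀ x, perturbation E A x i j = P.eval x := by
  classical
  exact ⟨C (A i j) + X * C (if E j i then 1 else 0), fun x => by
    simp only [perturbation, Matrix.of_apply]
    split_ifs <;> simp⟩

/-- The sparse matrix may miss links. It is the member x = 0 of a polynomial family whose members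
with x > 0 have the exact pattern, and observability fails for finitely many x only. -/
theorem structurallyObservable_of_cactus {E : Fin n → Fin n → Prop} {π : Equiv.Perm (Fin n)}
    {δ : Set (Fin n)} {σ : Fin m → Fin n} {A : Matrix (Fin n) (Fin n) ℝ}
    (hA : Cactus E π δ (Set.range σ) Set.univ A) (hδ : δ ⊆ Set.range σ) :
    StructurallyObservable E σ := by
  have hobs : Observable A (measurement σ fun _ => 1) := by
    rw [observable_iff_eigenvector]
    intro μ a ha hout
    have hmeas : ∀ x ∈ Set.range σ, a x = 0 := by
      rintro _ ⟨s, rfl⟩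
      have h1 := congrFun hout s
      rw [Matrix.mulVec, dotProduct, Finset.sum_eq_single (σ s)] at h1
      · simpa [measurement] using h1
      · intro t _ ht
        simp [measurement, ht]
      · simp
    exact hA.inj μ a (by simp) ha (fun x hx => hmeas x (hδ hx)) (Or.inr hmeas)
  obtain ⟨x, hx0, -, hx⟩ := exists_mem_Ioo_of_finite (finite_not_observable (perturbation E A) _
    (perturbation_polynomial E A) (x₀ := 0) (by rwa [perturbation_zero]))
  exact ⟨perturbation E A x, fun _ => 1,
    realizes_perturbation hA.nonneg (fun v u h => (hA.supp v u h).1) hx0, by simp, not_not.1 hx⟩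

/-- W is adapted to the spectrum of the sparse matrix and then kept fixed, so only A moves and the
same one-parameter genericity applies. -/
theorem structurallyDistributedObservable_of_cactus {E : Fin n → Fin n → Prop}
    {π : Equiv.Perm (Fin n)} {δ : Set (Fin n)} {σ : Fin m → Fin n}
    {A : Matrix (Fin n) (Fin n) ℝ} {Nα Nβ : Fin m → Fin m → Prop} (hm : 0 < m)
    (hA : Cactus E π δ (Set.range σ) Set.univ A) (hαs : ∀ s, Nα s s)
    (hhub : ∀ x ∈ δ, ∃ t, σ t = x ∧ ∀ s, Nα s t)
    (hβs : ∀ s, Nβ s s) (hβ : ∀ s t, Relation.ReflTransGen Nβ s t) :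
    StructurallyDistributedObservable E σ Nα Nβ := by
  obtain ⟨W, hW, hW1, hW0, hW2⟩ := exists_fusionMatrix_separated hm hβs hβ
    (Module.End.finite_hasEigenvalue (cAct A))
  have hobs := observable_kronecker hA hαs hhub hW1 hW0
    (fun ω ω' u u' hu hu' h h' μ μ' hμ hμ' => hW2 ω ω' u u' hu hu' h h' μ hμ μ' hμ')
  obtain ⟨x, hx0, -, hx⟩ := exists_mem_Ioo_of_finite
    (finite_not_observable (fun x => W ⊗ₖ perturbation E A x) _ (fun i j => by
      obtain ⟨P, hP⟩ := perturbation_polynomial E A i.2 j.2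
      exact ⟨Polynomial.C (W i.1 j.1) * P, fun x => by simp [Matrix.kroneckerMap_apply, hP]⟩)
      (x₀ := 0) (by rwa [perturbation_zero]))
  exact ⟨perturbation E A x, fun _ => 1, W,
    realizes_perturbation hA.nonneg (fun v u h => (hA.supp v u h).1) hx0, by simp, hW,
    not_not.1 hx⟩

end Network

/-! ### Recovery -/

/-- Among the nodes reachable from u, take one with the fewest descendants. Each of its descendants
has the same descendants and so leads back to it, and its component has no exit. -/
theorem exists_reachable_parentSCC {n : ℕ} (E : Fin n → Fin n → Prop) (u : Fin n) :
    ∃ P, IsParentSCC E P ∧ ∀ x ∈ P, Relation.ReflTransGen E u x := by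
  let D : Fin n → Set (Fin n) := fun v => {w | Relation.ReflTransGen E v w}
  obtain ⟨v, hv, hmin⟩ := (Set.toFinite {v | Relation.ReflTransGen E u v}).exists_minimalFor
    (fun v => (D v).ncard) _ ⟨u, .refl⟩
  have hback : ∀ w, Relation.ReflTransGen E v w → Relation.ReflTransGen E w v := by
    intro w hw
    have hsub : D w ⊆ D v := fun x hx => hw.trans hx
    have : D w = D v := Set.eq_of_subset_of_ncard_le hsub
      (hmin (hv.trans hw) (Set.ncard_le_ncard hsub (Set.toFinite _))) (Set.toFinite _)
    have hvv : v ∈ D v := .refl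
    rwa [← this] at hvv
  refine ⟨scc E v, ⟨⟨v, rfl⟩, fun a ha w haw => ?_⟩, fun x hx => hv.trans hx.1⟩
  exact ⟨ha.1.tail haw, hback _ (ha.1.tail haw)⟩

/-- A matching extends to a permutation of the states. -/
theorem IsMatching.exists_perm {n : ℕ} {E : Fin n → Fin n → Prop} {M : Finset (Fin n × Fin n)}
    (hM : IsMatching E M) : ∃ π : Equiv.Perm (Fin n), ∀ u ∉ unmatched M, E u (π u) := by
  classical
  have hex : ∀ u, ∃ v, u ∉ unmatched M → (u, v) ∈ M := by
    intro u
    by_cases h : u ∈ unmatched M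
    · exact ⟨u, fun h' => absurd h h'⟩
    · have := mt mem_unmatched.2 h
      push Not at this
      obtain ⟨v, hv⟩ := this
      exact ⟨v, fun _ => hv⟩
  choose f hf using hex
  obtain ⟨g, hg⟩ := Finset.exists_equiv_extend_of_card_eq (α := Fin n) (β := Fin n)
    (t := Finset.univ) (by simp) (s := (unmatched M)ᶜ) (f := f) (Finset.subset_univ _) (by
      intro a ha b hb hab
      have h1 := hf a (by simpa using ha)
      have h2 := hf b (by simpa using hb)
      have := hM.2 _ h1 _ h2 (Or.inr hab)
      exact congrArg Prod.fst this)
  refine ⟨g.trans (Equiv.subtypeUnivEquiv (by simp)), fun u hu => ?_⟩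
  have : (g.trans (Equiv.subtypeUnivEquiv (by simp)) : Equiv.Perm (Fin n)) u = f u :=
    hg u (by simpa using hu)
  rw [this]
  exact hM.1 _ (hf u hu)

/-- Apply the criterion to M' with δM' = (δM \ {i}) ∪ {j}: the other α-sensors still cover δM \ {i},
and `f` keeps its place as a hub while measuring j. A parent SCC can lose a measurement only if it
contains i, and then it contains j or has another sensor by `hfP`. -/
theorem recovery {n : ℕ} {E : Fin n → Fin n → Prop} {M : Finset (Fin n × Fin n)}
    (hM : IsMaximumMatching E M) {i : Fin n} (hi : i ∈ unmatched M) {j : Fin n}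
    (hj : j ∈ contraction E M i) {m : ℕ} {σ : Fin m → Fin n} {Nα Nβ : Fin m → Fin m → Prop}
    {f : Fin m} (hσ : ∀ x ∈ unmatched M, ∃ s, σ s = x)
    (hP : ∀ P, IsParentSCC E P → ∃ s, σ s ∈ P) (hαs : ∀ s, Nα s s)
    (hα : ∀ a, σ a ∈ unmatched M → ∀ s, Nα s a) (hβs : ∀ s, Nβ s s)
    (hβ : ∀ s t, Relation.ReflTransGen Nβ s t) (hf : σ f = i)
    (hfP : ∀ P, IsParentSCC E P → i ∈ P → j ∉ P → ∃ s, s ≠ f ∧ σ s ∈ P) :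
    StructurallyObservable E (Function.update σ f j) ∧
      StructurallyDistributedObservable E (Function.update σ f j) Nα Nβ := by
  obtain ⟨M', hM', hδ⟩ := exists_maximum_matching_of_contraction hM hi hj
  obtain ⟨π, hπ⟩ := hM'.1.exists_perm
  have hhub : ∀ x ∈ (unmatched M' : Set (Fin n)),
      ∃ t, Function.update σ f j t = x ∧ ∀ s, Nα s t := by
    intro x hx
    rcases (hδ x).1 hx with ⟨h1, h2⟩ | rfl
    · obtain ⟨s, rfl⟩ := hσ x h1
      have : s ≠ f := by rintro rfl; exact h2 hf
      exact ⟨s, Function.update_of_ne this _ _, hα s h1⟩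
    · exact ⟨f, Function.update_self _ _ _, hα f (hf ▸ hi)⟩
  have hsub : (unmatched M' : Set (Fin n)) ⊆ Set.range (Function.update σ f j) := by
    intro x hx
    obtain ⟨t, ht, -⟩ := hhub x hx
    exact ⟨t, ht⟩
  have hreach : ∀ u, ∃ v ∈ Set.range (Function.update σ f j), Relation.ReflTransGen E u v := by
    intro u
    obtain ⟨P, hPp, hPu⟩ := exists_reachable_parentSCC E u
    suffices h : ∃ s, Function.update σ f j s ∈ P by
      obtain ⟨s, hs⟩ := h
      exact ⟨_, ⟨s, rfl⟩, hPu _ hs⟩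
    obtain ⟨s, hs⟩ := hP P hPp
    by_cases hsf : s = f
    · subst hsf
      by_cases hjP : j ∈ P
      · exact ⟨s, by rwa [Function.update_self]⟩
      · obtain ⟨t, ht, htP⟩ := hfP P hPp (hf ▸ hs) hjP
        exact ⟨t, by rwa [Function.update_of_ne ht]⟩
    · exact ⟨s, by rwa [Function.update_of_ne hsf]⟩
  obtain ⟨A, hA⟩ := exists_cactus (E := E) (π := π) (δ := unmatched M')
    (meas := Set.range (Function.update σ f j)) (by simpa using hπ) hsub hreach
  exact ⟨structurallyObservable_of_cactus hA hsub,
    structurallyDistributedObservable_of_cactus f.pos hA hαs hhub hβs hβ⟩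

/-! ### Reasoning about programs -/

/-- The program `c`, started in `s`, halts, and its running time and final state satisfy `R`. -/
def Halts (c : Prog) (s : Store) (R : ℕ → Store → Prop) : Prop :=
  ∃ t s', Exec c s t s' ∧ R t s'

theorem Halts.mono {c : Prog} {s : Store} {R R' : ℕ → Store → Prop} (h : Halts c s R)
    (h' : ∀ t s', Exec c s t s' → R t s' → R' t s') : Halts c s R' := by
  obtain ⟨t, s', h1, h2⟩ := h
  exact ⟨t, s', h1, h' t s' h1 h2⟩

section Rules

variable {s : Store} {R : ℕ → Store → Prop}

theorem halts_setConst {d k : ℕ} : Halts (.setConst d k) s R ↔ R 1 (s.setReg d k) :=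
  ⟨by rintro ⟨_, _, ⟨⟩, h⟩; exact h, fun h => ⟨_, _, .setConst _ _ _, h⟩⟩

theorem halts_copy {d i : ℕ} : Halts (.copy d i) s R ↔ R 1 (s.setReg d (s.reg i)) :=
  ⟨by rintro ⟨_, _, ⟨⟩, h⟩; exact h, fun h => ⟨_, _, .copy _ _ _, h⟩⟩

theorem halts_incr {d : ℕ} : Halts (.incr d) s R ↔ R 1 (s.setReg d (s.reg d + 1)) :=
  ⟨by rintro ⟨_, _, ⟨⟩, h⟩; exact h, fun h => ⟨_, _, .incr _ _, h⟩⟩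

theorem halts_decr {d : ℕ} : Halts (.decr d) s R ↔ R 1 (s.setReg d (s.reg d - 1)) :=
  ⟨by rintro ⟨_, _, ⟨⟩, h⟩; exact h, fun h => ⟨_, _, .decr _ _, h⟩⟩

theorem halts_load {d a i j : ℕ} :
    Halts (.load d a i j) s R ↔ R 1 (s.setReg d (s.arr a (s.reg i) (s.reg j))) :=
  ⟨by rintro ⟨_, _, ⟨⟩, h⟩; exact h, fun h => ⟨_, _, .load _ _ _ _ _, h⟩⟩

theorem halts_store {a i j d : ℕ} :
    Halts (.store a i j d) s R ↔ R 1 (s.setArr a (s.reg i) (s.reg j) (s.reg d)) :=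
  ⟨by rintro ⟨_, _, ⟨⟩, h⟩; exact h, fun h => ⟨_, _, .store _ _ _ _ _, h⟩⟩

theorem halts_seq {c₁ c₂ : Prog} :
    Halts (.seq c₁ c₂) s R ↔ Halts c₁ s fun t s' => Halts c₂ s' fun t' s'' => R (t + t') s'' := by
  constructor
  · rintro ⟨_, _, h, hR⟩
    cases h with
    | seq _ _ _ _ _ _ _ h1 h2 => exact ⟨_, _, h1, _, _, h2, hR⟩
  · rintro ⟨t, s', h1, t', s'', h2, hR⟩
    exact ⟨_, _, .seq _ _ _ _ _ _ _ h1 h2, hR⟩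

theorem halts_ite {b : Test} {c₁ c₂ : Prog} : Halts (.ite b c₁ c₂) s R ↔
    (b.holds s → Halts c₁ s fun t s' => R (t + 1) s') ∧
      (¬ b.holds s → Halts c₂ s fun t s' => R (t + 1) s') := by
  constructor
  · rintro ⟨_, _, h, hR⟩
    cases h with
    | ite_true _ _ _ _ _ _ hb h => exact ⟨fun _ => ⟨_, _, h, hR⟩, fun hb' => absurd hb hb'⟩
    | ite_false _ _ _ _ _ _ hb h => exact ⟨fun hb' => absurd hb' hb, fun _ => ⟨_, _, h, hR⟩⟩
  · rintro ⟨h1, h2⟩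
    by_cases hb : b.holds s
    · obtain ⟨t, s', h, hR⟩ := h1 hb
      exact ⟨_, _, .ite_true _ _ _ _ _ _ hb h, hR⟩
    · obtain ⟨t, s', h, hR⟩ := h2 hb
      exact ⟨_, _, .ite_false _ _ _ _ _ _ hb h, hR⟩

/-- The rule for loops: the invariant `I` sees the time elapsed so far, and bounds it. -/
theorem halts_loop {b : Test} {c : Prog} (I : ℕ → Store → Prop) {B : ℕ}
    (hB : ∀ τ s, I τ s → τ ≤ B)
    (hc : ∀ τ s, I τ s → b.holds s → Halts c s fun t s' => I (τ + t + 1) s') (h0 : I 0 s) :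
    Halts (.loop b c) s fun t s' => ∃ τ, I τ s' ∧ ¬ b.holds s' ∧ t = τ + 1 := by
  -- `f` is the time left below the bound. Each pass costs at least one step, so bounded time takes
  -- the place of a loop variant.
  suffices h : ∀ f τ s, B ≤ τ + f → I τ s →
      Halts (.loop b c) s fun t s' => ∃ τ', I τ' s' ∧ ¬ b.holds s' ∧ τ + t = τ' + 1 by
    refine (h B 0 s (by omega) h0).mono fun t s' _ => ?_
    simp
  intro f
  induction f with
  | zero =>
    intro τ s hf hI
    by_cases hb : b.holds s
    · obtain ⟨t, s', -, h2⟩ := hc τ s hI hb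
      have := hB _ _ h2
      omega
    · exact ⟨1, s, .loop_false _ _ _ hb, τ, hI, hb, rfl⟩
  | succ f ih =>
    intro τ s hf hI
    by_cases hb : b.holds s
    · obtain ⟨t, s', h1, h2⟩ := hc τ s hI hb
      obtain ⟨t', s'', h3, τ', h4, h5, h6⟩ := ih (τ + t + 1) s' (by omega) h2
      exact ⟨_, _, .loop_true _ _ _ _ _ _ _ hb h1 h3, τ', h4, h5, by omega⟩
    · exact ⟨1, s, .loop_false _ _ _ hb, τ, hI, hb, rfl⟩

end Rules

/-! ### Memory accesses and frame rules -/

@[simp] theorem holds_eq {s : Store} {i j : ℕ} : (Test.eq i j).holds s ↔ s.reg i = s.reg j :=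
  Iff.rfl

@[simp] theorem holds_lt {s : Store} {i j : ℕ} : (Test.lt i j).holds s ↔ s.reg i < s.reg j :=
  Iff.rfl

@[simp] theorem setReg_reg (s : Store) (d x r : ℕ) :
    (s.setReg d x).reg r = if r = d then x else s.reg r := by
  simp [Store.setReg, Function.update_apply]

@[simp] theorem setReg_arr (s : Store) (d x : ℕ) : (s.setReg d x).arr = s.arr := rfl

@[simp] theorem setArr_reg (s : Store) (a i j x : ℕ) : (s.setArr a i j x).reg = s.reg := rfl

@[simp] theorem setArr_arr (s : Store) (a i j x b k : ℕ) : (s.setArr a i j x).arr b k =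
    if b = a ∧ k = i then Function.update (s.arr b k) j x else s.arr b k := by
  simp only [Store.setArr, Function.update_apply]
  by_cases h : b = a
  · subst h
    by_cases h' : k = i
    · subst h'; simp
    · simp [h']
  · simp [h]

/-- The registers written by a program. -/
def Prog.regs : Prog → List ℕ
  | .setConst d _ => [d]
  | .copy d _ => [d]
  | .incr d => [d]
  | .decr d => [d]
  | .load d _ _ _ => [d]
  | .store _ _ _ _ => []
  | .seq c₁ c₂ => c₁.regs ++ c₂.regs
  | .ite _ c₁ c₂ => c₁.regs ++ c₂.regs
  | .loop _ c => c.regs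

/-- The arrays written by a program. -/
def Prog.arrs : Prog → List ℕ
  | .store a _ _ _ => [a]
  | .seq c₁ c₂ => c₁.arrs ++ c₂.arrs
  | .ite _ c₁ c₂ => c₁.arrs ++ c₂.arrs
  | .loop _ c => c.arrs
  | _ => []

/-- The arrays read by a program. -/
def Prog.reads : Prog → List ℕ
  | .load _ a _ _ => [a]
  | .seq c₁ c₂ => c₁.reads ++ c₂.reads
  | .ite _ c₁ c₂ => c₁.reads ++ c₂.reads
  | .loop _ c => c.reads
  | _ => []

theorem Exec.reg_eq {c : Prog} {s s' : Store} {t : ℕ} (h : Exec c s t s') {r : ℕ}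
    (hr : r ∉ c.regs) : s'.reg r = s.reg r := by
  induction h with
  | seq _ _ _ _ _ _ _ _ _ ih1 ih2 =>
    simp only [Prog.regs, List.mem_append, not_or] at hr
    rw [ih2 hr.2, ih1 hr.1]
  | ite_true _ _ _ _ _ _ _ _ ih =>
    simp only [Prog.regs, List.mem_append, not_or] at hr
    exact ih hr.1
  | ite_false _ _ _ _ _ _ _ _ ih =>
    simp only [Prog.regs, List.mem_append, not_or] at hr
    exact ih hr.2
  | loop_true _ _ _ _ _ _ _ _ _ _ ih1 ih2 => rw [ih2 hr, ih1 hr]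
  | loop_false => rfl
  | store => rfl
  | _ => simp_all [Prog.regs]

theorem Exec.arr_eq {c : Prog} {s s' : Store} {t : ℕ} (h : Exec c s t s') {a : ℕ}
    (ha : a ∉ c.arrs) : s'.arr a = s.arr a := by
  induction h with
  | seq _ _ _ _ _ _ _ _ _ ih1 ih2 =>
    simp only [Prog.arrs, List.mem_append, not_or] at ha
    rw [ih2 ha.2, ih1 ha.1]
  | ite_true _ _ _ _ _ _ _ _ ih =>
    simp only [Prog.arrs, List.mem_append, not_or] at ha
    exact ih ha.1
  | ite_false _ _ _ _ _ _ _ _ ih =>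
    simp only [Prog.arrs, List.mem_append, not_or] at ha
    exact ih ha.2
  | loop_true _ _ _ _ _ _ _ _ _ _ ih1 ih2 => rw [ih2 ha, ih1 ha]
  | store b i j d s =>
    simp only [Prog.arrs, List.mem_singleton] at ha
    ext k l
    simp [ha]
  | _ => rfl

/-- The memory state with the contents of the array `a` replaced. -/
def Store.replaceArr (s : Store) (a : ℕ) (g : ℕ → ℕ → ℕ) : Store :=
  ⟨s.reg, Function.update s.arr a g⟩

/-- An array that is not accessed by a program does not influence its run. -/
theorem Exec.replaceArr {c : Prog} {s s' : Store} {t : ℕ} (h : Exec c s t s') {a : ℕ}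
    (g : ℕ → ℕ → ℕ) (h1 : a ∉ c.arrs) (h2 : a ∉ c.reads) :
    Exec c (s.replaceArr a g) t (s'.replaceArr a g) := by
  have hb : ∀ (b : Test) (s : Store), b.holds (s.replaceArr a g) ↔ b.holds s := by
    rintro (⟨i, j⟩ | ⟨i, j⟩) s <;> rfl
  induction h with
  | setConst d k s => exact .setConst d k _
  | copy d i s => exact .copy d i _
  | incr d s => exact .incr d _
  | decr d s => exact .decr d _
  | load d b i j s =>
    have := Exec.load d b i j (s.replaceArr a g)
    simp only [Prog.reads, List.mem_singleton] at h2
    simpa [Store.replaceArr, Store.setReg, Function.update_of_ne (Ne.symm h2)] using this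
  | store b i j d s =>
    have := Exec.store b i j d (s.replaceArr a g)
    simp only [Prog.arrs, List.mem_singleton] at h1
    have he : (s.setArr b (s.reg i) (s.reg j) (s.reg d)).replaceArr a g =
        (s.replaceArr a g).setArr b (s.reg i) (s.reg j) (s.reg d) := by
      simp only [Store.replaceArr, Store.setArr, Function.update_of_ne (Ne.symm h1),
        Store.mk.injEq, true_and]
      exact (Function.update_comm h1 _ _ _).symm
    rw [he]
    exact this
  | seq _ _ _ _ _ _ _ _ _ ih1 ih2 =>
    simp only [Prog.arrs, Prog.reads, List.mem_append, not_or] at h1 h2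
    exact .seq _ _ _ _ _ _ _ (ih1 h1.1 h2.1) (ih2 h1.2 h2.2)
  | ite_true _ _ _ _ _ _ h _ ih =>
    simp only [Prog.arrs, Prog.reads, List.mem_append, not_or] at h1 h2
    exact .ite_true _ _ _ _ _ _ ((hb _ _).2 h) (ih h1.1 h2.1)
  | ite_false _ _ _ _ _ _ h _ ih =>
    simp only [Prog.arrs, Prog.reads, List.mem_append, not_or] at h1 h2
    exact .ite_false _ _ _ _ _ _ (fun h' => h ((hb _ _).1 h')) (ih h1.2 h2.2)
  | loop_true _ _ _ _ _ _ _ h _ _ ih1 ih2 =>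
    exact .loop_true _ _ _ _ _ _ _ ((hb _ _).2 h) (ih1 h1 h2) (ih2 h1 h2)
  | loop_false _ _ _ h => exact .loop_false _ _ _ fun h' => h ((hb _ _).1 h')

/-- The program without effect. -/
def Prog.skip : Prog := .copy 2 2

/-- The loop `for i = 0, …, n - 1`, where register `0` holds `n`. -/
def Prog.forTo (i : ℕ) (c : Prog) : Prog :=
  .seq (.setConst i 0) (.loop (.lt i 0) (.seq c (.incr i)))

theorem halts_skip {s : Store} {R : ℕ → Store → Prop} :
    Halts .skip s R ↔ R 1 (s.setReg 2 (s.reg 2)) := halts_copy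

/-- The rule for `for`-loops: the invariant `I` sees the counter and the time elapsed in the body. -/
theorem halts_forTo {i : ℕ} {c : Prog} {s : Store} {n B : ℕ} (I : ℕ → ℕ → Store → Prop)
    (hn : s.reg 0 = n) (hi : i ≠ 0) (hic : i ∉ c.regs) (h0c : 0 ∉ c.regs)
    (hI : ∀ k τ s x, I k τ s → I k τ (s.setReg i x)) (hB : ∀ k τ s, I k τ s → τ ≤ B)
    (hc : ∀ k τ s, k < n → s.reg 0 = n → s.reg i = k → I k τ s →
      Halts c s fun t s' => I (k + 1) (τ + t) s')
    (h0 : I 0 0 s) :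
    Halts (.forTo i c) s fun t s' => ∃ τ, I n τ s' ∧ t = τ + 2 * n + 2 := by
  rw [Prog.forTo, halts_seq, halts_setConst]
  refine (halts_loop (B := B + 2 * n) (fun τ s => s.reg 0 = n ∧ ∃ k τ', k ≤ n ∧ s.reg i = k ∧
    I k τ' s ∧ τ = τ' + 2 * k) ?_ ?_ ?_).mono ?_
  · rintro τ s ⟨-, k, τ', hk, -, hI', rfl⟩
    have := hB _ _ _ hI'
    omega
  · rintro τ s ⟨hs, k, τ', hk, hik, hI', rfl⟩ hlt
    rw [holds_lt, hs, hik] at hlt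
    rw [halts_seq]
    refine (hc k τ' s hlt hs hik hI').mono fun t s' he hI'' => ?_
    rw [halts_incr]
    refine ⟨?_, k + 1, τ' + t, hlt, ?_, hI _ _ _ _ hI'', by ring⟩
    · rw [setReg_reg, if_neg hi.symm, he.reg_eq h0c, hs]
    · rw [setReg_reg, if_pos rfl, he.reg_eq hic, hik]
  · exact ⟨by rw [setReg_reg, if_neg hi.symm, hn], 0, 0, by omega, by simp, hI _ _ _ _ h0, rfl⟩
  · rintro t s' - ⟨τ, ⟨hs, k, τ', hk, hik, hI', rfl⟩, hnot, rfl⟩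
    rw [holds_lt, hs, hik] at hnot
    obtain rfl : k = n := by omega
    exact ⟨τ', hI', by ring⟩

/-! ### Matchings in arrays -/

section Arrays

variable {n K : ℕ} {adj : ℕ → ℕ → Prop} {mate own price : ℕ → ℕ}

/-- The arrays `mate` and `own` hold a matching, seen from `V⁺` and from `V⁻`; partners are stored
increased by one, and `0` marks the unmatched nodes. -/
structure Mat (n : ℕ) (adj : ℕ → ℕ → Prop) (mate own : ℕ → ℕ) : Prop where
  mate_own : ∀ u v, u < n → mate u = v + 1 → v < n ∧ adj u v ∧ own v = u + 1
  own_mate : ∀ v u, v < n → own v = u + 1 → u < n ∧ mate u = v + 1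

/-- The array `mate` after `u` and `v` have been matched and their former partners released. -/
def mateAssign (mate own : ℕ → ℕ) (u v x : ℕ) : ℕ :=
  if x = u then v + 1 else if own v = x + 1 then 0 else mate x

/-- The array `own` after `u` and `v` have been matched and their former partners released. -/
def ownAssign (mate own : ℕ → ℕ) (u v y : ℕ) : ℕ :=
  if y = v then u + 1 else if mate u = y + 1 then 0 else own y

theorem Mat.assign (h : Mat n adj mate own) {u v : ℕ} (hu : u < n) (hv : v < n) (huv : adj u v) :
    Mat n adj (mateAssign mate own u v) (ownAssign mate own u v) := by
  obtain ⟨h1, h2⟩ := h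
  constructor
  · intro x y hx hxy
    simp only [mateAssign, ownAssign] at *
    have := h1 x y hx
    have := h1 u y hu
    have := h2 v x hv
    grind
  · intro y x hy hyx
    simp only [mateAssign, ownAssign] at *
    have := h2 y x hy
    have := h2 v x hv
    have := h1 u y hu
    have := h1 x v
    grind

/-- The number of matched nodes of `V⁺`. -/
def matched (n : ℕ) (mate : ℕ → ℕ) : Finset ℕ := (Finset.range n).filter fun u => mate u ≠ 0

theorem mem_matched {u : ℕ} : u ∈ matched n mate ↔ u < n ∧ mate u ≠ 0 := by simp [matched]

/-- For the duality argument: it turns the sum of the prices of the sold objects into a sum over the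
bidders who hold them. -/
theorem Mat.sum_matched (h : Mat n adj mate own) (g : ℕ → ℕ) :
    ∑ v ∈ matched n own, g v = ∑ u ∈ matched n mate, g (mate u - 1) := by
  have h1 : ∀ v ∈ matched n own, own v - 1 ∈ matched n mate ∧ mate (own v - 1) = v + 1 := by
    intro v hv
    obtain ⟨hv1, hv2⟩ := mem_matched.1 hv
    obtain ⟨u, hu⟩ := Nat.exists_eq_succ_of_ne_zero hv2
    obtain ⟨h1, h2⟩ := h.own_mate v u hv1 hu
    simp [mem_matched, hu, h1, h2]
  have h2 : ∀ u ∈ matched n mate, mate u - 1 ∈ matched n own ∧ own (mate u - 1) = u + 1 := by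
    intro u hu
    obtain ⟨hu1, hu2⟩ := mem_matched.1 hu
    obtain ⟨v, hv⟩ := Nat.exists_eq_succ_of_ne_zero hu2
    obtain ⟨h1, -, h2⟩ := h.mate_own u v hu1 hv
    simp [mem_matched, hv, h1, h2]
  refine Finset.sum_nbij' (fun v => own v - 1) (fun u => mate u - 1) (fun v hv => (h1 v hv).1)
    (fun u hu => (h2 u hu).1) (fun v hv => ?_) (fun u hu => ?_) fun v hv => ?_
  · simp [(h1 v hv).2]
  · simp [(h2 u hu).2]
  · simp [(h1 v hv).2]

theorem Mat.card_matched (h : Mat n adj mate own) :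
    (matched n own).card = (matched n mate).card := by
  simpa using h.sum_matched fun _ => 1

theorem Mat.mate_inj (h : Mat n adj mate own) {u u' : ℕ} (hu : u < n) (hu' : u' < n)
    (h0 : mate u ≠ 0) (he : mate u = mate u') : u = u' := by
  obtain ⟨v, hv⟩ := Nat.exists_eq_succ_of_ne_zero h0
  have h1 := (h.mate_own u v hu hv).2.2
  have h2 := (h.mate_own u' v hu' (he ▸ hv)).2.2
  omega

/-! ### The auction -/

/-- The invariant of the auction: prices are at most `K`, unsold objects are free of charge, and
every bidder holds an object that is within one unit of the cheapest. -/
structure Auction (n K : ℕ) (adj : ℕ → ℕ → Prop) (mate own price : ℕ → ℕ) : Prop where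
  mat : Mat n adj mate own
  price_le : ∀ v < n, price v ≤ K
  unsold : ∀ v < n, own v = 0 → price v = 0
  content : ∀ u v v', u < n → mate u = v + 1 → v' < n → adj u v' → price v ≤ price v' + 1

/-- The raised price of v exceeds the cheapest neighbour of u by at most the one unit that `content`
tolerates. For the other bidders only prices of objects they do not hold have risen, and a former
owner of v now holds nothing. -/
theorem Auction.bid (h : Auction n K adj mate own price) {u v : ℕ} (hu : u < n) (hv : v < n)
    (huv : adj u v) (hmu : mate u = 0) (hlt : price v < K)
    (hmin : ∀ v' < n, adj u v' → price v ≤ price v') :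
    Auction n K adj (mateAssign mate own u v) (ownAssign mate own u v)
      (Function.update price v (price v + 1)) := by
  refine ⟨h.mat.assign hu hv huv, fun y hy => ?_, fun y hy hy' => ?_, fun x y y' hx hxy hy' hadj => ?_⟩
  · have := h.price_le y hy
    rw [Function.update_apply]
    split_ifs <;> omega
  · have := h.unsold y hy
    simp only [ownAssign, hmu] at hy'
    rw [Function.update_apply]
    grind
  · simp only [mateAssign] at hxy
    rw [Function.update_apply, Function.update_apply]
    have h1 := h.content x y y' hx
    have h2 := hmin y' hy'
    have h3 := h.mat.mate_own x v hx
    split_ifs at hxy with h4 h5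
    · obtain rfl : y = v := by omega
      subst h4
      have := h2 hadj
      split_ifs <;> omega
    · have h6 := h1 hxy hy' hadj
      have : y ≠ v := by
        rintro rfl
        exact h5 (h3 hxy).2.2
      rw [if_neg this]
      split_ifs with h7
      · subst h7; omega
      · exact h6

theorem sum_sub_price_bid {v : ℕ} (hv : v < n) (hlt : price v < K) :
    ∑ y ∈ Finset.range n, (K - Function.update price v (price v + 1) y) + 1 =
      ∑ y ∈ Finset.range n, (K - price y) := by
  have hv' := Finset.mem_range.2 hv
  rw [← Finset.add_sum_erase _ _ hv', ← Finset.add_sum_erase (Finset.range n) (fun y => K - price y) hv']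
  have : ∑ y ∈ (Finset.range n).erase v, (K - Function.update price v (price v + 1) y) =
      ∑ y ∈ (Finset.range n).erase v, (K - price y) :=
    Finset.sum_congr rfl fun y hy => by
      rw [Function.update_of_ne (Finset.ne_of_mem_erase hy)]
  rw [this, Function.update_self]
  omega

/-- The size of the matching found by an auction that has ended is nearly maximum. -/
theorem Auction.card_le {E : Fin n → Fin n → Prop} (h : Auction n K adj mate own price)
    (hadj : ∀ u v : Fin n, E u v → adj u v)
    (hend : ∀ u < n, mate u = 0 → ∀ v < n, adj u v → K ≤ price v)
    {M : Finset (Fin n × Fin n)} (hM : IsMatching E M) :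
    K * M.card ≤ K * (matched n mate).card + n := by
  have hsum : ∀ (f : Fin n × Fin n → Fin n), Set.InjOn f M → ∀ g : ℕ → ℕ,
      ∑ e ∈ M, g (f e) ≤ ∑ x ∈ Finset.range n, g x := by
    intro f hf g
    rw [← Finset.sum_image (f := fun x : ℕ => g x) (g := fun e => ((f e : Fin n) : ℕ))
      (fun a ha b hb hab => hf ha hb (Fin.ext hab))]
    refine Finset.sum_le_sum_of_subset fun x hx => ?_
    obtain ⟨e, -, rfl⟩ := Finset.mem_image.1 hx
    simp
  -- Prices and the profits `g` form a nearly feasible dual solution: price v + g u ≥ K − 1 on every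
  -- link. Their total is K times the number of matched nodes, because unsold objects are free.
  let g : ℕ → ℕ := fun u => if mate u = 0 then 0 else K - price (mate u - 1)
  have h1 : ∑ e ∈ M, price e.2 ≤ ∑ v ∈ Finset.range n, price v :=
    hsum Prod.snd (fun e he e' he' hee => hM.2 e he e' he' (Or.inr hee)) price
  have h2 : ∑ e ∈ M, g e.1 ≤ ∑ u ∈ Finset.range n, g u :=
    hsum Prod.fst (fun e he e' he' hee => hM.2 e he e' he' (Or.inl hee)) g
  have h3 : ∑ v ∈ Finset.range n, price v = ∑ u ∈ matched n mate, price (mate u - 1) := by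
    rw [← h.mat.sum_matched, matched, Finset.sum_filter]
    refine Finset.sum_congr rfl fun v hv => ?_
    split_ifs with h0
    · rfl
    · exact h.unsold v (Finset.mem_range.1 hv) (not_not.1 h0)
  have h4 : ∑ u ∈ Finset.range n, g u = ∑ u ∈ matched n mate, (K - price (mate u - 1)) := by
    rw [matched, Finset.sum_filter]
    refine Finset.sum_congr rfl fun v hv => ?_
    by_cases h0 : mate v = 0 <;> simp [g, h0]
  have h5 : ∑ u ∈ matched n mate, price (mate u - 1) +
      ∑ u ∈ matched n mate, (K - price (mate u - 1)) = K * (matched n mate).card := by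
    rw [← Finset.sum_add_distrib, Finset.sum_congr rfl (g := fun _ => K), Finset.sum_const,
      smul_eq_mul, mul_comm]
    intro u hu
    obtain ⟨hu1, hu2⟩ := mem_matched.1 hu
    obtain ⟨v, hv⟩ := Nat.exists_eq_succ_of_ne_zero hu2
    have := h.price_le v (h.mat.mate_own u v hu1 hv).1
    rw [hv, Nat.succ_sub_one]
    omega
  have h6 : K * M.card ≤ ∑ e ∈ M, price e.2 + ∑ e ∈ M, g e.1 + M.card := by
    rw [← Finset.sum_add_distrib, mul_comm, ← smul_eq_mul, ← Finset.sum_const, Finset.card_eq_sum_ones,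
      ← Finset.sum_add_distrib]
    refine Finset.sum_le_sum fun e he => ?_
    have hE := hadj e.1 e.2 (hM.1 e he)
    by_cases h0 : mate e.1 = 0
    · have := hend e.1 e.1.2 h0 e.2 e.2.2 hE
      simp only [g, if_pos h0]
      omega
    · obtain ⟨v, hv⟩ := Nat.exists_eq_succ_of_ne_zero h0
      have := h.content e.1 v e.2 e.1.2 hv e.2.2 hE
      simp only [g, if_neg h0, hv, Nat.succ_sub_one]
      omega
  have h7 := card_le_of_isMatching hM
  omega

/-! ### The search for an augmenting path -/

/-- The invariant of the search: `par` holds for the reached nodes of `V⁻` their predecessors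
(increased by one), the queue `q` with `tail` entries the reached nodes of `V⁺`, of which the
first `head` have been processed, and `fin` an unmatched reached node of `V⁻`. -/
structure Search (n : ℕ) (adj : ℕ → ℕ → Prop) (mate own par q : ℕ → ℕ) (head tail fin : ℕ)
    (rk : ℕ → ℕ) : Prop where
  head_le : head ≤ tail
  queue_lt : ∀ k < tail, q k < n
  queue_reached : ∀ k < tail, mate (q k) = 0 ∨ ∃ w, mate (q k) = w + 1 ∧ par w ≠ 0
  roots : ∀ u < n, mate u = 0 → ∃ k < tail, q k = u
  par_adj : ∀ v < n, ∀ u, par v = u + 1 → u < n ∧ adj u v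
  reached : ∀ v < n, par v ≠ 0 → ∀ u, own v = u + 1 → ∃ k < tail, q k = u
  free : ∀ v < n, par v ≠ 0 → own v = 0 → fin ≠ 0
  fin_free : ∀ v, fin = v + 1 → v < n ∧ par v ≠ 0 ∧ own v = 0
  count : tail + ((Finset.range n).filter fun v => own v ≠ 0 ∧ par v = 0).card = n
  processed : ∀ k < head, ∀ v < n, adj (q k) v → par v ≠ 0
  rank_lt : ∀ v < n, par v ≠ 0 → rk v < (matched n par).card
  rank : ∀ v < n, ∀ u, par v = u + 1 → ∀ w, mate u = w + 1 → par w ≠ 0 ∧ rk w < rk v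

theorem matched_update {par : ℕ → ℕ} {v x : ℕ} (hv : v < n) (h0 : par v = 0) :
    (matched n (Function.update par v (x + 1))).card = (matched n par).card + 1 := by
  have : matched n (Function.update par v (x + 1)) = insert v (matched n par) := by
    ext y
    rw [mem_matched, Finset.mem_insert, mem_matched, Function.update_apply]
    split_ifs with h
    · subst h; simp [hv]
    · simp [h]
  rw [this, Finset.card_insert_of_notMem (by simp [mem_matched, h0])]

variable {par q : ℕ → ℕ} {head tail fin : ℕ} {rk : ℕ → ℕ}

/-- The rank of the new node is the number of nodes of V⁻ reached before it, so ranks drop towards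
the roots. An unmatched v becomes `fin`. A matched v sends its partner to the queue, and `count`
stays balanced because v is no longer an unreached matched node. -/
theorem Search.discover (hM : Mat n adj mate own)
    (h : Search n adj mate own par q head tail fin rk) {u v : ℕ} (hu : u < n) (hv : v < n)
    (huv : adj u v) (hpar : par v = 0) (hmu : mate u = 0 ∨ ∃ w, mate u = w + 1 ∧ par w ≠ 0) :
    ∃ rk', (own v = 0 → Search n adj mate own (Function.update par v (u + 1)) q head tail (v + 1) rk') ∧
      ∀ x, own v = x + 1 → Search n adj mate own (Function.update par v (u + 1))
        (Function.update q tail x) head (tail + 1) fin rk' := by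
  have hne : ∀ w, par w ≠ 0 → w ≠ v := fun w hw hwv => hw (hwv ▸ hpar)
  have hpar' : ∀ w, par w ≠ 0 → Function.update par v (u + 1) w ≠ 0 := fun w hw => by
    rwa [Function.update_of_ne (hne w hw)]
  have hrank_lt : ∀ y < n, Function.update par v (u + 1) y ≠ 0 →
      Function.update rk v (matched n par).card y <
        (matched n (Function.update par v (u + 1))).card := by
    intro y hy hpy
    rw [matched_update hv hpar]
    by_cases hyv : y = v
    · subst hyv; simp
    · rw [Function.update_of_ne hyv] at hpy ⊢
      have := h.rank_lt y hy hpy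
      omega
  have hrank : ∀ y < n, ∀ x, Function.update par v (u + 1) y = x + 1 → ∀ w, mate x = w + 1 →
      Function.update par v (u + 1) w ≠ 0 ∧
        Function.update rk v (matched n par).card w < Function.update rk v (matched n par).card y := by
    intro y hy x hyx w hxw
    by_cases hyv : y = v
    · subst hyv
      rw [Function.update_self] at hyx ⊢
      obtain rfl : u = x := by omega
      rcases hmu with h0 | ⟨w', hw', hpw⟩
      · omega
      · obtain rfl : w' = w := by omega
        refine ⟨hpar' _ hpw, ?_⟩
        rw [Function.update_of_ne (hne _ hpw)]
        exact h.rank_lt w' (hM.mate_own u w' hu hw').1 hpw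
    · rw [Function.update_of_ne hyv] at hyx ⊢
      obtain ⟨h1, h2⟩ := h.rank y hy x hyx w hxw
      rw [Function.update_of_ne (hne _ h1), Function.update_of_ne (hne _ h1)]
      exact ⟨h1, h2⟩
  have hadj : ∀ y < n, ∀ x, Function.update par v (u + 1) y = x + 1 → x < n ∧ adj x y := by
    intro y hy x hyx
    by_cases hyv : y = v
    · subst hyv
      rw [Function.update_self] at hyx
      obtain rfl : u = x := by omega
      exact ⟨hu, huv⟩
    · rw [Function.update_of_ne hyv] at hyx
      exact h.par_adj y hy x hyx
  have hqr : ∀ x, (mate x = 0 ∨ ∃ w, mate x = w + 1 ∧ par w ≠ 0) →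
      mate x = 0 ∨ ∃ w, mate x = w + 1 ∧ Function.update par v (u + 1) w ≠ 0 := fun x hx =>
    hx.imp_right fun ⟨w, h1, h2⟩ => ⟨w, h1, hpar' w h2⟩
  refine ⟨Function.update rk v (matched n par).card, fun h0 => ?_, fun x hx => ?_⟩
  · refine ⟨h.head_le, h.queue_lt, fun k hk => hqr _ (h.queue_reached k hk), h.roots, hadj, ?_, ?_, ?_, ?_,
      fun k hk y hy hky => hpar' _ (h.processed k hk y hy hky), hrank_lt, hrank⟩
    · intro y hy hpy x hyx
      have hyv : y ≠ v := by rintro rfl; omega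
      rw [Function.update_of_ne hyv] at hpy
      exact h.reached y hy hpy x hyx
    · intro _ _ _ _
      exact Nat.succ_ne_zero v
    · intro y hy
      obtain rfl : v = y := by omega
      exact ⟨hv, by simp, h0⟩
    · rw [Finset.filter_congr (q := fun y => own y ≠ 0 ∧ par y = 0), h.count]
      intro y _
      by_cases hyv : y = v
      · subst hyv; simp [h0]
      · rw [Function.update_of_ne hyv]
  · have hq : ∀ k < tail, Function.update q tail x k = q k := fun k hk =>
      Function.update_of_ne hk.ne _ _
    have hex : ∀ z, (∃ k < tail, q k = z) → ∃ k < tail + 1, Function.update q tail x k = z := by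
      rintro z ⟨k, hk, rfl⟩
      exact ⟨k, by omega, hq k hk⟩
    obtain ⟨hxn, hxv⟩ := hM.own_mate v x hv hx
    refine ⟨h.head_le.trans (Nat.le_succ _), ?_, ?_, fun y hy h0 => hex _ (h.roots y hy h0), hadj, ?_, ?_, ?_, ?_, ?_, hrank_lt,
      hrank⟩
    · intro k hk
      rcases Nat.lt_succ_iff_lt_or_eq.1 hk with hk | rfl
      · rw [hq k hk]; exact h.queue_lt k hk
      · rwa [Function.update_self]
    · intro k hk
      rcases Nat.lt_succ_iff_lt_or_eq.1 hk with hk | rfl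
      · rw [hq k hk]; exact hqr _ (h.queue_reached k hk)
      · rw [Function.update_self]
        exact Or.inr ⟨v, hxv, by simp⟩
    · intro y hy hpy z hyz
      by_cases hyv : y = v
      · subst hyv
        obtain rfl : x = z := by omega
        exact ⟨tail, by omega, Function.update_self _ _ _⟩
      · rw [Function.update_of_ne hyv] at hpy
        exact hex _ (h.reached y hy hpy z hyz)
    · intro y hy hpy h0
      have hyv : y ≠ v := by rintro rfl; omega
      rw [Function.update_of_ne hyv] at hpy
      exact h.free y hy hpy h0
    · intro y hy
      obtain ⟨h1, h2, h3⟩ := h.fin_free y hy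
      exact ⟨h1, hpar' _ h2, h3⟩
    · have : (Finset.range n).filter (fun y => own y ≠ 0 ∧ par y = 0) =
          insert v ((Finset.range n).filter fun y => own y ≠ 0 ∧
            Function.update par v (u + 1) y = 0) := by
        ext y
        simp only [Finset.mem_filter, Finset.mem_insert, Finset.mem_range]
        by_cases hyv : y = v
        · subst hyv; simp [hv, hx, hpar]
        · rw [Function.update_of_ne hyv]; simp [hyv]
      have hc := h.count
      rw [this, Finset.card_insert_of_notMem (by simp)] at hc
      omega
    · intro k hk y hy hky
      rw [hq k (hk.trans_le h.head_le)] at hky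
      exact hpar' _ (h.processed k hk y hy hky)

end Arrays

/-! ### Exchange along the predecessors, in the arrays -/

section Flip

variable {n : ℕ} {adj : ℕ → ℕ → Prop} {mate own par q rk : ℕ → ℕ} {head tail fin : ℕ}

/-- The invariant of the augmentation along the predecessors `par`: the unmatched node `v` of `V⁻`
remains to be matched, and the ranks decrease along the rest of the path. -/
structure Flip (n : ℕ) (adj : ℕ → ℕ → Prop) (par rk mate own : ℕ → ℕ) (v : ℕ) : Prop where
  mat : Mat n adj mate own
  lt : v < n
  reached : par v ≠ 0
  free : own v = 0
  par_adj : ∀ v < n, ∀ u, par v = u + 1 → u < n ∧ adj u v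
  rank : ∀ w < n, ∀ u, par w = u + 1 → rk w ≤ rk v → ∀ x, mate u = x + 1 →
    par x ≠ 0 ∧ rk x < rk w

theorem Search.flip (hM : Mat n adj mate own) (h : Search n adj mate own par q head tail fin rk)
    {v : ℕ} (hv : fin = v + 1) : Flip n adj par rk mate own v := by
  obtain ⟨h1, h2, h3⟩ := h.fin_free v hv
  exact ⟨hM, h1, h2, h3, h.par_adj, fun w hw u hwu _ x hx => h.rank w hw u hwu x hx⟩

theorem matched_mateAssign_of_eq_zero {u v : ℕ} (hu : u < n) (hv : own v = 0)
    (h0 : mate u = 0) :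
    (matched n (mateAssign mate own u v)).card = (matched n mate).card + 1 := by
  have : mateAssign mate own u v = Function.update mate u (v + 1) := by
    ext x
    simp [mateAssign, Function.update_apply, hv]
  rw [this, matched_update hu h0]

theorem matched_mateAssign_of_ne_zero {u v : ℕ} (hv : own v = 0) (h0 : mate u ≠ 0) :
    (matched n (mateAssign mate own u v)).card = (matched n mate).card := by
  congr 1
  ext x
  by_cases hx : x = u
  · subst hx; simp [mem_matched, mateAssign, h0]
  · simp [mem_matched, mateAssign, hx, hv]

/-- Matching u with v frees the former partner x of u, and x continues the path. The partner of u is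
now the larger-ranked v, but a node with predecessor u has rank above rk x. So the rank condition
survives only up to the rank of the current node, which is why `Flip` asks for no more. -/
theorem Flip.step {v u x : ℕ} (h : Flip n adj par rk mate own v) (hu : par v = u + 1)
    (hx : mate u = x + 1) :
    Flip n adj par rk (mateAssign mate own u v) (ownAssign mate own u v) x ∧ rk x < rk v := by
  obtain ⟨hun, huv⟩ := h.par_adj v h.lt u hu
  obtain ⟨hxp, hxr⟩ := h.rank v h.lt u hu le_rfl x hx
  obtain ⟨hxn, -, hox⟩ := h.mat.mate_own u x hun hx
  have hxv : x ≠ v := by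
    rintro rfl
    have := h.free
    omega
  refine ⟨⟨h.mat.assign hun h.lt huv, hxn, hxp, ?_, h.par_adj, ?_⟩, hxr⟩
  · simp [ownAssign, hxv, hx]
  · intro w hw z hwz hrw y hy
    by_cases hzu : z = u
    · subst hzu
      have := h.rank w hw z hwz (by omega) x hx
      omega
    · have hy' : mate z = y + 1 := by
        simpa [mateAssign, hzu, h.free] using hy
      exact h.rank w hw z hwz (by omega) y hy'

end Flip

/-! ### Matchings in arrays and matchings of `Γ_A` -/

section Convert

variable {n : ℕ} {E : Fin n → Fin n → Prop} {adj : ℕ → ℕ → Prop} {mate own par q rk : ℕ → ℕ}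
  {head tail fin : ℕ}

/-- The matching stored in the array `mate`. -/
def toMatching (n : ℕ) (mate : ℕ → ℕ) : Finset (Fin n × Fin n) :=
  Finset.univ.filter fun e => mate e.1 = e.2 + 1

theorem mem_toMatching {u v : Fin n} : (u, v) ∈ toMatching n mate ↔ mate u = v + 1 := by
  simp [toMatching]

theorem Mat.isMatching (h : Mat n adj mate own) (hadj : ∀ u v : Fin n, adj u v ↔ E u v) :
    IsMatching E (toMatching n mate) := by
  refine ⟨fun ⟨u, v⟩ he => ?_, fun ⟨u, v⟩ he ⟨u', v'⟩ he' hee => ?_⟩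
  · exact (hadj u v).1 (h.mate_own u v u.2 (mem_toMatching.1 he)).2.1
  · rw [mem_toMatching] at he he'
    simp only [Prod.mk.injEq, Fin.ext_iff] at hee ⊢
    rcases hee with hee | hee
    · rw [hee] at he
      omega
    · have := h.mate_inj u.2 u'.2 (by omega) (by omega)
      omega

theorem Mat.mem_unmatched_iff (h : Mat n adj mate own) {u : Fin n} :
    u ∈ unmatched (toMatching n mate) ↔ mate u = 0 := by
  rw [mem_unmatched]
  constructor
  · intro hu
    by_contra h0
    obtain ⟨v, hv⟩ := Nat.exists_eq_succ_of_ne_zero h0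
    exact hu ⟨v, (h.mate_own u v u.2 hv).1⟩ (mem_toMatching.2 hv)
  · intro h0 v hv
    rw [mem_toMatching] at hv
    omega

theorem Mat.card_toMatching (h : Mat n adj mate own) :
    (toMatching n mate).card = (matched n mate).card := by
  refine Finset.card_bij (fun e _ => (e.1 : ℕ)) ?_ ?_ ?_
  · rintro ⟨u, v⟩ he
    rw [mem_toMatching] at he
    exact mem_matched.2 ⟨u.2, by simp [he]⟩
  · rintro ⟨u, v⟩ he ⟨u', v'⟩ he' hee
    rw [mem_toMatching] at he he'
    simp only [Prod.mk.injEq, Fin.ext_iff] at hee ⊢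
    rw [hee] at he
    omega
  · intro u hu
    obtain ⟨hu1, hu2⟩ := mem_matched.1 hu
    obtain ⟨v, hv⟩ := Nat.exists_eq_succ_of_ne_zero hu2
    exact ⟨(⟨u, hu1⟩, ⟨v, (h.mate_own u v hu1 hv).1⟩), mem_toMatching.2 hv, rfl⟩

theorem chain_invariant {α : Type*} {r : α → α → Prop} {P : α → Prop}
    (hP : ∀ x y, r x y → P x → P y) {p : List α} (hc : p.IsChain r) {a b : α}
    (ha : p.head? = some a) (hb : p.getLast? = some b) (hPa : P a) : P b := by
  induction p generalizing a with
  | nil => simp at ha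
  | cons x p ih =>
    obtain rfl : x = a := by simpa using ha
    cases p with
    | nil =>
      obtain rfl : x = b := by simpa using hb
      exact hPa
    | cons y p =>
      rw [List.isChain_cons_cons] at hc
      exact ih hc.2 rfl (by simpa [List.getLast?_cons_cons] using hb) (hP _ _ hc.1 hPa)

/-- An unsuccessful complete search proves that there is no augmenting path. -/
theorem Search.not_augmenting (hM : Mat n adj mate own)
    (h : Search n adj mate own par q tail tail 0 rk) (hadj : ∀ u v : Fin n, adj u v ↔ E u v) :
    ¬ ∃ p, IsAugmentingPath E (toMatching n mate) p := by
  rintro ⟨p, -, hc, ⟨i, hi, hh⟩, v, hv, hl⟩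
  -- The reached nodes are closed under links of the auxiliary graph. So an augmenting path would
  -- end in a reached unmatched node, for which `free` requires a nonzero `fin`.
  have hvP := chain_invariant (P := fun x : Fin n ⊕ Fin n =>
    match x with
    | .inl u => ∃ k < tail, q k = u
    | .inr v => par v ≠ 0) (by
      rintro _ _ (⟨u, v, huv, -⟩ | ⟨u, v, huv⟩) hx
      · obtain ⟨k, hk, hku⟩ := hx
        exact h.processed k hk v v.2 (by rw [hku]; exact (hadj u v).2 huv)
      · exact h.reached v v.2 hx u (hM.mate_own u v u.2 (mem_toMatching.1 huv)).2.2)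
    hc hh hl (h.roots i i.2 (hM.mem_unmatched_iff.1 hi))
  refine h.free v v.2 hvP ?_ rfl
  by_contra h0
  obtain ⟨u, hu⟩ := Nat.exists_eq_succ_of_ne_zero h0
  obtain ⟨hun, huv⟩ := hM.own_mate v u v.2 hu
  exact hv (Finset.mem_image.2 ⟨(⟨u, hun⟩, v), mem_toMatching.2 huv, rfl⟩)

/-- The digraph of the two-step alternating walks on `V⁺`. -/
def Hop (n : ℕ) (adj : ℕ → ℕ → Prop) (own : ℕ → ℕ) (u u' : ℕ) : Prop :=
  ∃ v < n, adj u v ∧ own v = u' + 1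

/-- Alternating paths visit V⁺ at every second node. A hop may also run along a link of the
matching, but then it returns to its own start and can be dropped. -/
theorem Mat.contraction_iff (hM : Mat n adj mate own) (hadj : ∀ u v : Fin n, adj u v ↔ E u v)
    (i j : Fin n) :
    j ∈ contraction E (toMatching n mate) i ↔ Relation.ReflTransGen (Hop n adj own) i j := by
  constructor
  · intro h
    have key : ∀ x : Fin n ⊕ Fin n,
        Relation.ReflTransGen (AuxLink E (toMatching n mate)) (.inl i) x →
        match x with
        | .inl u => Relation.ReflTransGen (Hop n adj own) i u
        | .inr v => ∃ u, Relation.ReflTransGen (Hop n adj own) i u ∧ adj u v := by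
      intro x hx
      induction hx with
      | refl => exact .refl
      | tail _ hl ih =>
        cases hl with
        | free u v huv _ => exact ⟨u, ih, (hadj u v).2 huv⟩
        | matched u v huv =>
          obtain ⟨w, hw, hwv⟩ := ih
          exact hw.tail ⟨v, v.2, hwv, (hM.mate_own u v u.2 (mem_toMatching.1 huv)).2.2⟩
    exact key _ h
  · intro h
    have key : ∀ x, Relation.ReflTransGen (Hop n adj own) i x → ∃ y : Fin n, (y : ℕ) = x ∧
        Relation.ReflTransGen (AuxLink E (toMatching n mate)) (.inl i) (.inl y) := by
      intro x hx
      induction hx with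
      | refl => exact ⟨i, rfl, .refl⟩
      | @tail b c _ hl ih =>
        obtain ⟨y, rfl, hy⟩ := ih
        obtain ⟨v, hv, hyv, hvc⟩ := hl
        obtain ⟨hcn, hcv⟩ := hM.own_mate v c hv hvc
        have hmem : ((⟨c, hcn⟩ : Fin n), (⟨v, hv⟩ : Fin n)) ∈ toMatching n mate :=
          mem_toMatching.2 hcv
        refine ⟨⟨c, hcn⟩, rfl, ?_⟩
        by_cases hm : (y, (⟨v, hv⟩ : Fin n)) ∈ toMatching n mate
        · have := (hM.mate_own y v y.2 (mem_toMatching.1 hm)).2.2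
          obtain rfl : y = ⟨c, hcn⟩ := Fin.ext (by simp; omega)
          exact hy
        · exact (hy.tail (.free y ⟨v, hv⟩ ((hadj _ _).1 hyv) hm)).tail (.matched _ _ hmem)
    obtain ⟨y, hyj, hy⟩ := key j h
    obtain rfl : y = j := Fin.ext hyj
    exact hy

/-- The contraction of `i` as a set of natural numbers. -/
noncomputable def contractionSet (n : ℕ) (adj : ℕ → ℕ → Prop) (own : ℕ → ℕ) (i : ℕ) : Finset ℕ :=
  open Classical in (Finset.range n).filter fun j => Relation.ReflTransGen (Hop n adj own) i j

theorem Mat.card_contractionSet (hM : Mat n adj mate own) (hadj : ∀ u v : Fin n, adj u v ↔ E u v)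
    (i : Fin n) :
    (contractionSet n adj own i).card = (contraction E (toMatching n mate) i).ncard := by
  classical
  rw [Set.ncard_eq_toFinset_card _ (Set.toFinite _)]
  symm
  refine Finset.card_bij (fun u _ => (u : ℕ)) ?_ (fun _ _ _ _ h => Fin.ext h) ?_
  · intro u hu
    rw [Set.Finite.mem_toFinset, hM.contraction_iff hadj] at hu
    simp [contractionSet, hu]
  · intro u hu
    simp only [contractionSet, Finset.mem_filter, Finset.mem_range] at hu
    exact ⟨⟨u, hu.1⟩, by rw [Set.Finite.mem_toFinset, hM.contraction_iff hadj]; exact hu.2, rfl⟩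

theorem Mat.mem_contractionSet (hM : Mat n adj mate own) {i u : ℕ} (hi : i < n) :
    u ∈ contractionSet n adj own i ↔ Relation.ReflTransGen (Hop n adj own) i u := by
  classical
  simp only [contractionSet, Finset.mem_filter, Finset.mem_range, and_iff_right_iff_imp]
  intro h
  rcases Relation.ReflTransGen.cases_tail h with rfl | ⟨w, -, v, hv, -, hvu⟩
  · exact hi
  · exact (hM.own_mate v u hv hvu).1

open Classical in
/-- The number of successors in the digraph of the two-step walks is bounded by the size of the
contraction. -/
theorem Mat.card_succ_le (hM : Mat n adj mate own) {i u : ℕ} (hi : i < n)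
    (hu : u ∈ contractionSet n adj own i) :
    ((Finset.range n).filter fun v => adj u v ∧ own v ≠ 0).card ≤
      (contractionSet n adj own i).card := by
  -- Each such v goes to its partner, one hop away from u and hence again in the contraction;
  -- distinct v have distinct partners.
  refine Finset.card_le_card_of_injOn (fun v => own v - 1) ?_ ?_
  · intro v hv
    simp only [Finset.coe_filter, Finset.mem_range, Set.mem_ofPred_eq] at hv
    obtain ⟨hvn, huv, h0⟩ := hv
    obtain ⟨x, hx⟩ := Nat.exists_eq_succ_of_ne_zero h0
    rw [hM.mem_contractionSet hi] at hu
    have : x ∈ contractionSet n adj own i :=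
      (hM.mem_contractionSet hi).2 (hu.tail ⟨v, hvn, huv, hx⟩)
    simpa [hx] using this
  · intro v hv v' hv' hvv
    simp only [Finset.coe_filter, Finset.mem_range, Set.mem_ofPred_eq] at hv hv'
    obtain ⟨x, hx⟩ := Nat.exists_eq_succ_of_ne_zero hv.2.2
    obtain ⟨x', hx'⟩ := Nat.exists_eq_succ_of_ne_zero hv'.2.2
    simp only [hx, hx', Nat.succ_sub_one] at hvv
    subst hvv
    have h1 := (hM.own_mate v x hv.1 hx).2
    have h2 := (hM.own_mate v' x hv'.1 hx').2
    omega

end Convert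

/-! ### The search for a contraction -/

section Reach

variable {R : ℕ → ℕ → Prop} {i : ℕ} {mark q : ℕ → ℕ} {head tail : ℕ}

/-- The invariant of the search from `i` with queue `q`, of which `head` entries out of `tail` have
been processed; `mark` is the indicator of the entries. -/
structure Reach (R : ℕ → ℕ → Prop) (i : ℕ) (mark q : ℕ → ℕ) (head tail : ℕ) : Prop where
  head_le : head ≤ tail
  root : ∃ k < tail, q k = i
  reach : ∀ k < tail, Relation.ReflTransGen R i (q k)
  inj : ∀ k < tail, ∀ l < tail, q k = q l → k = l
  mark_le : ∀ j, mark j ≤ 1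
  mark_iff : ∀ j, mark j ≠ 0 ↔ ∃ k < tail, q k = j
  processed : ∀ k < head, ∀ u, R (q k) u → ∃ l < tail, q l = u

/-- The queue holds reachable nodes without repetition. This bounds the number of rounds by the size
of the contraction rather than by n. -/
theorem Reach.tail_le (h : Reach R i mark q head tail) {C : Finset ℕ}
    (hC : ∀ u, Relation.ReflTransGen R i u → u ∈ C) : tail ≤ C.card := by
  rw [← Finset.card_range tail]
  refine Finset.card_le_card_of_injOn q (fun k hk => hC _ (h.reach k (by simpa using hk))) ?_
  intro k hk l hl hkl
  exact h.inj k (by simpa using hk) l (by simpa using hl) hkl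

theorem Reach.push (h : Reach R i mark q head tail) {j : ℕ} (hj : mark j = 0)
    (hij : Relation.ReflTransGen R i j) :
    Reach R i (Function.update mark j 1) (Function.update q tail j) head (tail + 1) := by
  have hq : ∀ k < tail, Function.update q tail j k = q k := fun k hk =>
    Function.update_of_ne hk.ne _ _
  have hex : ∀ z, (∃ k < tail, q k = z) → ∃ k < tail + 1, Function.update q tail j k = z := by
    rintro z ⟨k, hk, rfl⟩
    exact ⟨k, by omega, hq k hk⟩
  have hnew : ∀ k < tail, q k ≠ j := fun k hk hkj => (h.mark_iff j).2 ⟨k, hk, hkj⟩ hj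
  have hcases : ∀ k < tail + 1, (k < tail ∧ Function.update q tail j k = q k) ∨
      (k = tail ∧ Function.update q tail j k = j) := by
    intro k hk
    rcases Nat.lt_succ_iff_lt_or_eq.1 hk with hk | rfl
    · exact Or.inl ⟨hk, hq k hk⟩
    · exact Or.inr ⟨rfl, Function.update_self _ _ _⟩
  refine ⟨h.head_le.trans (Nat.le_succ _), hex _ h.root, fun k hk => ?_, fun k hk l hl hkl => ?_,
    fun y => ?_, fun y => ?_, fun k hk u hu => ?_⟩
  · rcases hcases k hk with ⟨h1, h2⟩ | ⟨h1, h2⟩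
    · rw [h2]; exact h.reach k h1
    · rw [h2]; exact hij
  · rcases hcases k hk with ⟨h1, h2⟩ | ⟨h1, h2⟩ <;> rcases hcases l hl with ⟨h3, h4⟩ | ⟨h3, h4⟩ <;>
      rw [h2, h4] at hkl
    · exact h.inj k h1 l h3 hkl
    · exact absurd hkl (hnew k h1)
    · exact absurd hkl.symm (hnew l h3)
    · omega
  · rw [Function.update_apply]
    split_ifs
    · exact le_rfl
    · exact h.mark_le y
  · by_cases hy : y = j
    · subst hy
      simp only [Function.update_self, ne_eq, one_ne_zero, not_false_eq_true, true_iff]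
      exact ⟨tail, by omega, Function.update_self _ _ _⟩
    · rw [Function.update_of_ne hy, h.mark_iff]
      refine ⟨hex y, ?_⟩
      rintro ⟨k, hk, hky⟩
      rcases hcases k hk with ⟨h1, h2⟩ | ⟨h1, h2⟩
      · exact ⟨k, h1, h2 ▸ hky⟩
      · exact absurd (hky.symm.trans h2) hy
  · rw [hq k (hk.trans_le h.head_le)] at hu
    exact hex u (h.processed k hk u hu)

open Classical in
theorem Reach.mark_eq (h : Reach R i mark q tail tail) (j : ℕ) :
    mark j = if Relation.ReflTransGen R i j then 1 else 0 := by
  have hiff : mark j ≠ 0 ↔ Relation.ReflTransGen R i j := by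
    rw [h.mark_iff]
    constructor
    · rintro ⟨k, hk, rfl⟩
      exact h.reach k hk
    · intro hij
      induction hij with
      | refl => exact h.root
      | tail _ hl ih =>
        obtain ⟨k, hk, rfl⟩ := ih
        exact h.processed k hk _ hl
  have := h.mark_le j
  split_ifs with hr
  · have := hiff.2 hr
    omega
  · by_contra h0
    exact hr (hiff.1 h0)

end Reach

/-! ### The threshold of the prices -/

/-- Register `3` becomes the least `K` with `K (K + 1) / 2 ≥ n`. -/
def computeThreshold : Prog :=
  .loop (.lt 4 0) (.seq (.incr 3) (.seq (.setConst 5 0)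
    (.loop (.lt 5 3) (.seq (.incr 4) (.incr 5)))))

/-- Register `4` runs through the triangular numbers K (K + 1) / 2. The lower bound on K makes the
auction leave few links missing, and minimality makes K of order √n. The crude K ≤ n already keeps
this phase within O(n²). -/
theorem halts_computeThreshold {s : Store} {n : ℕ} (h0 : s.reg 0 = n) (h3 : s.reg 3 = 0)
    (h4 : s.reg 4 = 0) : Halts computeThreshold s fun t s' => ∃ K, s'.reg 3 = K ∧
      2 * n ≤ K * (K + 1) ∧ (∀ k, K = k + 1 → k * (k + 1) < 2 * n) ∧ t ≤ n * (3 * n + 4) + 1 := by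
  refine (halts_loop (B := n * (3 * n + 4)) (fun τ s => s.reg 0 = n ∧ ∃ K, s.reg 3 = K ∧
    2 * s.reg 4 = K * (K + 1) ∧ (∀ k, K = k + 1 → k * (k + 1) < 2 * n) ∧
    K ≤ n ∧ τ ≤ K * (3 * n + 4)) ?_ ?_ ?_).mono ?_
  · rintro τ s ⟨-, K, -, -, -, hK, hτ⟩
    exact hτ.trans (Nat.mul_le_mul_right _ hK)
  · rintro τ s ⟨hs0, K, hs3, hs4, hk, hK, hτ⟩ hlt
    rw [holds_lt, hs0] at hlt
    simp only [halts_seq, halts_incr, halts_setConst]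
    refine (halts_loop (B := 3 * (K + 1)) (fun τ' s' => s'.reg 0 = n ∧ s'.reg 3 = K + 1 ∧
      s'.reg 5 ≤ K + 1 ∧ s'.reg 4 = s.reg 4 + s'.reg 5 ∧ τ' = 3 * s'.reg 5) ?_ ?_ ?_).mono ?_
    · rintro τ' s' ⟨-, -, h5, -, rfl⟩
      omega
    · rintro τ' s' ⟨h1, h2, h5, h6, rfl⟩ hlt'
      rw [holds_lt, h2] at hlt'
      simp only [halts_seq, halts_incr, setReg_reg]
      simp [h1, h2, h6]
      omega
    · simp [hs0, hs3]
    · rintro t s' - ⟨τ', ⟨h1, h2, h5, h6, rfl⟩, hnot, rfl⟩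
      rw [holds_lt, h2] at hnot
      have h7 : s'.reg 5 = K + 1 := by omega
      have h8 : K ≤ s.reg 4 := by nlinarith
      refine ⟨h1, K + 1, h2, ?_, ?_, by omega, ?_⟩
      · rw [h6, h7]; ring_nf; ring_nf at hs4; omega
      · intro k hk'
        obtain rfl : K = k := by omega
        omega
      · rw [h7, add_mul]
        omega
  · exact ⟨h0, 0, h3, by simp [h4], by omega, by omega, by omega⟩
  · rintro t s' - ⟨τ, ⟨h1, K, h2, h5, h6, h7, h8⟩, hnot, rfl⟩
    rw [holds_lt, h1] at hnot
    exact ⟨K, h2, by omega, h6, by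
      have := h8.trans (Nat.mul_le_mul_right _ h7); omega⟩

/-! ### Assigning partners -/

/-- Matches the node in register `14` with the node in register `15`; their former partners go to
the registers `17` and `16`. -/
def assignProg : Prog :=
  .seq (.load 16 4 1 15) <|
  .seq (.ite (.eq 16 1) .skip (.seq (.copy 18 16) (.seq (.decr 18) (.store 2 1 18 1)))) <|
  .seq (.load 17 2 1 14) <|
  .seq (.ite (.eq 17 1) .skip (.seq (.copy 18 17) (.seq (.decr 18) (.store 4 1 18 1)))) <|
  .seq (.copy 18 15) <| .seq (.incr 18) <| .seq (.store 2 1 14 18) <|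
  .seq (.copy 18 14) <| .seq (.incr 18) (.store 4 1 15 18)

/-- The owner of v is released before the partner of u is read. `hne` says that this owner is not u,
so the two releases do not interfere. -/
theorem halts_assignProg {s : Store} {u v : ℕ} (h1 : s.reg 1 = 0) (hu : s.reg 14 = u)
    (hv : s.reg 15 = v) (hne : s.arr 4 0 v ≠ u + 1) :
    Halts assignProg s fun t s' => t ≤ 16 ∧
      s'.arr 2 0 = mateAssign (s.arr 2 0) (s.arr 4 0) u v ∧
      s'.arr 4 0 = ownAssign (s.arr 2 0) (s.arr 4 0) u v ∧
      s'.reg 16 = s.arr 4 0 v ∧ s'.reg 17 = s.arr 2 0 u := by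
  have e1 : ∀ (f : ℕ → ℕ) (a x y : ℕ), Function.update f (a - 1) x y =
      if y = a - 1 then x else f y := fun f a x y => Function.update_apply _ _ _ _
  simp only [assignProg, halts_seq, halts_load, halts_ite, halts_skip, halts_copy, halts_decr,
    halts_store, halts_incr, holds_eq, setReg_reg, setReg_arr, setArr_reg, setArr_arr]
  simp only [Nat.reduceEqDiff, if_true, if_false, h1, hu, hv,
    and_self, and_true]
  refine ⟨fun h => ⟨fun h' => ?_, fun h' => ?_⟩, fun h => ⟨fun h' => ?_, fun h' => ?_⟩⟩
  · refine ⟨by norm_num, ?_, ?_⟩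
    · ext x; simp only [mateAssign, Function.update_apply]; grind
    · ext x; simp only [ownAssign, Function.update_apply]; grind
  · refine ⟨by norm_num, ?_, ?_⟩
    · ext x; simp only [mateAssign, Function.update_apply]; grind
    · ext x; simp only [ownAssign, Function.update_apply]; grind
  · have : u ≠ s.arr 4 0 v - 1 := by omega
    simp only [Function.update_apply, if_neg this] at h' ⊢
    refine ⟨by norm_num, ?_, ?_, trivial, trivial⟩
    · ext x; simp only [mateAssign, Function.update_apply]; grind
    · ext x; simp only [ownAssign, Function.update_apply]; grind
  · have : u ≠ s.arr 4 0 v - 1 := by omega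
    simp only [Function.update_apply, if_neg this] at h' ⊢
    refine ⟨by norm_num, ?_, ?_, trivial, trivial⟩
    · ext x; simp only [mateAssign, Function.update_apply]; grind
    · ext x; simp only [ownAssign, Function.update_apply]; grind

/-! ### The auction program -/

/-- Register `0` holds `n`, register `1` holds `0`, array `0` the adjacency matrix. -/
structure Base (n : ℕ) (A : ℕ → ℕ → ℕ) (s : Store) : Prop where
  size : s.reg 0 = n
  zero : s.reg 1 = 0
  adj : s.arr 0 = A

theorem Base.exec {n : ℕ} {A : ℕ → ℕ → ℕ} {s s' : Store} (h : Base n A s) {c : Prog} {t : ℕ}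
    (he : Exec c s t s') (h0 : 0 ∉ c.regs) (h1 : 1 ∉ c.regs) (h2 : 0 ∉ c.arrs) : Base n A s' :=
  ⟨by rw [he.reg_eq h0, h.size], by rw [he.reg_eq h1, h.zero], by rw [he.arr_eq h2, h.adj]⟩

theorem Base.setReg {n : ℕ} {A : ℕ → ℕ → ℕ} {s : Store} (h : Base n A s) {d x : ℕ} (h0 : d ≠ 0)
    (h1 : d ≠ 1) : Base n A (s.setReg d x) :=
  ⟨by rw [setReg_reg, if_neg h0.symm, h.size], by rw [setReg_reg, if_neg h1.symm, h.zero], h.adj⟩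

/-- Finds a cheapest neighbour (register `13`, price in register `12`) of the bidder in register
`7`; without neighbours cheaper than the threshold, register `12` becomes the threshold. -/
def scanProg : Prog :=
  .seq (.copy 12 3) <| .forTo 9 <| .seq (.load 10 0 7 9) <| .ite (.eq 10 1) .skip <|
    .seq (.load 11 5 1 9) <| .ite (.lt 11 12) (.seq (.copy 12 11) (.copy 13 9)) .skip

theorem halts_scanProg {n : ℕ} {A : ℕ → ℕ → ℕ} {s : Store} (hb : Base n A s) :
    Halts scanProg s fun t s' => s'.reg 12 ≤ s.reg 3 ∧
      (∀ v < n, A (s.reg 7) v ≠ 0 → s'.reg 12 ≤ s.arr 5 0 v) ∧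
      (s'.reg 12 < s.reg 3 → s'.reg 13 < n ∧ A (s.reg 7) (s'.reg 13) ≠ 0 ∧
        s.arr 5 0 (s'.reg 13) = s'.reg 12) ∧ t ≤ 8 * n + 3 := by
  rw [scanProg, halts_seq, halts_copy]
  refine (halts_forTo (n := n) (B := 6 * n) (fun k τ s' => Base n A s' ∧ s'.reg 7 = s.reg 7 ∧
    s'.arr 5 = s.arr 5 ∧ s'.reg 12 ≤ s.reg 3 ∧ (∀ v < k, A (s.reg 7) v ≠ 0 → s'.reg 12 ≤ s.arr 5 0 v) ∧
      (s'.reg 12 < s.reg 3 → s'.reg 13 < n ∧ A (s.reg 7) (s'.reg 13) ≠ 0 ∧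
        s.arr 5 0 (s'.reg 13) = s'.reg 12) ∧ τ ≤ 6 * k ∧ k ≤ n)
    (hb.setReg (by decide) (by decide)).size (by decide) (by decide) (by decide) ?_ ?_ ?_ ?_).mono ?_
  · rintro k τ s' x ⟨h1, h⟩
    exact ⟨h1.setReg (by decide) (by decide), by simpa using h⟩
  · rintro k τ s' ⟨-, -, -, -, -, -, h1, h2⟩
    omega
  · rintro k τ s' hk hs0 hs9 ⟨h1, h2, h3, h4, h5, h6, h7, h8⟩
    have hA := h1.adj
    have hz := h1.zero
    have hstep : ∀ v < k + 1, v < k ∨ v = k := fun v hv => Nat.lt_succ_iff_lt_or_eq.1 hv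
    refine Halts.mono (R := fun t s'' => s''.reg 12 ≤ s.reg 3 ∧
      (∀ v < k + 1, A (s.reg 7) v ≠ 0 → s''.reg 12 ≤ s.arr 5 0 v) ∧
      (s''.reg 12 < s.reg 3 → s''.reg 13 < n ∧ A (s.reg 7) (s''.reg 13) ≠ 0 ∧
        s.arr 5 0 (s''.reg 13) = s''.reg 12) ∧ t ≤ 6) ?_ ?_
    · simp only [halts_seq, halts_load, halts_ite, halts_skip, halts_copy, holds_eq, holds_lt,
        setReg_reg, setReg_arr]
      simp only [Nat.reduceEqDiff, if_true, if_false, hA, hz, hs9, h2, h3]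
      refine ⟨fun h => ⟨h4, fun v hv hv' => ?_, h6, by norm_num⟩, fun h => ⟨fun h' => ?_, fun h' => ?_⟩⟩
      · rcases hstep v hv with hv | rfl
        · exact h5 v hv hv'
        · exact absurd h hv'
      · refine ⟨by omega, fun v hv hv' => ?_, fun _ => ⟨hk, h, trivial⟩, by norm_num⟩
        rcases hstep v hv with hv | rfl
        · have := h5 v hv hv'; omega
        · exact le_rfl
      · refine ⟨h4, fun v hv hv' => ?_, h6, by norm_num⟩
        rcases hstep v hv with hv | rfl
        · exact h5 v hv hv'
        · omega
    · rintro t s'' he ⟨g1, g2, g3, g4⟩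
      exact ⟨h1.exec he (by decide) (by decide) (by decide),
        by rw [he.reg_eq (by decide), h2], by rw [he.arr_eq (by decide), h3], g1, g2, g3,
        by omega, hk⟩
  · exact ⟨hb.setReg (by decide) (by decide), by simp, by simp, by simp, by simp, by simp,
      by simp, by simp⟩
  · rintro t s' - ⟨τ, ⟨h1, h2, h3, h4, h5, h6, h7, h8⟩, rfl⟩
    exact ⟨h4, h5, h6, by omega⟩

/-- One bid of the bidder in register `7`; register `8` tells whether another bidder, kicked out
by this bid, has to bid next. -/
def bidProg : Prog :=
  .seq scanProg <| .ite (.lt 12 3)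
    (.seq (.copy 14 7) <| .seq (.copy 15 13) <| .seq assignProg <| .seq (.load 18 5 1 13) <|
      .seq (.incr 18) <| .seq (.store 5 1 13 18) <|
      .ite (.eq 16 1) (.setConst 8 0) (.seq (.copy 7 16) (.decr 7)))
    (.setConst 8 0)

/-- The invariant of the auction on memory states, where the bidders up to `m` have been served with
the exception of the active one. -/
structure Market (n K : ℕ) (A : ℕ → ℕ → ℕ) (m : ℕ) (s : Store) : Prop where
  base : Base n A s
  threshold : s.reg 3 = K
  auction : Auction n K (fun u v => A u v ≠ 0) (s.arr 2 0) (s.arr 4 0) (s.arr 5 0)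
  active_le : s.reg 8 ≤ 1
  active : s.reg 8 = 1 → s.reg 7 < n ∧ s.arr 2 0 (s.reg 7) = 0
  served : ∀ u < m, s.arr 2 0 u = 0 → (s.reg 8 = 1 ∧ u = s.reg 7) ∨
    ∀ v < n, A u v ≠ 0 → K ≤ s.arr 5 0 v

/-- The capital that is left for further bids. -/
def budget (n K : ℕ) (s : Store) : ℕ := ∑ v ∈ Finset.range n, (K - s.arr 5 0 v)

/-- The potential is `budget` plus register `8`. Either some price rises by one, or the scan finds
nothing below K and the active bidder retires. -/
theorem halts_bidProg {n K m : ℕ} {A : ℕ → ℕ → ℕ} {s : Store} (h : Market n K A m s)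
    (hact : s.reg 8 = 1) :
    Halts bidProg s fun t s' => Market n K A m s' ∧
      budget n K s' ≤ budget n K s ∧
      budget n K s' + s'.reg 8 + 1 ≤ budget n K s + s.reg 8 ∧ t ≤ 8 * n + 30 := by
  obtain ⟨hcn, hcm⟩ := h.active hact
  rw [bidProg, halts_seq]
  refine (halts_scanProg h.base).mono fun t s₁ he ⟨g1, g2, g3, g4⟩ => ?_
  have hb₁ := h.base.exec he (by decide) (by decide) (by decide)
  have e3 : s₁.reg 3 = K := by rw [he.reg_eq (by decide), h.threshold]
  have e7 : s₁.reg 7 = s.reg 7 := he.reg_eq (by decide)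
  have e8 : s₁.reg 8 = 1 := by rw [he.reg_eq (by decide), hact]
  have earr : s₁.arr = s.arr := by
    ext a : 1
    exact he.arr_eq (by simp [scanProg, Prog.arrs, Prog.forTo, Prog.skip])
  rw [h.threshold] at g1 g3
  rw [halts_ite, holds_lt, e3]
  refine ⟨fun hlt => ?_, fun hlt => ?_⟩
  · obtain ⟨hvn, hadj, hprice⟩ := g3 hlt
    set c := s.reg 7 with hc
    set v := s₁.reg 13 with hv
    rw [halts_seq, halts_copy, halts_seq, halts_copy, halts_seq]
    refine (halts_assignProg (u := c) (v := v) (by simp [hb₁.zero]) (by simp [e7]) (by simp [hv])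
      ?_).mono fun t₂ s₂ he₂ ⟨k1, k2, k3, k4, k5⟩ => ?_
    · simp only [setReg_arr, earr]
      intro h0
      have := (h.auction.mat.own_mate v c hvn h0).2
      omega
    simp only [setReg_arr, earr] at k2 k3 k4
    have hb₂ : Base n A s₂ := ((hb₁.setReg (by decide) (by decide)).setReg (by decide)
      (by decide)).exec he₂ (by decide) (by decide) (by decide)
    have r3 : s₂.reg 3 = K := by rw [he₂.reg_eq (by decide)]; simp [e3]
    have r13 : s₂.reg 13 = v := by rw [he₂.reg_eq (by decide)]; simp [hv]
    have r8 : s₂.reg 8 = 1 := by rw [he₂.reg_eq (by decide)]; simp [e8]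
    have a5 : s₂.arr 5 = s.arr 5 := by rw [he₂.arr_eq (by decide)]; simp [earr]
    have hbid := h.auction.bid hcn hvn hadj hcm (by rw [hprice]; exact hlt)
      (fun v' hv' ha => by rw [hprice]; exact g2 v' hv' ha)
    have hsum := sum_sub_price_bid (price := s.arr 5 0) hvn (by rw [hprice]; exact hlt)
    -- a node without partner that was served still finds no cheap neighbour
    have hserved : ∀ u < m, mateAssign (s.arr 2 0) (s.arr 4 0) c v u = 0 →
        s.arr 4 0 v = u + 1 ∨ ∀ v' < n, A u v' ≠ 0 →
          K ≤ Function.update (s.arr 5 0) v (s.arr 5 0 v + 1) v' := by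
      intro u hu h0
      by_cases how : s.arr 4 0 v = u + 1
      · exact Or.inl how
      · simp only [mateAssign, if_neg how] at h0
        split_ifs at h0 with huc
        rcases h.served u hu h0 with ⟨-, h'⟩ | h'
        · exact absurd h' huc
        · refine Or.inr fun v' hv' ha => (h' v' hv' ha).trans ?_
          rw [Function.update_apply]
          split_ifs with hvv
          · subst hvv; omega
          · exact le_rfl
    refine Halts.mono (R := fun t s' => s'.arr 5 0 = Function.update (s.arr 5 0) v (s.arr 5 0 v + 1) ∧
      (s.arr 4 0 v = 0 → s'.reg 8 = 0) ∧
      (∀ x, s.arr 4 0 v = x + 1 → s'.reg 8 = 1 ∧ s'.reg 7 = x) ∧ t ≤ 6) ?_ ?_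
    · simp only [halts_seq, halts_load, halts_incr, halts_store, halts_ite, holds_eq,
        halts_setConst, halts_copy, halts_decr, setReg_reg, setReg_arr, setArr_arr, setArr_reg]
      simp only [Nat.reduceEqDiff, if_true, if_false, hb₂.zero, r13, a5, k4, r8, true_and, and_self]
      refine ⟨fun h0 => ⟨fun _ => trivial, fun x hx => by omega, by norm_num⟩,
        fun h0 => ⟨fun h1 => absurd h1 h0, fun x hx => by omega, by norm_num⟩⟩
    · rintro t₃ s₃ he₃ ⟨p1, p2, p3, p4⟩
      have a2 : s₃.arr 2 = s₂.arr 2 := he₃.arr_eq (by decide)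
      have a4 : s₃.arr 4 = s₂.arr 4 := he₃.arr_eq (by decide)
      have hbud : budget n K s₃ + 1 = budget n K s := by
        rw [budget, p1]
        exact hsum
      have hM : Market n K A m s₃ := by
        refine ⟨hb₂.exec he₃ (by decide) (by decide) (by decide),
          by rw [he₃.reg_eq (by decide), r3], by rw [a2, a4, k2, k3, p1]; exact hbid, ?_, ?_, ?_⟩
        · rcases Nat.eq_zero_or_eq_succ_pred (s.arr 4 0 v) with h0 | h0
          · rw [p2 h0]; omega
          · rw [(p3 _ h0).1]
        · intro h8
          rcases Nat.eq_zero_or_eq_succ_pred (s.arr 4 0 v) with h0 | h0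
          · rw [p2 h0] at h8; omega
          · have hx := h.auction.mat.own_mate v _ hvn h0
            rw [(p3 _ h0).2, a2, k2]
            refine ⟨hx.1, ?_⟩
            have hne : (s.arr 4 0 v).pred ≠ c := by
              intro hcc
              have := hx.2
              rw [hcc] at this
              omega
            rw [mateAssign, if_neg hne, if_pos h0]
        · intro u hu h0
          rw [a2, k2] at h0
          rw [p1]
          rcases hserved u hu h0 with h' | h'
          · exact Or.inl ⟨(p3 u h').1, (p3 u h').2.symm⟩
          · exact Or.inr h'
      have := hM.active_le
      exact ⟨hM, by omega, by omega, by omega⟩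
  · rw [halts_setConst]
    have hbud : budget n K (s₁.setReg 8 0) = budget n K s := by simp [budget, earr]
    refine ⟨⟨hb₁.setReg (by decide) (by decide), by simp [e3], by simpa [earr] using h.auction,
      by simp, by simp, ?_⟩, hbud.le, by simp [hbud, hact], by omega⟩
    intro u hu h0
    simp only [setReg_arr, earr] at h0 ⊢
    right
    rcases h.served u hu h0 with ⟨-, rfl⟩ | h'
    · intro v hv ha
      have := g2 v hv ha
      omega
    · exact h'

/-- Every state in turn bids until the chain of bids ends. -/
def auctionProg : Prog :=
  .forTo 6 <| .seq (.copy 7 6) <| .seq (.load 10 2 1 6) <|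
    .seq (.ite (.eq 10 1) (.setConst 8 1) (.setConst 8 0)) <| .loop (.lt 1 8) bidProg

/-- Time is charged to the budget spent, plus one scan that may find nothing. So the chains of bids
need no individual bound. -/
theorem halts_bid_loop {n K m : ℕ} {A : ℕ → ℕ → ℕ} {s : Store} (h : Market n K A m s) :
    Halts (.loop (.lt 1 8) bidProg) s fun t s' => Market n K A m s' ∧ s'.reg 8 = 0 ∧
      budget n K s' ≤ budget n K s ∧ t + (8 * n + 31) * budget n K s' ≤ (8 * n + 31) * (budget n K s + 1) + 1 := by
  refine (halts_loop (B := (8 * n + 31) * (budget n K s + 1)) (fun τ s' => Market n K A m s' ∧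
    budget n K s' ≤ budget n K s ∧ τ + (8 * n + 31) * (budget n K s' + s'.reg 8) ≤ (8 * n + 31) * (budget n K s + 1))
    ?_ ?_ ?_).mono ?_
  · rintro τ s' ⟨-, -, h'⟩
    exact (Nat.le_add_right _ _).trans h'
  · rintro τ s' ⟨h1, hle, h2⟩ hlt
    rw [holds_lt, h1.base.zero] at hlt
    have h8 : s'.reg 8 = 1 := by have := h1.active_le; omega
    refine (halts_bidProg h1 h8).mono fun t s'' _ ⟨h3, hle', h4, h5⟩ => ⟨h3, hle'.trans hle, ?_⟩
    have := Nat.mul_le_mul_left (8 * n + 31) h4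
    rw [mul_add _ _ 1, mul_one] at this
    omega
  · exact ⟨h, le_rfl, by have := Nat.mul_le_mul_left (8 * n + 31) (Nat.add_le_add_left h.active_le (budget n K s)); omega⟩
  · rintro t s' - ⟨τ, ⟨h1, hle, h2⟩, hnot, rfl⟩
    rw [holds_lt, h1.base.zero] at hnot
    have h8 : s'.reg 8 = 0 := by omega
    rw [h8, add_zero] at h2
    exact ⟨h1, h8, hle, by omega⟩

/-- There are n prices, each rising at most K times, and at most one unsuccessful scan per bidder:
O(nK + n) scans of cost O(n). The slope 37 instead of 31 absorbs the overhead of each bidder. -/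
theorem halts_auctionProg {n K : ℕ} {A : ℕ → ℕ → ℕ} {s : Store} (hb : Base n A s)
    (h3 : s.reg 3 = K) (h8 : s.reg 8 = 0) (h2 : s.arr 2 0 = 0) (h4 : s.arr 4 0 = 0)
    (h5 : s.arr 5 0 = 0) :
    Halts auctionProg s fun t s' =>
      Auction n K (fun u v => A u v ≠ 0) (s'.arr 2 0) (s'.arr 4 0) (s'.arr 5 0) ∧
      (∀ u < n, s'.arr 2 0 u = 0 → ∀ v < n, A u v ≠ 0 → K ≤ s'.arr 5 0 v) ∧
      t ≤ (8 * n + 37) * (n * K + n) + 2 * n + 2 := by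
  have hbudget : budget n K s = n * K := by simp [budget, h5]
  refine (halts_forTo (n := n) (B := (8 * n + 37) * (n * K + n)) (fun k τ s' => Market n K A k s' ∧
    s'.reg 8 = 0 ∧ k ≤ n ∧
    τ + (8 * n + 37) * budget n K s' ≤ (8 * n + 37) * (n * K + k)) hb.size (by decide) (by decide)
    (by decide) ?_ ?_ ?_ ?_).mono ?_
  · rintro k τ s' x ⟨h, h8, hk, hτ⟩
    refine ⟨⟨h.base.setReg (by decide) (by decide), by simpa using h.threshold, h.auction,
      by simpa using h.active_le, by simpa using h.active, by simpa using h.served⟩,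
      by simpa using h8, hk, hτ⟩
  · rintro k τ s' ⟨-, -, hk, hτ⟩
    have := Nat.mul_le_mul_left (8 * n + 37) (Nat.add_le_add_left hk (n * K))
    omega
  · rintro k τ s' hk hs0 hs6 ⟨h, h8, -, hτ⟩
    rw [halts_seq, halts_copy, halts_seq, halts_load, halts_seq]
    refine Halts.mono (R := fun t s'' => Market n K A (k + 1) s'' ∧ s''.arr = s'.arr ∧ t ≤ 2) ?_ ?_
    · simp only [halts_ite, halts_setConst, holds_eq, setReg_reg, setReg_arr]
      simp only [Nat.reduceEqDiff, if_true, if_false, h.base.zero, hs6]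
      have hB : ∀ x y z : ℕ, Base n A (((s'.setReg 7 x).setReg 10 y).setReg 8 z) := fun x y z =>
        ((h.base.setReg (by decide) (by decide)).setReg (by decide) (by decide)).setReg (by decide)
          (by decide)
      refine ⟨fun h0 => ⟨⟨hB _ _ _, by simpa using h.threshold, h.auction, by simp, ?_, ?_⟩,
        by simp, by norm_num⟩, fun h0 => ⟨⟨hB _ _ _, by simpa using h.threshold, h.auction, by simp,
        by simp, ?_⟩, by simp, by norm_num⟩⟩
      · simpa using ⟨hk, h0⟩
      · intro u hu hu0
        simp only [setReg_arr] at hu0 ⊢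
        simp only [setReg_reg, Nat.reduceEqDiff, if_true, if_false, true_and]
        rcases Nat.lt_succ_iff_lt_or_eq.1 hu with hu | rfl
        · rcases h.served u hu hu0 with ⟨h', -⟩ | h'
          · omega
          · exact Or.inr h'
        · exact Or.inl rfl
      · intro u hu hu0
        simp only [setReg_arr] at hu0 ⊢
        rcases Nat.lt_succ_iff_lt_or_eq.1 hu with hu | rfl
        · rcases h.served u hu hu0 with ⟨h', -⟩ | h'
          · omega
          · exact Or.inr h'
        · exact absurd hu0 h0
    · rintro t s'' - ⟨g1, g2, g3⟩
      refine (halts_bid_loop g1).mono fun t' s₃ _ ⟨p1, p2, q1, p3⟩ => ⟨p1, p2, hk, ?_⟩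
      have e : budget n K s'' = budget n K s' := by simp [budget, g2]
      rw [e] at p3
      rw [e] at q1
      have q2 : (8 * n + 37) * (n * K + (k + 1)) = (8 * n + 37) * (n * K + k) + (8 * n + 37) := by
        ring
      have q3 : ∀ x, (8 * n + 37) * x = (8 * n + 31) * x + 6 * x := fun x => by ring
      rw [q2]
      rw [mul_add _ _ 1, mul_one] at p3
      have r1 := q3 (budget n K s₃)
      have r2 := q3 (budget n K s')
      omega
  · refine ⟨⟨hb, h3, ⟨⟨?_, ?_⟩, ?_, ?_, ?_⟩, by omega, by omega, by simp⟩, h8, by omega, by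
      simp [hbudget]⟩
    all_goals simp [h2, h4, h5]
  · rintro t s' - ⟨τ, ⟨h, h8, -, hτ⟩, rfl⟩
    refine ⟨h.auction, fun u hu hu0 => ?_, by omega⟩
    rcases h.served u hu hu0 with ⟨h', -⟩ | h'
    · omega
    · exact h'

/-! ### The search program -/

section SearchProgram

variable {n : ℕ} {A : ℕ → ℕ → ℕ} {mate own : ℕ → ℕ}

/-- The memory state during a search whose first `head` queue entries have been processed. -/
structure Searching (n : ℕ) (A : ℕ → ℕ → ℕ) (mate own : ℕ → ℕ) (head : ℕ) (s : Store) : Prop where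
  base : Base n A s
  mate_eq : s.arr 2 0 = mate
  own_eq : s.arr 4 0 = own
  search : ∃ rk, Search n (fun u v => A u v ≠ 0) mate own (s.arr 6 0) (s.arr 7 0) head (s.reg 21)
    (s.reg 22) rk

/-- Clears the predecessors and fills the queue with the unmatched nodes of `V⁺`. -/
def initSearchProg : Prog :=
  .seq (.forTo 20 (.store 6 1 20 1)) <| .seq (.setConst 21 0) <| .seq (.setConst 22 0) <|
    .forTo 20 <| .seq (.load 23 2 1 20) <|
      .ite (.eq 23 1) (.seq (.store 7 1 21 20) (.incr 21)) .skip

theorem halts_clear {s : Store} (hb : Base n A s) :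
    Halts (.forTo 20 (.store 6 1 20 1)) s fun t s' => (∀ v < n, s'.arr 6 0 v = 0) ∧
      t ≤ 3 * n + 2 := by
  refine (halts_forTo (n := n) (B := n) (fun k τ s' => Base n A s' ∧ (∀ v < k, s'.arr 6 0 v = 0) ∧
    k ≤ n ∧ τ ≤ k) hb.size (by decide) (by decide) (by decide) ?_ ?_ ?_ ?_).mono ?_
  · rintro k τ s' x ⟨h1, h2, h3⟩
    exact ⟨h1.setReg (by decide) (by decide), h2, h3⟩
  · rintro k τ s' ⟨-, -, h1, h2⟩
    omega
  · rintro k τ s' hk hs0 hs20 ⟨h1, h2, -, h4⟩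
    rw [halts_store]
    refine ⟨⟨h1.size, h1.zero, ?_⟩, ?_, hk, by omega⟩
    · ext i j
      simp [h1.adj]
    · intro v hv
      simp only [setArr_arr, h1.zero, hs20, and_self, if_true, Function.update_apply]
      split_ifs with hvk
      · rfl
      · exact h2 v (by omega)
  · exact ⟨hb, by simp, by omega, by omega⟩
  · rintro t s' - ⟨τ, ⟨-, h2, -, h4⟩, rfl⟩
    exact ⟨h2, by omega⟩

theorem card_filter_range_succ (P : ℕ → Prop) [DecidablePred P] (k : ℕ) :
    ((Finset.range (k + 1)).filter P).card =
      ((Finset.range k).filter P).card + if P k then 1 else 0 := by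
  rw [Finset.range_add_one, Finset.filter_insert]
  split_ifs
  · rw [Finset.card_insert_of_notMem (by simp)]
  · rfl

theorem halts_initSearchProg {s : Store} (hb : Base n A s)
    (hM : Mat n (fun u v => A u v ≠ 0) (s.arr 2 0) (s.arr 4 0)) :
    Halts initSearchProg s fun t s' => Searching n A (s.arr 2 0) (s.arr 4 0) 0 s' ∧
      t ≤ 9 * n + 6 := by
  rw [initSearchProg, halts_seq]
  refine (halts_clear hb).mono fun t₁ s₁ he₁ ⟨hpar, ht₁⟩ => ?_
  have hb₁ := hb.exec he₁ (by decide) (by decide) (by decide)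
  have e2 : s₁.arr 2 = s.arr 2 := he₁.arr_eq (by decide)
  have e4 : s₁.arr 4 = s.arr 4 := he₁.arr_eq (by decide)
  rw [halts_seq, halts_setConst, halts_seq, halts_setConst]
  set s₂ := (s₁.setReg 21 0).setReg 22 0 with hs₂
  have hb₂ : Base n A s₂ := (hb₁.setReg (by decide) (by decide)).setReg (by decide) (by decide)
  refine (halts_forTo (n := n) (B := 4 * n) (fun k τ s' => Base n A s' ∧ s'.arr 2 = s.arr 2 ∧
    s'.arr 4 = s.arr 4 ∧ s'.arr 6 = s₁.arr 6 ∧ s'.reg 22 = 0 ∧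
    (∀ j < s'.reg 21, s'.arr 7 0 j < n ∧ s.arr 2 0 (s'.arr 7 0 j) = 0) ∧
    (∀ u < k, s.arr 2 0 u = 0 → ∃ j < s'.reg 21, s'.arr 7 0 j = u) ∧
    s'.reg 21 = ((Finset.range k).filter fun u => ¬ s.arr 2 0 u ≠ 0).card ∧ k ≤ n ∧ τ ≤ 4 * k)
    hb₂.size (by decide) (by decide) (by decide) ?_ ?_ ?_ ?_).mono ?_
  · rintro k τ s' x ⟨h1, h⟩
    exact ⟨h1.setReg (by decide) (by decide), by simpa using h⟩
  · rintro k τ s' ⟨-, -, -, -, -, -, -, -, h1, h2⟩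
    omega
  · rintro k τ s' hk hs0 hs20 ⟨h1, h2, h3, h4, h5, h6, h7, h8, -, h10⟩
    refine Halts.mono (R := fun t s'' => (∀ j < s''.reg 21, s''.arr 7 0 j < n ∧
      s.arr 2 0 (s''.arr 7 0 j) = 0) ∧
      (∀ u < k + 1, s.arr 2 0 u = 0 → ∃ j < s''.reg 21, s''.arr 7 0 j = u) ∧
      s''.reg 21 = ((Finset.range (k + 1)).filter fun u => ¬ s.arr 2 0 u ≠ 0).card ∧ t ≤ 4) ?_ ?_
    · simp only [halts_seq, halts_load, halts_ite, halts_skip, halts_store, halts_incr, holds_eq,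
        setReg_reg, setReg_arr, setArr_arr, setArr_reg, card_filter_range_succ]
      simp only [Nat.reduceEqDiff, if_true, if_false, h1.zero, hs20, h2, and_self]
      refine ⟨fun h0 => ⟨fun j hj => ?_, fun u hu hu0 => ?_, by simp [h8, h0], by norm_num⟩,
        fun h0 => ⟨h6, fun u hu hu0 => ?_, by simp [h8, h0], by norm_num⟩⟩
      · rcases Nat.lt_succ_iff_lt_or_eq.1 hj with hj | rfl
        · rw [Function.update_of_ne hj.ne]
          exact h6 j hj
        · rw [Function.update_self]
          exact ⟨hk, h0⟩
      · rcases Nat.lt_succ_iff_lt_or_eq.1 hu with hu | rfl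
        · obtain ⟨j, hj, hju⟩ := h7 u hu hu0
          exact ⟨j, by omega, by rw [Function.update_of_ne hj.ne, hju]⟩
        · exact ⟨s'.reg 21, by omega, Function.update_self _ _ _⟩
      · rcases Nat.lt_succ_iff_lt_or_eq.1 hu with hu | rfl
        · exact h7 u hu hu0
        · exact absurd hu0 h0
    · rintro t s'' he ⟨g1, g2, g3, g4⟩
      exact ⟨h1.exec he (by decide) (by decide) (by decide), by rw [he.arr_eq (by decide), h2],
        by rw [he.arr_eq (by decide), h3], by rw [he.arr_eq (by decide), h4],
        by rw [he.reg_eq (by decide), h5], g1, g2, g3, hk, by omega⟩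
  · exact ⟨hb₂, by simp [hs₂, e2], by simp [hs₂, e4], by simp [hs₂], by simp [hs₂], by simp [hs₂],
      by simp, by simp [hs₂], by omega, by omega⟩
  · rintro t s' - ⟨τ, ⟨h1, h2, h3, h4, h5, h6, h7, h8, -, h10⟩, rfl⟩
    refine ⟨⟨h1, by rw [h2], by rw [h3], fun _ => 0, ?_⟩, by omega⟩
    rw [h4, h5]
    refine ⟨Nat.zero_le _, fun k hk => (h6 k hk).1, fun k hk => Or.inl (h6 k hk).2, h7, ?_, ?_, ?_,
      by omega, ?_, by omega, ?_, ?_⟩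
    · intro v hv u hu
      rw [hpar v hv] at hu; omega
    · intro v hv h0
      exact absurd (hpar v hv) h0
    · intro v hv h0
      exact absurd (hpar v hv) h0
    -- As many nodes of V⁻ as of V⁺ are matched, so the queued unmatched nodes of V⁺ and the matched
    -- nodes of V⁻ add up to n.
    · have e : (Finset.range n).filter (fun v => s.arr 4 0 v ≠ 0 ∧ s₁.arr 6 0 v = 0) =
          matched n (s.arr 4 0) := by
        refine Finset.filter_congr fun v hv => ?_
        simp [hpar v (Finset.mem_range.1 hv)]
      rw [e, hM.card_matched, h8, matched, add_comm, Finset.card_filter_add_card_filter_not,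
        Finset.card_range]
    · intro v hv h0
      exact absurd (hpar v hv) h0
    · intro v hv u hu
      rw [hpar v hv] at hu; omega

/-- Inspects the node in register `26` as a neighbour of the node in register `25`. -/
def visitProg : Prog :=
  .seq (.load 27 0 25 26) <| .ite (.eq 27 1) .skip <| .seq (.load 27 6 1 26) <|
    .ite (.eq 27 1)
      (.seq (.copy 28 25) <| .seq (.incr 28) <| .seq (.store 6 1 26 28) <| .seq (.load 28 4 1 26) <|
        .ite (.eq 28 1) (.seq (.copy 22 26) (.incr 22))
          (.seq (.decr 28) <| .seq (.store 7 1 21 28) (.incr 21)))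
      .skip

theorem halts_visitProg {s : Store} {head u v : ℕ} (hM : Mat n (fun u v => A u v ≠ 0) mate own)
    (h : Searching n A mate own head s) (hu : s.reg 25 = u) (hv : s.reg 26 = v) (hun : u < n)
    (hvn : v < n) (hlt : head < s.reg 21) (hq : s.arr 7 0 head = u) :
    Halts visitProg s fun t s' => Searching n A mate own head s' ∧ head < s'.reg 21 ∧
      s'.arr 7 0 head = u ∧ (∀ w, s.arr 6 0 w ≠ 0 → s'.arr 6 0 w ≠ 0) ∧
      (A u v ≠ 0 → s'.arr 6 0 v ≠ 0) ∧ t ≤ 12 := by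
  obtain ⟨hb, hmate, hown, rk, hS⟩ := h
  have hmono : ∀ w, s.arr 6 0 w ≠ 0 → Function.update (s.arr 6 0) v (u + 1) w ≠ 0 := by
    intro w hw
    rw [Function.update_apply]
    split_ifs
    · omega
    · exact hw
  refine Halts.mono (R := fun t s' => (∃ rk, Search n (fun u v => A u v ≠ 0) mate own (s'.arr 6 0)
    (s'.arr 7 0) head (s'.reg 21) (s'.reg 22) rk) ∧ head < s'.reg 21 ∧
      s'.arr 7 0 head = u ∧ (∀ w, s.arr 6 0 w ≠ 0 → s'.arr 6 0 w ≠ 0) ∧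
      (A u v ≠ 0 → s'.arr 6 0 v ≠ 0) ∧ t ≤ 12) ?_ ?_
  · simp only [visitProg, halts_seq, halts_load, halts_ite, halts_skip, halts_store, halts_incr,
      halts_copy, halts_decr, holds_eq, setReg_reg, setReg_arr, setArr_arr, setArr_reg]
    simp only [Nat.reduceEqDiff, if_true, if_false, hb.zero, hb.adj, hu, hv, hown, and_self,
      false_and]
    refine ⟨fun h0 => ⟨⟨rk, hS⟩, hlt, hq, fun w hw => hw, fun h1 => absurd h0 h1, by norm_num⟩,
      fun h0 => ⟨fun h1 => ?_, fun h1 => ⟨⟨rk, hS⟩, hlt, hq, fun w hw => hw, fun _ => h1, by norm_num⟩⟩⟩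
    obtain ⟨rk', hd1, hd2⟩ := hS.discover hM hun hvn h0 h1 (hq ▸ hS.queue_reached head hlt)
    refine ⟨fun h2 => ⟨⟨rk', hd1 h2⟩, hlt, hq, hmono, fun _ => by simp, by norm_num⟩, fun h2 => ?_⟩
    obtain ⟨x, hx⟩ := Nat.exists_eq_succ_of_ne_zero h2
    have hd := hd2 x hx
    refine ⟨⟨rk', ?_⟩, by omega, by rw [Function.update_of_ne hlt.ne, hq], hmono,
      fun _ => by simp, by norm_num⟩
    rw [hx, Nat.succ_sub_one]
    exact hd
  · rintro t s' he ⟨g1, g2, g3, g4, g5, g6⟩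
    exact ⟨⟨hb.exec he (by decide) (by decide) (by decide), by rw [he.arr_eq (by decide), hmate],
      by rw [he.arr_eq (by decide), hown], g1⟩, g2, g3, g4, g5, g6⟩

/-- The search from all unmatched nodes of `V⁺`. -/
def searchProg : Prog :=
  .seq initSearchProg <| .seq (.setConst 24 0) <| .loop (.lt 24 21) <|
    .seq (.load 25 7 1 24) <| .seq (.forTo 26 visitProg) (.incr 24)

/-- `count` limits the queue to n entries, each served by one scan of a row. The search never stops
early: at its end head = tail, as `Search.not_augmenting` needs. -/
theorem halts_searchProg {s : Store} (hb : Base n A s)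
    (hM : Mat n (fun u v => A u v ≠ 0) (s.arr 2 0) (s.arr 4 0)) :
    Halts searchProg s fun t s' => Searching n A (s.arr 2 0) (s.arr 4 0) (s'.reg 21) s' ∧
      t ≤ n * (14 * n + 5) + 9 * n + 8 := by
  rw [searchProg, halts_seq]
  refine (halts_initSearchProg hb hM).mono fun t₁ s₁ he₁ ⟨hS₁, ht₁⟩ => ?_
  rw [halts_seq, halts_setConst]
  have tail_le : ∀ {head s'}, Searching n A (s.arr 2 0) (s.arr 4 0) head s' →
      head ≤ s'.reg 21 ∧ s'.reg 21 ≤ n := by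
    rintro head s' ⟨-, -, -, rk, hS⟩
    have := hS.count
    exact ⟨hS.head_le, by omega⟩
  refine (halts_loop (B := n * (14 * n + 5)) (fun τ s' =>
    Searching n A (s.arr 2 0) (s.arr 4 0) (s'.reg 24) s' ∧ τ ≤ s'.reg 24 * (14 * n + 5))
    ?_ ?_ ?_).mono ?_
  · rintro τ s' ⟨h1, h2⟩
    obtain ⟨h3, h4⟩ := tail_le h1
    exact h2.trans (Nat.mul_le_mul_right _ (h3.trans h4))
  · rintro τ s' ⟨h1, h2⟩ hlt
    rw [holds_lt] at hlt
    rw [halts_seq, halts_load, halts_seq]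
    set head := s'.reg 24 with hhead
    set u := s'.arr 7 0 head with hu
    have hun : u < n := by
      obtain ⟨-, -, -, rk, hS⟩ := h1
      exact hS.queue_lt _ hlt
    have hset : ∀ {s'' : Store} {d x : ℕ}, d ≠ 0 → d ≠ 1 → d ≠ 21 → d ≠ 22 →
        Searching n A (s.arr 2 0) (s.arr 4 0) head s'' →
        Searching n A (s.arr 2 0) (s.arr 4 0) head (s''.setReg d x) := by
      rintro s'' d x d0 d1 d2 d3 ⟨g1, g2, g3, rk, g4⟩
      refine ⟨g1.setReg d0 d1, g2, g3, rk, ?_⟩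
      simpa [d2.symm, d3.symm] using g4
    refine (halts_forTo (n := n) (B := 12 * n) (fun k τ s'' =>
      Searching n A (s.arr 2 0) (s.arr 4 0) head s'' ∧ s''.reg 24 = head ∧ s''.reg 25 = u ∧
      head < s''.reg 21 ∧ s''.arr 7 0 head = u ∧ (∀ v < k, A u v ≠ 0 → s''.arr 6 0 v ≠ 0) ∧
      k ≤ n ∧ τ ≤ 12 * k) ?_ (by decide) (by decide) (by decide) ?_ ?_ ?_ ?_).mono ?_
    · simp [h1.base.size]
    · rintro k τ s'' x ⟨g1, g⟩
      exact ⟨hset (by decide) (by decide) (by decide) (by decide) g1, by simpa using g⟩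
    · rintro k τ s'' ⟨-, -, -, -, -, -, g1, g2⟩
      omega
    · rintro k τ s'' hk hs0 hs26 ⟨g1, g2, g3, g4, g5, g6, -, g8⟩
      refine (halts_visitProg hM g1 g3 hs26 hun hk g4 g5).mono
        fun t s₃ he ⟨p1, p2, p3, p4, p5, p6⟩ => ⟨p1, by rw [he.reg_eq (by decide), g2],
          by rw [he.reg_eq (by decide), g3], p2, p3, ?_, hk, by omega⟩
      intro v hv hAv
      rcases Nat.lt_succ_iff_lt_or_eq.1 hv with hv | rfl
      · exact p4 v (g6 v hv hAv)
      · exact p5 hAv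
    · refine ⟨hset (by decide) (by decide) (by decide) (by decide) h1, by simp [hhead], ?_,
        by simpa using hlt, by simp [hu], by simp, by omega, by omega⟩
      simp [h1.base.zero, hu, hhead]
    · rintro t s'' - ⟨τ', ⟨g1, g2, g3, g4, g5, g6, -, g8⟩, rfl⟩
      rw [halts_incr]
      obtain ⟨p1, p2, p3, rk, p4⟩ := g1
      refine ⟨⟨p1.setReg (by decide) (by decide), p2, p3, rk, ?_⟩, ?_⟩
      · simp only [setReg_reg, setReg_arr, Nat.reduceEqDiff, if_true, if_false, g2]
        refine { p4 with head_le := g4, processed := fun k hk v hv hkv => ?_ }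
        rcases Nat.lt_succ_iff_lt_or_eq.1 hk with hk | rfl
        · exact p4.processed k hk v hv hkv
        · rw [g5] at hkv
          exact g6 v hv hkv
      · simp only [setReg_reg, if_true, g2]
        rw [add_mul]
        omega
  · obtain ⟨g1, g2, g3, rk, g4⟩ := hS₁
    exact ⟨⟨g1.setReg (by decide) (by decide), g2, g3, rk, by simpa using g4⟩, by omega⟩
  · rintro t s' - ⟨τ, ⟨h1, h2⟩, hnot, rfl⟩
    rw [holds_lt] at hnot
    obtain ⟨h3, h4⟩ := tail_le h1
    have h5 : s'.reg 24 = s'.reg 21 := by omega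
    rw [h5] at h1
    refine ⟨h1, ?_⟩
    have := h2.trans (Nat.mul_le_mul_right _ (h3.trans h4))
    omega

/-! ### Augmentation -/

/-- Augments the matching along the predecessors, starting from the node in register `22`. -/
def augmentProg : Prog :=
  .seq (.copy 15 22) <| .seq (.decr 15) <| .seq (.setConst 29 1) <| .loop (.lt 1 29) <|
    .seq (.load 14 6 1 15) <| .seq (.decr 14) <| .seq assignProg <|
      .ite (.eq 17 1) (.setConst 29 0) (.seq (.copy 15 17) (.decr 15))

/-- Ranks start below n and drop at every assignment, so there are at most n of them. All but the
last rematch a node that was matched already; the last one takes in an unmatched root. -/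
theorem halts_augmentProg {s : Store} (hM : Mat n (fun u v => A u v ≠ 0) mate own)
    (h : Searching n A mate own (s.reg 21) s) (hfin : s.reg 22 ≠ 0) :
    Halts augmentProg s fun t s' => Base n A s' ∧
      Mat n (fun u v => A u v ≠ 0) (s'.arr 2 0) (s'.arr 4 0) ∧
      (matched n (s'.arr 2 0)).card = (matched n mate).card + 1 ∧ t ≤ 22 * n + 4 := by
  obtain ⟨hb, hmate, hown, rk, hS⟩ := h
  obtain ⟨v₀, hv₀⟩ := Nat.exists_eq_succ_of_ne_zero hfin
  have hflip := hS.flip hM hv₀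
  have hrk : rk v₀ + 1 ≤ n := by
    have h1 := hS.rank_lt v₀ hflip.lt hflip.reached
    have h2 : (matched n (s.arr 6 0)).card ≤ n := by
      rw [matched]
      exact (Finset.card_filter_le _ _).trans (Finset.card_range n).le
    omega
  set par := s.arr 6 0 with hpar
  rw [augmentProg, halts_seq, halts_copy, halts_seq, halts_decr, halts_seq, halts_setConst]
  refine (halts_loop (B := 22 * n) (fun τ s' => Base n A s' ∧ s'.arr 6 0 = par ∧
    ((s'.reg 29 = 1 ∧ Flip n (fun u v => A u v ≠ 0) par rk (s'.arr 2 0) (s'.arr 4 0) (s'.reg 15) ∧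
      (matched n (s'.arr 2 0)).card = (matched n mate).card ∧ τ + 22 * (rk (s'.reg 15) + 1) ≤ 22 * n) ∨
      (s'.reg 29 = 0 ∧ Mat n (fun u v => A u v ≠ 0) (s'.arr 2 0) (s'.arr 4 0) ∧
        (matched n (s'.arr 2 0)).card = (matched n mate).card + 1 ∧ τ ≤ 22 * n))) ?_ ?_ ?_).mono ?_
  · rintro τ s' ⟨-, -, ⟨-, -, -, h⟩ | ⟨-, -, -, h⟩⟩ <;> omega
  · rintro τ s' ⟨h1, h2, h3⟩ hlt
    rw [holds_lt, h1.zero] at hlt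
    rcases h3 with ⟨h29, hf, hc, hτ⟩ | ⟨h29, -⟩
    swap
    · omega
    set v := s'.reg 15 with hv
    obtain ⟨u, hu⟩ := Nat.exists_eq_succ_of_ne_zero hf.reached
    obtain ⟨hun, huv⟩ := hf.par_adj v hf.lt u hu
    rw [halts_seq, halts_load, halts_seq, halts_decr, halts_seq]
    have hbs : ∀ x y : ℕ, Base n A ((s'.setReg 14 x).setReg 14 y) := fun x y =>
      (h1.setReg (by decide) (by decide)).setReg (by decide) (by decide)
    refine (halts_assignProg (u := u) (v := v) (hbs _ _).zero
      (by simp [h1.zero, h2, ← hv, hu]) (by simp [hv]) (by simp [hf.free])).mono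
      fun t s₁ he ⟨k1, k2, k3, k4, k5⟩ => ?_
    simp only [setReg_arr] at k2 k3 k5
    have hb₁ : Base n A s₁ := (hbs _ _).exec he (by decide) (by decide) (by decide)
    have e6 : s₁.arr 6 0 = par := by rw [he.arr_eq (by decide)]; simpa using h2
    have e29 : s₁.reg 29 = 1 := by rw [he.reg_eq (by decide)]; simpa using h29
    simp only [halts_ite, halts_setConst, halts_seq, halts_copy, halts_decr, holds_eq, hb₁.zero, k5]
    refine ⟨fun h0 => ⟨hb₁.setReg (by decide) (by decide), e6, Or.inr ⟨by simp, ?_, ?_, by omega⟩⟩,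
      fun h0 => ⟨(hb₁.setReg (by decide) (by decide)).setReg (by decide) (by decide), e6, Or.inl ?_⟩⟩
    · simp only [setReg_arr]
      rw [k2, k3]
      exact hf.mat.assign hun hf.lt huv
    · simp only [setReg_arr]
      rw [k2, matched_mateAssign_of_eq_zero hun hf.free h0, hc]
    · obtain ⟨x, hx⟩ := Nat.exists_eq_succ_of_ne_zero h0
      obtain ⟨hstep, hrank⟩ := hf.step hu hx
      simp only [setReg_reg, setReg_arr, Nat.reduceEqDiff, if_true, if_false, k2, k3, hx,
        Nat.succ_sub_one]
      refine ⟨e29, hstep, ?_, by omega⟩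
      rw [matched_mateAssign_of_ne_zero hf.free h0, hc]
  · refine ⟨((hb.setReg (by decide) (by decide)).setReg (by decide) (by decide)).setReg (by decide)
      (by decide), hpar.symm, Or.inl ⟨by simp, ?_⟩⟩
    simp only [setReg_reg, setReg_arr, Nat.reduceEqDiff, if_true, if_false, hv₀, Nat.succ_sub_one,
      hmate, hown, true_and]
    exact ⟨hflip, by omega⟩
  · rintro t s' - ⟨τ, ⟨h1, h2, ⟨h29, -⟩ | ⟨-, h4, h5, h6⟩⟩, hnot, rfl⟩
    · rw [holds_lt, h1.zero] at hnot
      omega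
    · exact ⟨h1, h4, h5, by omega⟩

/-- Augments as long as the search succeeds. -/
def improveProg : Prog :=
  .seq (.setConst 19 1) <| .loop (.lt 1 19) <| .seq searchProg <|
    .ite (.eq 22 1) (.setConst 19 0) augmentProg

/-- `D` bounds the links still missing, so at most D searches succeed and one more fails. In the
invariant, d counts the missing links still allowed, and register `19` stands for the failing
search. -/
theorem halts_improveProg {E : Fin n → Fin n → Prop} {s : Store} {D : ℕ} (hb : Base n A s)
    (hM : Mat n (fun u v => A u v ≠ 0) (s.arr 2 0) (s.arr 4 0))
    (hadj : ∀ u v : Fin n, A u v ≠ 0 ↔ E u v)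
    (hD : ∀ M, IsMatching E M → M.card ≤ (matched n (s.arr 2 0)).card + D) :
    Halts improveProg s fun t s' => Base n A s' ∧
      Mat n (fun u v => A u v ≠ 0) (s'.arr 2 0) (s'.arr 4 0) ∧
      (¬ ∃ p, IsAugmentingPath E (toMatching n (s'.arr 2 0)) p) ∧
      t ≤ (n * (14 * n + 5) + 31 * n + 15) * (D + 1) + 2 := by
  rw [improveProg, halts_seq, halts_setConst]
  set T := n * (14 * n + 5) + 31 * n + 15 with hT
  set c := (matched n (s.arr 2 0)).card with hc
  refine (halts_loop (B := T * (D + 1)) (fun τ s' => Base n A s' ∧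
    Mat n (fun u v => A u v ≠ 0) (s'.arr 2 0) (s'.arr 4 0) ∧ s'.reg 19 ≤ 1 ∧
    (s'.reg 19 = 0 → ¬ ∃ p, IsAugmentingPath E (toMatching n (s'.arr 2 0)) p) ∧
    ∃ d, (matched n (s'.arr 2 0)).card + d = c + D ∧ τ + T * (d + s'.reg 19) ≤ T * (D + 1))
    ?_ ?_ ?_).mono ?_
  · rintro τ s' ⟨-, -, -, -, d, -, h⟩
    omega
  · rintro τ s' ⟨h1, h2, h3, h4, d, h5, h6⟩ hlt
    rw [holds_lt, h1.zero] at hlt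
    have h19 : s'.reg 19 = 1 := by omega
    rw [h19, mul_add, mul_one] at h6
    rw [halts_seq]
    refine (halts_searchProg h1 h2).mono fun t₁ s₁ he₁ ⟨hS, ht₁⟩ => ?_
    have e19 : s₁.reg 19 = 1 := by rw [he₁.reg_eq (by decide), h19]
    rw [halts_ite, holds_eq, hS.base.zero]
    refine ⟨fun h0 => ?_, fun h0 => ?_⟩
    · rw [halts_setConst]
      refine ⟨hS.base.setReg (by decide) (by decide), ?_, by simp, fun _ => ?_, d, ?_, ?_⟩
      · simpa only [setReg_arr, hS.mate_eq, hS.own_eq] using h2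
      · obtain ⟨rk, hs⟩ := hS.search
        rw [h0] at hs
        simp only [setReg_arr, hS.mate_eq]
        exact hs.not_augmenting h2 hadj
      · simpa only [setReg_arr, hS.mate_eq] using h5
      · simp only [setReg_reg, if_true, add_zero]
        omega
    · refine (halts_augmentProg h2 hS h0).mono fun t₂ s₂ he₂ ⟨k1, k2, k3, k4⟩ => ?_
      have e19' : s₂.reg 19 = 1 := by rw [he₂.reg_eq (by decide), e19]
      have hcard := hD _ (k2.isMatching hadj)
      rw [k2.card_toMatching] at hcard
      obtain ⟨d', rfl⟩ : ∃ d', d = d' + 1 := ⟨d - 1, by omega⟩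
      refine ⟨k1, k2, e19'.le, fun h => by omega, d', by omega, ?_⟩
      rw [e19']
      omega
  · exact ⟨hb.setReg (by decide) (by decide), hM, by simp, by simp, D, rfl, by simp⟩
  · rintro t s' - ⟨τ, ⟨h1, h2, h3, h4, d, h5, h6⟩, hnot, rfl⟩
    rw [holds_lt, h1.zero] at hnot
    exact ⟨h1, h2, h4 (by omega), by omega⟩

end SearchProgram

/-! ### The program for the contractions -/

section ContractionProgram

variable {n : ℕ} {A : ℕ → ℕ → ℕ} {own : ℕ → ℕ}

/-- `lst` lists, in its first `c` entries, the successors of `u` in the digraph of the two-step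
walks, as far as they are reached through the nodes `v < k` of `V⁻`. -/
structure SuccList (A : ℕ → ℕ → ℕ) (own : ℕ → ℕ) (u : ℕ) (lst : ℕ → ℕ) (k c : ℕ) : Prop where
  card_eq : c = ((Finset.range k).filter fun v => A u v ≠ 0 ∧ own v ≠ 0).card
  sound : ∀ i < c, ∃ v < k, A u v ≠ 0 ∧ own v = lst i + 1
  complete : ∀ v < k, ∀ w, A u v ≠ 0 → own v = w + 1 → ∃ i < c, lst i = w

theorem SuccList.skip {u k c : ℕ} {lst : ℕ → ℕ} (h : SuccList A own u lst k c)
    (hk : A u k = 0 ∨ own k = 0) : SuccList A own u lst (k + 1) c := by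
  refine ⟨?_, fun i hi => ?_, fun v hv w huv hvw => ?_⟩
  · rw [Finset.range_add_one, Finset.filter_insert, if_neg (by tauto)]
    exact h.card_eq
  · obtain ⟨v, hv, hv'⟩ := h.sound i hi
    exact ⟨v, by omega, hv'⟩
  · rcases Nat.lt_succ_iff_lt_or_eq.1 hv with hv | rfl
    · exact h.complete v hv w huv hvw
    · rcases hk with hk | hk
      · exact absurd hk huv
      · omega

theorem SuccList.push {u k c x : ℕ} {lst : ℕ → ℕ} (h : SuccList A own u lst k c)
    (hk : A u k ≠ 0) (hx : own k = x + 1) :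
    SuccList A own u (Function.update lst c x) (k + 1) (c + 1) := by
  refine ⟨?_, fun i hi => ?_, fun v hv w huv hvw => ?_⟩
  · rw [Finset.range_add_one, Finset.filter_insert, if_pos ⟨hk, by omega⟩,
      Finset.card_insert_of_notMem (by simp), ← h.card_eq]
  · rcases Nat.lt_succ_iff_lt_or_eq.1 hi with hi | rfl
    · obtain ⟨v, hv, hv'⟩ := h.sound i hi
      exact ⟨v, by omega, by rwa [Function.update_of_ne hi.ne]⟩
    · exact ⟨k, by omega, hk, by rwa [Function.update_self]⟩
  · rcases Nat.lt_succ_iff_lt_or_eq.1 hv with hv | rfl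
    · obtain ⟨i, hi, hi'⟩ := h.complete v hv w huv hvw
      exact ⟨i, by omega, by rwa [Function.update_of_ne hi.ne]⟩
    · exact ⟨c, by omega, by rw [Function.update_self]; omega⟩

/-- Lists the successors of the node in register `30`, and counts them in register `31`. -/
def succProg : Prog :=
  .seq (.setConst 31 0) <| .forTo 32 <| .seq (.load 33 0 30 32) <| .ite (.eq 33 1) .skip <|
    .seq (.load 33 4 1 32) <| .ite (.eq 33 1) .skip <|
      .seq (.decr 33) <| .seq (.store 8 30 31 33) (.incr 31)

theorem halts_succProg {s : Store} (hb : Base n A s) :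
    Halts succProg s fun t s' => (∀ r ≠ s.reg 30, s'.arr 8 r = s.arr 8 r) ∧
      SuccList A (s.arr 4 0) (s.reg 30) (s'.arr 8 (s.reg 30)) n (s'.reg 31) ∧ t ≤ 9 * n + 3 := by
  rw [succProg, halts_seq, halts_setConst]
  refine (halts_forTo (n := n) (B := 7 * n) (fun k τ s' => Base n A s' ∧ s'.reg 30 = s.reg 30 ∧
    s'.arr 4 = s.arr 4 ∧ (∀ r ≠ s.reg 30, s'.arr 8 r = s.arr 8 r) ∧
    SuccList A (s.arr 4 0) (s.reg 30) (s'.arr 8 (s.reg 30)) k (s'.reg 31) ∧ τ ≤ 7 * k ∧ k ≤ n)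
    (hb.setReg (by decide) (by decide)).size (by decide) (by decide) (by decide) ?_ ?_ ?_ ?_).mono ?_
  · rintro k τ s' x ⟨h1, h⟩
    exact ⟨h1.setReg (by decide) (by decide), by simpa using h⟩
  · rintro k τ s' ⟨-, -, -, -, -, h1, h2⟩
    omega
  · rintro k τ s' hk hs0 hs9 ⟨h1, h2, h3, h4, h5, h6, h7⟩
    have hA := h1.adj
    have hz := h1.zero
    refine Halts.mono (R := fun t s'' => (∀ r ≠ s.reg 30, s''.arr 8 r = s.arr 8 r) ∧
      SuccList A (s.arr 4 0) (s.reg 30) (s''.arr 8 (s.reg 30)) (k + 1) (s''.reg 31) ∧ t ≤ 7) ?_ ?_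
    · simp only [halts_seq, halts_load, halts_ite, halts_skip, halts_decr, halts_store, halts_incr,
        holds_eq, setReg_reg, setReg_arr, setArr_reg, setArr_arr]
      simp only [Nat.reduceEqDiff, if_true, if_false, hA, hz, hs9, h2, h3, true_and]
      refine ⟨fun h => ⟨h4, h5.skip (Or.inl h), by norm_num⟩, fun h => ⟨fun h' =>
        ⟨h4, h5.skip (Or.inr h'), by norm_num⟩, fun h' => ⟨fun r hr => ?_, ?_, by norm_num⟩⟩⟩
      · rw [if_neg hr, h4 r hr]
      · exact h5.push h (by omega)
    · rintro t s'' he ⟨g1, g2, g3⟩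
      exact ⟨h1.exec he (by decide) (by decide) (by decide),
        by rw [he.reg_eq (by decide), h2], by rw [he.arr_eq (by decide), h3], g1, g2,
        by omega, hk⟩
  · refine ⟨hb.setReg (by decide) (by decide), by simp, by simp, by simp, ?_, by simp, by simp⟩
    exact ⟨by simp, by simp, by simp⟩
  · rintro t s' - ⟨τ, ⟨h1, h2, h3, h4, h5, h6, h7⟩, rfl⟩
    exact ⟨h4, h5, by omega⟩

/-- Lists the successors of all nodes. -/
def listProg : Prog := .forTo 30 (.seq succProg (.store 9 1 30 31))

theorem halts_listProg {s : Store} (hb : Base n A s) :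
    Halts listProg s fun t s' =>
      (∀ u < n, SuccList A (s.arr 4 0) u (s'.arr 8 u) n (s'.arr 9 0 u)) ∧
        t ≤ n * (9 * n + 6) + 2 := by
  refine (halts_forTo (n := n) (B := n * (9 * n + 4)) (fun k τ s' => Base n A s' ∧
    s'.arr 4 = s.arr 4 ∧ (∀ u < k, SuccList A (s.arr 4 0) u (s'.arr 8 u) n (s'.arr 9 0 u)) ∧
    τ ≤ k * (9 * n + 4) ∧ k ≤ n) hb.size (by decide) (by decide) (by decide) ?_ ?_ ?_ ?_).mono ?_
  · rintro k τ s' x ⟨h1, h⟩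
    exact ⟨h1.setReg (by decide) (by decide), by simpa using h⟩
  · rintro k τ s' ⟨-, -, -, h1, h2⟩
    exact h1.trans (Nat.mul_le_mul_right _ h2)
  · rintro k τ s' hk hs0 hs30 ⟨h1, h2, h3, h4, h5⟩
    rw [halts_seq]
    refine (halts_succProg h1).mono fun t s₁ he ⟨g1, g2, g3⟩ => ?_
    have hb₁ := h1.exec he (by decide) (by decide) (by decide)
    have e30 : s₁.reg 30 = k := by rw [he.reg_eq (by decide), hs30]
    have e9 : s₁.arr 9 = s'.arr 9 := he.arr_eq (by decide)
    have e4 : s₁.arr 4 = s'.arr 4 := he.arr_eq (by decide)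
    rw [halts_store]
    simp only [hs30, h2] at g1 g2
    refine ⟨⟨hb₁.size, hb₁.zero, ?_⟩, ?_, fun u hu => ?_, by rw [add_mul]; omega, hk⟩
    · ext i j
      simp [hb₁.adj]
    · ext i j
      simp [e4, h2]
    · simp only [setArr_arr, hb₁.zero, e30]
      rcases Nat.lt_succ_iff_lt_or_eq.1 hu with hu | rfl
      · simpa [Function.update_of_ne hu.ne, g1 u hu.ne, e9] using h3 u hu
      · simpa using g2
  · exact ⟨hb, rfl, by simp, by simp, by simp⟩
  · rintro t s' - ⟨τ, ⟨h1, h2, h3, h4, h5⟩, rfl⟩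
    exact ⟨h3, by rw [mul_add] at h4 ⊢; omega⟩

/-- Puts the node in register `42` into the queue unless it is marked. -/
def markProg : Prog :=
  .seq (.load 43 3 34 42) <| .ite (.eq 43 1)
    (.seq (.store 3 34 42 36) <| .seq (.store 10 1 38 42) (.incr 38)) .skip

/-- Computes the contraction of the node in register `34`. -/
def contractProg : Prog :=
  .seq (.setConst 36 1) <| .seq (.store 3 34 34 36) <| .seq (.store 10 1 1 34) <|
    .seq (.setConst 37 0) <| .seq (.setConst 38 1) <| .loop (.lt 37 38) <|
      .seq (.load 39 10 1 37) <| .seq (.load 40 9 1 39) <| .seq (.setConst 41 0) <|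
        .seq (.loop (.lt 41 40) (.seq (.load 42 8 39 41) (.seq markProg (.incr 41)))) (.incr 37)

/-- The state of the search for the contraction of `i`, of which `head` queue entries have been
processed; the lists `lst`, `cnt` of the successors and the rows `mk` of the other contractions are
left alone. -/
structure Exploring (n : ℕ) (A : ℕ → ℕ → ℕ) (R : ℕ → ℕ → Prop) (i : ℕ) (lst mk : ℕ → ℕ → ℕ)
    (cnt : ℕ → ℕ) (head : ℕ) (s : Store) : Prop where
  base : Base n A s
  root : s.reg 34 = i
  one : s.reg 36 = 1
  lst_eq : s.arr 8 = lst
  cnt_eq : s.arr 9 0 = cnt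
  rows : ∀ r ≠ i, s.arr 3 r = mk r
  reach : Reach R i (s.arr 3 i) (s.arr 10 0) head (s.reg 38)

variable {R : ℕ → ℕ → Prop} {i : ℕ} {lst mk : ℕ → ℕ → ℕ} {cnt : ℕ → ℕ} {head : ℕ} {s : Store}

theorem Exploring.setReg (h : Exploring n A R i lst mk cnt head s) {d x : ℕ}
    (h0 : d ∉ [0, 1, 34, 36, 38]) : Exploring n A R i lst mk cnt head (s.setReg d x) := by
  simp only [List.mem_cons, List.not_mem_nil, or_false, not_or] at h0
  obtain ⟨h0, h1, h34, h36, h38⟩ := h0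
  refine ⟨h.base.setReg h0 h1, ?_, ?_, h.lst_eq, h.cnt_eq, h.rows, ?_⟩
  · rw [setReg_reg, if_neg (Ne.symm h34), h.root]
  · rw [setReg_reg, if_neg (Ne.symm h36), h.one]
  · rw [setReg_reg, if_neg (Ne.symm h38)]
    exact h.reach

theorem halts_markProg (h : Exploring n A R i lst mk cnt head s)
    (hR : Relation.ReflTransGen R i (s.reg 42)) :
    Halts markProg s fun t s' => Exploring n A R i lst mk cnt head s' ∧
      s.reg 38 ≤ s'.reg 38 ∧ (∀ k < s.reg 38, s'.arr 10 0 k = s.arr 10 0 k) ∧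
      (∃ k < s'.reg 38, s'.arr 10 0 k = s.reg 42) ∧ t ≤ 5 := by
  have hz := h.base.zero
  have hr := h.root
  have h1 := h.one
  simp only [markProg, halts_seq, halts_load, halts_ite, halts_skip, halts_store, halts_incr,
    holds_eq, setReg_reg, setReg_arr, setArr_reg]
  simp only [Nat.reduceEqDiff, if_true, if_false, hz, hr, h1]
  simp only [setArr_arr, setReg_arr]
  refine ⟨fun h0 => ⟨⟨⟨h.base.size, hz, ?_⟩, hr, h1, ?_, ?_, fun r hri => ?_, ?_⟩, by simp,
    fun k hk => ?_, ?_, by norm_num⟩, fun h0 => ⟨(h.setReg (by decide)).setReg (by decide), le_rfl,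
      fun _ _ => trivial, (h.reach.mark_iff _).1 h0, by norm_num⟩⟩
  · ext a b
    simp [h.base.adj]
  · ext a b
    simp [h.lst_eq]
  · simp [h.cnt_eq]
  · simp [hri, h.rows r hri]
  · simpa using h.reach.push h0 hR
  · simp [Function.update_of_ne hk.ne]
  · exact ⟨s.reg 38, by simp, by simp⟩

/-- The work is proportional to the pairs of a queue entry and one of its successors, with at most
|C| of either. Scanning adjacency rows or clearing the output row would cost n, so the lists are
prepared and the row is assumed to be zero. -/
theorem halts_contractProg {C : Finset ℕ} (hb : Base n A s) (hi : s.reg 34 = i)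
    (hC : ∀ u, Relation.ReflTransGen R i u → u ∈ C)
    (hsound : ∀ u ∈ C, ∀ k < s.arr 9 0 u, R u (s.arr 8 u k))
    (hcomplete : ∀ u ∈ C, ∀ w, R u w → ∃ k < s.arr 9 0 u, s.arr 8 u k = w)
    (hcard : ∀ u ∈ C, s.arr 9 0 u ≤ C.card) (hrow : ∀ j, s.arr 3 i j = 0) :
    Halts contractProg s fun t s' => (∀ r ≠ i, s'.arr 3 r = s.arr 3 r) ∧
      (∃ q tail, Reach R i (s'.arr 3 i) q tail tail) ∧ t ≤ 20 * C.card ^ 2 := by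
  have hpos : 0 < C.card := Finset.card_pos.2 ⟨i, hC i .refl⟩
  obtain ⟨c, hc⟩ : ∃ c, C.card = c := ⟨_, rfl⟩
  simp only [contractProg]
  rw [halts_seq, halts_setConst, halts_seq, halts_store, halts_seq, halts_store, halts_seq,
    halts_setConst, halts_seq, halts_setConst]
  refine (halts_loop (B := c * (8 * c + 6)) (fun τ s' =>
    Exploring n A R i (s.arr 8) (s.arr 3) (s.arr 9 0) (s'.reg 37) s' ∧
      τ ≤ s'.reg 37 * (8 * c + 6)) ?_ ?_ ?_).mono ?_
  · rintro τ s' ⟨h, hτ⟩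
    have := (h.reach.head_le).trans (h.reach.tail_le hC)
    rw [hc] at this
    exact hτ.trans (Nat.mul_le_mul_right _ this)
  · rintro τ s' ⟨h, hτ⟩ hlt
    rw [holds_lt] at hlt
    set head := s'.reg 37 with hhead
    set x := s'.arr 10 0 head with hx
    have hrx := h.reach.reach _ hlt
    rw [← hx] at hrx
    have hxC := hC _ hrx
    rw [halts_seq, halts_load, halts_seq, halts_load, halts_seq, halts_setConst, halts_seq]
    refine (halts_loop (B := 8 * c) (fun τ' s₁ =>
      Exploring n A R i (s.arr 8) (s.arr 3) (s.arr 9 0) head s₁ ∧ s₁.reg 37 = head ∧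
      s₁.reg 39 = x ∧ s₁.reg 40 = s.arr 9 0 x ∧ s₁.reg 41 ≤ s.arr 9 0 x ∧ head < s₁.reg 38 ∧
      s₁.arr 10 0 head = x ∧
      (∀ k < s₁.reg 41, ∃ l < s₁.reg 38, s₁.arr 10 0 l = s.arr 8 x k) ∧
      τ' ≤ 8 * s₁.reg 41) ?_ ?_ ?_).mono ?_
    · rintro τ' s₁ ⟨-, -, -, -, h1, -, -, -, h2⟩
      have := hcard x hxC
      omega
    · rintro τ' s₁ ⟨g, h37, h39, h40, h41, h38, hq, hl, hτ'⟩ hlt'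
      rw [holds_lt, h40] at hlt'
      rw [halts_seq, halts_load, halts_seq]
      have hRk : Relation.ReflTransGen R i (s.arr 8 x (s₁.reg 41)) :=
        hrx.tail (hsound x hxC _ hlt')
      refine (halts_markProg (g.setReg (d := 42) (by decide))
        (by simpa [g.lst_eq, h39] using hRk)).mono fun t s₂ he ⟨k1, k2, k3, k4, k5⟩ => ?_
      rw [halts_incr]
      simp only [setReg_reg, setReg_arr, Nat.reduceEqDiff, if_true, if_false, g.lst_eq, h39] at k2 k3 k4
      have e37 : s₂.reg 37 = head := by rw [he.reg_eq (by decide)]; simpa using h37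
      have e39 : s₂.reg 39 = x := by rw [he.reg_eq (by decide)]; simpa using h39
      have e40 : s₂.reg 40 = s.arr 9 0 x := by rw [he.reg_eq (by decide)]; simpa using h40
      have e41 : s₂.reg 41 = s₁.reg 41 := by rw [he.reg_eq (by decide)]; simp
      refine ⟨k1.setReg (by decide), by simpa using e37, by simpa using e39, by simpa using e40,
        by simp only [setReg_reg, if_true, e41]; omega, ?_, ?_, ?_, ?_⟩
      · simp only [setReg_reg, Nat.reduceEqDiff, if_false]
        omega
      · rw [setReg_arr, k3 _ h38, hq]
      · simp only [setReg_reg, setReg_arr, Nat.reduceEqDiff, if_true, if_false, e41]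
        intro k hk
        rcases Nat.lt_succ_iff_lt_or_eq.1 hk with hk | rfl
        · obtain ⟨l, hl1, hl2⟩ := hl k hk
          exact ⟨l, by omega, by rw [k3 l hl1, hl2]⟩
        · exact k4
      · simp only [setReg_reg, if_true, e41]
        omega
    · refine ⟨((h.setReg (by decide)).setReg (by decide)).setReg (by decide), by simp [hhead], ?_, ?_, by simp,
        by simpa using hlt, hx.symm, by simp, by simp⟩
      · simp [h.base.zero, hx, hhead]
      · simp [h.base.zero, hx, hhead, h.cnt_eq]
    · rintro t s₁ - ⟨τ', ⟨g, h37, h39, h40, h41, h38, hq, hl, hτ'⟩, hnot, rfl⟩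
      rw [holds_lt, h40] at hnot
      rw [halts_incr]
      have g' := g.setReg (d := 37) (x := s₁.reg 37 + 1) (by decide)
      have hcx := hcard x hxC
      simp only [setReg_reg, if_true, h37, add_mul, one_mul] at g' ⊢
      refine ⟨⟨g'.base, g'.root, g'.one, g'.lst_eq, g'.cnt_eq, g'.rows, ?_⟩, by omega⟩
      obtain ⟨r1, r2, r3, r4, r5, r6, r7⟩ := g'.reach
      refine ⟨by simpa using h38, r2, r3, r4, r5, r6, fun k hk u hu => ?_⟩
      rcases Nat.lt_succ_iff_lt_or_eq.1 hk with hk | rfl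
      · exact r7 k hk u hu
      · simp only [setReg_arr, hq] at hu
        obtain ⟨k, hk, rfl⟩ := hcomplete x hxC u hu
        simpa using hl k (by omega)
  · have hrow' : s.arr 3 i = fun _ => 0 := funext hrow
    refine ⟨⟨⟨by simp [hb.size], by simp [hb.zero], ?_⟩, by simp [hi], by simp, ?_, ?_, ?_, ?_⟩, by simp⟩
    · ext a b
      simp [hb.adj]
    · ext a b
      simp
    · simp
    · intro r hr
      simp [hi, hr]
    · simp only [setReg_reg, setReg_arr, setArr_reg, setArr_arr, Nat.reduceEqDiff, if_true, if_false,
        hi, hb.zero, false_and, and_true, hrow']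
      refine ⟨by omega, ⟨0, by omega, by simp⟩, ?_, by omega, fun j => ?_, fun j => ?_, by simp⟩
      · intro k hk
        obtain rfl : k = 0 := by omega
        simpa using Relation.ReflTransGen.refl
      · rw [Function.update_apply]
        split_ifs <;> simp
      · rw [Function.update_apply]
        split_ifs with hj
        · simp only [ne_eq, one_ne_zero, not_false_eq_true, true_iff]
          exact ⟨0, by omega, by simp [hj]⟩
        · simp only [ne_eq, not_true_eq_false, false_iff, not_exists, not_and]
          intro k hk
          obtain rfl : k = 0 := by omega
          simpa using Ne.symm hj
  · rintro t s' - ⟨τ, ⟨h, hτ⟩, hnot, rfl⟩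
    rw [holds_lt] at hnot
    have h1 := h.reach.head_le
    have h2 := h.reach.tail_le hC
    refine ⟨h.rows, ⟨s'.arr 10 0, s'.reg 38, ?_⟩, ?_⟩
    · have := h.reach
      rwa [show s'.reg 37 = s'.reg 38 by omega] at this
    · rw [hc] at h2 hpos ⊢
      have := hτ.trans (Nat.mul_le_mul_right _ (h1.trans h2))
      nlinarith

/-- Computes the contractions of the unmatched states among those marked in array `1`. -/
def contractionsProg : Prog :=
  .forTo 34 <| .seq (.load 35 1 1 34) <| .ite (.eq 35 1) .skip <|
    .seq (.load 35 2 1 34) <| .ite (.eq 35 1) contractProg .skip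

open Classical in
theorem halts_contractionsProg {mate : ℕ → ℕ} (hb : Base n A s)
    (hM : Mat n (fun u v => A u v ≠ 0) mate own) (hmate : s.arr 2 0 = mate)
    (hlist : ∀ u < n, SuccList A own u (s.arr 8 u) n (s.arr 9 0 u))
    (hrow : ∀ i j, s.arr 3 i j = 0) :
    Halts contractionsProg s fun t s' =>
      (∀ i < n, s.arr 1 0 i ≠ 0 → mate i = 0 → ∀ j, s'.arr 3 i j =
        if Relation.ReflTransGen (Hop n (fun u v => A u v ≠ 0) own) i j then 1 else 0) ∧
      t ≤ 7 * n + 2 + ∑ i ∈ (Finset.range n).filter (fun i => s.arr 1 0 i ≠ 0 ∧ mate i = 0),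
        20 * (contractionSet n (fun u v => A u v ≠ 0) own i).card ^ 2 := by
  set R := Hop n (fun u v => A u v ≠ 0) own with hRdef
  set P : ℕ → Prop := fun i => s.arr 1 0 i ≠ 0 ∧ mate i = 0 with hP
  set w : ℕ → ℕ := fun i => 20 * (contractionSet n (fun u v => A u v ≠ 0) own i).card ^ 2 with hw
  have hmono : ∀ k ≤ n, ∑ i ∈ (Finset.range k).filter P, w i ≤ ∑ i ∈ (Finset.range n).filter P, w i :=
    fun k hk => Finset.sum_le_sum_of_subset
      (Finset.filter_subset_filter _ (Finset.range_subset_range.2 hk))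
  refine (halts_forTo (n := n) (B := 5 * n + ∑ i ∈ (Finset.range n).filter P, w i) (fun k τ s' =>
    Base n A s' ∧ s'.arr 1 = s.arr 1 ∧ s'.arr 2 = s.arr 2 ∧ s'.arr 8 = s.arr 8 ∧
    s'.arr 9 = s.arr 9 ∧ (∀ i < k, P i → ∀ j, s'.arr 3 i j =
      if Relation.ReflTransGen R i j then 1 else 0) ∧ (∀ i, k ≤ i → ∀ j, s'.arr 3 i j = 0) ∧
    τ ≤ 5 * k + ∑ i ∈ (Finset.range k).filter P, w i ∧ k ≤ n)
    hb.size (by decide) (by decide) (by decide) ?_ ?_ ?_ ?_).mono ?_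
  · rintro k τ s' x ⟨h1, h⟩
    exact ⟨h1.setReg (by decide) (by decide), by simpa using h⟩
  · rintro k τ s' ⟨-, -, -, -, -, -, -, h1, h2⟩
    have := hmono k h2
    omega
  · rintro k τ s' hk hs0 hs34 ⟨h1, h2, h3, h4, h5, h6, h7, h8, h9⟩
    have hsum : ∑ i ∈ (Finset.range (k + 1)).filter P, w i =
        ∑ i ∈ (Finset.range k).filter P, w i + if P k then w k else 0 := by
      rw [Finset.range_add_one, Finset.filter_insert]
      split_ifs
      · rw [Finset.sum_insert (by simp), add_comm]
      · simp
    refine Halts.mono (R := fun t s'' => (∀ i < k + 1, P i → ∀ j, s''.arr 3 i j =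
      if Relation.ReflTransGen R i j then 1 else 0) ∧ (∀ i, k + 1 ≤ i → ∀ j, s''.arr 3 i j = 0) ∧
      t ≤ 5 + if P k then w k else 0) ?_ ?_
    · have hskip : ¬ P k → (∀ i < k + 1, P i → ∀ j, s'.arr 3 i j =
          if Relation.ReflTransGen R i j then 1 else 0) ∧ ∀ i, k + 1 ≤ i → ∀ j, s'.arr 3 i j = 0 := by
        refine fun hPk => ⟨fun i hi hPi => ?_, fun i hi => h7 i (by omega)⟩
        rcases Nat.lt_succ_iff_lt_or_eq.1 hi with hi | rfl
        · exact h6 i hi hPi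
        · exact absurd hPi hPk
      simp only [halts_seq, halts_load, halts_ite, halts_skip, holds_eq, setReg_reg, setReg_arr]
      simp only [Nat.reduceEqDiff, if_true, if_false, h1.zero, hs34, h2, h3, hmate]
      refine ⟨fun h => ?_, fun h => ⟨fun h' => ?_, fun h' => ?_⟩⟩
      · obtain ⟨a, b⟩ := hskip fun hPk => hPk.1 h
        exact ⟨a, b, by omega⟩
      · have hPk : P k := ⟨h, h'⟩
        have hC : ∀ u ∈ contractionSet n (fun u v => A u v ≠ 0) own k, u < n := fun u hu => by
          simp only [contractionSet, Finset.mem_filter, Finset.mem_range] at hu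
          exact hu.1
        refine (halts_contractProg (i := k) (R := R)
          (C := contractionSet n (fun u v => A u v ≠ 0) own k)
          ((h1.setReg (by decide) (by decide)).setReg (by decide) (by decide)) (by simpa using hs34)
          (fun u => (hM.mem_contractionSet hk).2) (fun u hu l hl => ?_) (fun u hu x hx => ?_)
          (fun u hu => ?_) (fun j => ?_)).mono fun t s'' he ⟨g1, ⟨q, tail, g2⟩, g3⟩ => ⟨?_, ?_, ?_⟩
        · simp only [setReg_arr, h4, h5] at hl ⊢
          exact (hlist u (hC u hu)).sound l hl
        · obtain ⟨v, hv, huv, hvx⟩ := hx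
          simp only [setReg_arr, h4, h5]
          exact (hlist u (hC u hu)).complete v hv x huv hvx
        · simp only [setReg_arr, h5]
          rw [(hlist u (hC u hu)).card_eq]
          convert hM.card_succ_le hk hu
        · exact h7 k le_rfl j
        · intro i hi hPi j
          rcases Nat.lt_succ_iff_lt_or_eq.1 hi with hi | rfl
          · rw [g1 i hi.ne]
            exact h6 i hi hPi j
          · exact g2.mark_eq j
        · intro i hi j
          rw [g1 i (by omega)]
          exact h7 i (by omega) j
        · rw [if_pos hPk]
          simp only [hw]
          omega
      · obtain ⟨a, b⟩ := hskip fun hPk => h' hPk.2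
        exact ⟨a, b, by omega⟩
    · rintro t s'' he ⟨g1, g2, g3⟩
      exact ⟨h1.exec he (by decide) (by decide) (by decide),
        by rw [he.arr_eq (by decide), h2], by rw [he.arr_eq (by decide), h3],
        by rw [he.arr_eq (by decide), h4], by rw [he.arr_eq (by decide), h5], g1, g2,
        by rw [hsum]; omega, hk⟩
  · exact ⟨hb, rfl, rfl, rfl, rfl, by simp, fun i _ => hrow i, by simp, by simp⟩
  · rintro t s' - ⟨τ, ⟨-, -, -, -, -, h6, -, h8, -⟩, rfl⟩
    refine ⟨fun i hi ha hb => h6 i hi ⟨ha, hb⟩, ?_⟩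
    change _ ≤ 7 * n + 2 + ∑ i ∈ (Finset.range n).filter P, w i
    omega

end ContractionProgram

/-! ### The contraction detection program -/

section ContractionDetection

variable {n : ℕ} {E : Fin n → Fin n → Prop}

theorem inputStore_adj (Q : Finset (Fin n)) (u v : Fin n) :
    (inputStore E Q).arr 0 u v ≠ 0 ↔ E u v := by
  simp [inputStore, Fin.val_inj]

theorem inputStore_query (Q : Finset (Fin n)) (u : Fin n) :
    (inputStore E Q).arr 1 0 u ≠ 0 ↔ u ∈ Q := by
  simp [inputStore, Fin.val_inj]

theorem inputStore_arr (Q : Finset (Fin n)) {a : ℕ} (h0 : a ≠ 0) (h1 : a ≠ 1) :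
    (inputStore E Q).arr a = 0 := by
  ext i j
  simp [inputStore, h0, h1]

theorem inputStore_eq_replaceArr (Q : Finset (Fin n)) :
    inputStore E Q = (inputStore E ∅).replaceArr 1 ((inputStore E Q).arr 1) := by
  simp only [inputStore, Store.replaceArr, Store.mk.injEq, true_and]
  ext a i j
  by_cases ha : a = 1
  · subst ha
    simp
  · simp [ha]

/-- Computes a maximum matching: a nearly maximum one by an auction, and the rest by augmentation. -/
def matchProg : Prog := .seq computeThreshold (.seq auctionProg improveProg)

/-- The auction costs O(n² (K + 1)) and leaves at most K links missing, so at most K + 1 searches of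
cost O(n²) + O(1) follow. The run is made for the empty query set and transported to other query
sets later. -/
theorem halts_matchProg (E : Fin n → Fin n → Prop) :
    Halts matchProg (inputStore E ∅) fun t s' => Base n ((inputStore E ∅).arr 0) s' ∧
      Mat n (fun u v => (inputStore E ∅).arr 0 u v ≠ 0) (s'.arr 2 0) (s'.arr 4 0) ∧
      (¬ ∃ p, IsAugmentingPath E (toMatching n (s'.arr 2 0)) p) ∧
      ∃ K, (∀ k, K = k + 1 → k * (k + 1) < 2 * n) ∧ t ≤ 150 * (n ^ 2 * (K + 1) + K + 1) := by
  have hb : Base n ((inputStore E ∅).arr 0) (inputStore E ∅) :=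
    ⟨by simp [inputStore], by simp [inputStore], rfl⟩
  rw [matchProg, halts_seq]
  refine (halts_computeThreshold (n := n) (by simp [inputStore]) (by simp [inputStore])
    (by simp [inputStore])).mono fun t₁ s₁ he₁ ⟨K, h3, hK, hK', ht₁⟩ => ?_
  have harr : ∀ a, a ≠ 0 → a ≠ 1 → a ∉ computeThreshold.arrs → s₁.arr a 0 = 0 := fun a h0 h1 h2 => by
    rw [he₁.arr_eq h2, inputStore_arr ∅ h0 h1]
    rfl
  rw [halts_seq]
  refine (halts_auctionProg (hb.exec he₁ (by decide) (by decide) (by decide)) h3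
    (by rw [he₁.reg_eq (by decide)]; simp [inputStore]) (harr 2 (by decide) (by decide) (by decide))
    (harr 4 (by decide) (by decide) (by decide))
    (harr 5 (by decide) (by decide) (by decide))).mono fun t₂ s₂ he₂ ⟨hA, hend, ht₂⟩ => ?_
  have hb₂ := (hb.exec he₁ (by decide) (by decide) (by decide)).exec he₂ (by decide) (by decide)
    (by decide)
  have hD : ∀ M, IsMatching E M → M.card ≤ (matched n (s₂.arr 2 0)).card + K := by
    intro M hM
    have h := hA.card_le (fun u v => (inputStore_adj ∅ u v).2) hend hM
    rcases Nat.eq_zero_or_pos K with rfl | hpos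
    · have := card_le_of_isMatching hM
      omega
    -- If K + 1 links were missing, duality would give K (K + 1) ≤ n, against 2 n ≤ K (K + 1) and K
    -- > 0.
    · by_contra! hlt
      have : K * ((matched n (s₂.arr 2 0)).card + K + 1) ≤ K * M.card := Nat.mul_le_mul_left _ hlt
      nlinarith
  refine (halts_improveProg hb₂ hA.mat (inputStore_adj ∅) hD).mono
    fun t₃ s₃ _ ⟨k1, k2, k3, k4⟩ => ⟨k1, k2, k3, K, hK', ?_⟩
  have hn : n ≤ n ^ 2 := Nat.le_self_pow two_ne_zero n
  have hnK : n * K ≤ n ^ 2 * K := Nat.mul_le_mul_right _ hn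
  nlinarith

/-- Computes a maximum matching and the contractions of the unmatched queried states. -/
def contractionDetection : Prog := .seq matchProg (.seq listProg contractionsProg)

/-- Minimality says (K − 1) K < 2 n for K > 0, so K ≤ 3 √n for n ≥ 1. Then n² (K + 1) ≤ 4 n² √n and
K ≤ 3 n² √n, whence the constant 7. -/
theorem cast_bound_le {K : ℕ} (hK : ∀ k, K = k + 1 → k * (k + 1) < 2 * n) :
    ((n ^ 2 * (K + 1) + K + 1 : ℕ) : ℝ) ≤ 7 * ((n : ℝ) ^ (5 / 2 : ℝ) + 1) := by
  rcases Nat.eq_zero_or_pos n with rfl | hn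
  · have : K = 0 := by
      by_contra h0
      obtain ⟨k, rfl⟩ := Nat.exists_eq_succ_of_ne_zero h0
      simpa using hK k rfl
    subst this
    norm_num
  · have hn1 : (1 : ℝ) ≤ n := by exact_mod_cast hn
    obtain ⟨r, hr⟩ : ∃ r, r = Real.sqrt n := ⟨_, rfl⟩
    have hr1 : 1 ≤ r := by rw [hr]; exact Real.one_le_sqrt.2 hn1
    have hrr : r * r = n := by rw [hr]; exact Real.mul_self_sqrt (by positivity)
    have hpow : (n : ℝ) ^ (5 / 2 : ℝ) = n ^ 2 * r := by
      rw [show (5 / 2 : ℝ) = (2 : ℕ) + 1 / 2 by norm_num, Real.rpow_add (by linarith),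
        Real.rpow_natCast, hr, Real.sqrt_eq_rpow]
    have hKr : (K : ℝ) ≤ 3 * r := by
      by_contra! hlt
      obtain ⟨k, rfl⟩ : ∃ k, K = k + 1 := ⟨K - 1, by
        have : (0 : ℝ) < K := by linarith
        have : 0 < K := by exact_mod_cast this
        omega⟩
      have h1 : ((k * (k + 1) : ℕ) : ℝ) < ((2 * n : ℕ) : ℝ) := by exact_mod_cast hK k rfl
      push_cast at h1 hlt
      nlinarith
    rw [hpow]
    push_cast
    have hn2 : (1 : ℝ) ≤ (n : ℝ) ^ 2 := one_le_pow₀ hn1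
    have h1 : (n : ℝ) ^ 2 * (K + 1) ≤ (n : ℝ) ^ 2 * (4 * r) :=
      mul_le_mul_of_nonneg_left (by linarith) (by positivity)
    have h2 : r ≤ (n : ℝ) ^ 2 * r := le_mul_of_one_le_left (by linarith) hn2
    linarith

/-- `M` has to be fixed before `Q`. The matching phase neither reads nor writes array `1`, so by
`Exec.replaceArr` its run without queries is its run for every `Q`. -/
theorem halts_contractionDetection (E : Fin n → Fin n → Prop) :
    ∃ M, IsMatching E M ∧ (¬ ∃ p, IsAugmentingPath E M p) ∧ ∀ Q : Finset (Fin n),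
      Halts contractionDetection (inputStore E Q) fun t s => IsOutput E Q M s ∧
        (t : ℝ) ≤ 1300 * ((n : ℝ) ^ (5 / 2 : ℝ) +
          ∑ i ∈ Q ∩ unmatched M, ((contraction E M i).ncard : ℝ) ^ 2 + 1) := by
  classical
  obtain ⟨t₁, s₁, he₁, hb, hM, hp, K, hK, ht₁⟩ := halts_matchProg E
  set A := (inputStore E ∅).arr 0 with hA
  have hadj : ∀ u v : Fin n, A u v ≠ 0 ↔ E u v := inputStore_adj ∅
  obtain ⟨mate, hmate⟩ : ∃ mate, s₁.arr 2 0 = mate := ⟨_, rfl⟩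
  obtain ⟨own, hown⟩ : ∃ own, s₁.arr 4 0 = own := ⟨_, rfl⟩
  rw [hmate, hown] at hM
  rw [hmate] at hp
  refine ⟨toMatching n mate, hM.isMatching hadj, hp, fun Q => ?_⟩
  have he := he₁.replaceArr ((inputStore E Q).arr 1) (a := 1) (by decide) (by decide)
  rw [← inputStore_eq_replaceArr] at he
  obtain ⟨s₂, hs₂⟩ : ∃ s₂, s₁.replaceArr 1 ((inputStore E Q).arr 1) = s₂ := ⟨_, rfl⟩
  rw [hs₂] at he
  have hreg : s₂.reg = s₁.reg := by rw [← hs₂]; rfl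
  have harr : ∀ a ≠ 1, s₂.arr a = s₁.arr a := fun a ha => by
    rw [← hs₂]
    exact Function.update_of_ne ha _ _
  have harr1 : s₂.arr 1 = (inputStore E Q).arr 1 := by
    rw [← hs₂]
    simp [Store.replaceArr]
  have hb₂ : Base n A s₂ := ⟨by rw [hreg, hb.size], by rw [hreg, hb.zero],
    by rw [harr 0 (by decide), hb.adj]⟩
  rw [contractionDetection, halts_seq]
  refine ⟨t₁, s₂, he, ?_⟩
  beta_reduce
  rw [halts_seq]
  refine (halts_listProg hb₂).mono fun t₃ s₃ he₃ ⟨hlist, ht₃⟩ => ?_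
  rw [harr 4 (by decide), hown] at hlist
  have hQ : s₃.arr 1 = (inputStore E Q).arr 1 := by rw [he₃.arr_eq (by decide), harr1]
  have hmate₃ : s₃.arr 2 0 = mate := by rw [he₃.arr_eq (by decide), harr 2 (by decide), hmate]
  have hrow : ∀ i j, s₃.arr 3 i j = 0 := fun i j => by
    rw [he₃.arr_eq (by decide), he.arr_eq (by decide), inputStore_arr Q (by decide) (by decide)]
    rfl
  refine (halts_contractionsProg (hb₂.exec he₃ (by decide) (by decide) (by decide)) hM hmate₃ hlist
    hrow).mono fun t₄ s₄ he₄ ⟨hout, ht₄⟩ => ?_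
  rw [hQ] at hout ht₄
  have hmate₄ : s₄.arr 2 0 = mate := by rw [he₄.arr_eq (by decide), hmate₃]
  refine ⟨⟨fun u v h => ?_, fun u hu => ?_, fun i hi j => ?_⟩, ?_⟩
  · rw [hmate₄]
    exact mem_toMatching.1 h
  · rw [hmate₄]
    exact hM.mem_unmatched_iff.1 hu
  · rw [Finset.mem_inter, hM.mem_unmatched_iff] at hi
    rw [hout i i.2 ((inputStore_query Q i).2 hi.1) hi.2 j]
    simp only [hM.contraction_iff hadj]
  · have hsum : ∑ i ∈ (Finset.range n).filter (fun i => (inputStore E Q).arr 1 0 i ≠ 0 ∧ mate i = 0),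
        20 * (contractionSet n (fun u v => A u v ≠ 0) own i).card ^ 2 =
        20 * ∑ i ∈ Q ∩ unmatched (toMatching n mate),
          (contraction E (toMatching n mate) i).ncard ^ 2 := by
      rw [← Finset.mul_sum]
      congr 1
      symm
      refine Finset.sum_bij (fun i _ => (i : ℕ)) (fun i hi => ?_) (fun _ _ _ _ h => Fin.ext h)
        (fun x hx => ?_) (fun i _ => by rw [hM.card_contractionSet hadj])
      · rw [Finset.mem_inter, hM.mem_unmatched_iff] at hi
        rw [Finset.mem_filter, inputStore_query]
        exact ⟨Finset.mem_range.2 i.2, hi⟩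
      · rw [Finset.mem_filter, Finset.mem_range] at hx
        obtain ⟨hxn, hxQ, hx0⟩ := hx
        refine ⟨⟨x, hxn⟩, ?_, rfl⟩
        rw [Finset.mem_inter, hM.mem_unmatched_iff]
        exact ⟨(inputStore_query Q ⟨x, hxn⟩).1 hxQ, hx0⟩
    rw [hsum] at ht₄
    have hn : n ≤ n ^ 2 := Nat.le_self_pow two_ne_zero n
    have htot : t₁ + (t₃ + t₄) ≤ 172 * (n ^ 2 * (K + 1) + K + 1) + 20 *
        ∑ i ∈ Q ∩ unmatched (toMatching n mate),
          (contraction E (toMatching n mate) i).ncard ^ 2 := by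
      nlinarith
    have hcast : ((t₁ + (t₃ + t₄) : ℕ) : ℝ) ≤ 172 * ((n ^ 2 * (K + 1) + K + 1 : ℕ) : ℝ) + 20 *
        ∑ i ∈ Q ∩ unmatched (toMatching n mate),
          ((contraction E (toMatching n mate) i).ncard : ℝ) ^ 2 := by
      exact_mod_cast htot
    have hS : 0 ≤ ∑ i ∈ Q ∩ unmatched (toMatching n mate),
        ((contraction E (toMatching n mate) i).ncard : ℝ) ^ 2 :=
      Finset.sum_nonneg fun _ _ => by positivity
    have := cast_bound_le hK
    linarith

end ContractionDetection

end SensorRecovery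

/-! ### The theorem -/

theorem mainTheorem1 :
    -- recovery from the failure of an alpha-sensor
    (∀ (n : ℕ) (E : Fin n → Fin n → Prop) (M : Finset (Fin n × Fin n)),
      IsMaximumMatching E M → ∀ i ∈ unmatched M, ∀ j ∈ contraction E M i,
        (∃ M', IsMaximumMatching E M' ∧ j ∈ unmatched M') ∧
        ∀ (m : ℕ) (σ : Fin m → Fin n) (Nα Nβ : Fin m → Fin m → Prop) (f : Fin m),
          -- the network before the failure: unmatched states and parent SCCs are measured
          (∀ x ∈ unmatched M, ∃ s, σ s = x) →
          (∀ P, IsParentSCC E P → ∃ s, σ s ∈ P) →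
          -- alpha-sensors are hubs of the first network
          (∀ s, Nα s s) → (∀ a, σ a ∈ unmatched M → ∀ s, Nα s a) →
          -- the second network is strongly connected
          (∀ s, Nβ s s) → (∀ s t, Relation.ReflTransGen Nβ s t) →
          -- the sensor `f` fails; it was not needed in a parent SCC not containing `x_j`
          σ f = i →
          (∀ P, IsParentSCC E P → i ∈ P → j ∉ P → ∃ s, s ≠ f ∧ σ s ∈ P) →
          -- a new sensor measuring `x_j`, with the connections of `f`
          StructurallyObservable E (Function.update σ f j) ∧
          StructurallyDistributedObservable E (Function.update σ f j) Nα Nβ) ∧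
    -- correctness of the algorithm
    (∀ (n : ℕ) (E : Fin n → Fin n → Prop) (M₀ : Finset (Fin n × Fin n)), IsMatching E M₀ →
      (∀ k M, AugmentIter E k M₀ M → IsMatching E M ∧ M.card = M₀.card + k ∧ k ≤ n) ∧
      (∃ M, AugmentLoopEnds E M₀ M) ∧
      ∀ M, AugmentLoopEnds E M₀ M → IsMaximumMatching E M) ∧
    -- running time of the algorithm
    (∃ (prog : Prog) (C : ℝ), ∀ (n : ℕ) (E : Fin n → Fin n → Prop),
      ∃ M₀ M, IsMatching E M₀ ∧ AugmentLoopEnds E M₀ M ∧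
        ∀ Q : Finset (Fin n), ∃ (t : ℕ) (s : Store),
          Exec prog (inputStore E Q) t s ∧ IsOutput E Q M s ∧
          (t : ℝ) ≤ C * ((n : ℝ) ^ (5 / 2 : ℝ) +
            ∑ i ∈ Q ∩ unmatched M, ((contraction E M i).ncard : ℝ) ^ 2 + 1)) := by
  refine ⟨fun n E M hM i hi j hj => ⟨?_, ?_⟩, fun n E M₀ hM₀ => augmentation_correct hM₀, ?_⟩
  · obtain ⟨M', hM', h⟩ := exists_maximum_matching_of_contraction hM hi hj
    exact ⟨M', hM', (h j).2 (Or.inr rfl)⟩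
  · intro m σ Nα Nβ f hσ hP hαs hα hβs hβ hf hfP
    exact recovery hM hi hj hσ hP hαs hα hβs hβ hf hfP
  · refine ⟨contractionDetection, 1300, fun n E => ?_⟩
    obtain ⟨M, hM, hp, hQ⟩ := halts_contractionDetection E
    -- The start of the loop is existentially quantified: started at `M` itself, the loop ends after
    -- no pass because `M` has no augmenting path.
    exact ⟨M, M, hM, ⟨⟨0, .zero M⟩, hp⟩, hQ⟩
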